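/- **Setting.** Let the metatheory be (the internal language of) a regular, locally cartesian closed category $\mathcal{E}$ with finite disjoint universal coproducts and a natural number object $\mathbb{N}$. Let $\square$ be an internal category of cubes in $\mathcal{E}$: an internal category whose objects are $[n]$, $n : \mathbb{N}$, where $[0]$ is terminal and $[n+1]$ is the product $[n]\times[1]$, with two points $0,1 : [0]\to I := [1]$ that are told apart by some function $\square([0],[1])\to 2 = 1+1$. *Cubical sets* are the internal presheaves on $\square$; $\Delta$ is the constant presheaf functor, $\Gamma$ is evaluation at $[0]$, and $I$ also denotes the representable $\mathbf{y}[1]$. Fix a class of *cofibrations* of cubical sets: monomorphisms $m$, stable under pullback, containing each $0\to B$, and with $\Gamma(m)$ a complemented subobject. Fix also a class of *admissible* maps $r:B\to I$, closed under precomposition and containing every map that factors through a constant cubical set. A map $f : X\to Y$ is a *Kan fibration* if it has fillers for open boxes: for each cofibration $m:A\to B$, admissible $r: B\to I$, and maps $v: I\times B\to Y$, $w : I\times A\to X$, $x_0 : B\to X$ with $f w = v (I\times m)$, $f x_0 = v\langle r,\mathrm{id}\rangle$, $w\langle rm,\mathrm{id}\rangle = x_0m$, there is $h : I\times B\to X$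 with $fh=v$, $h(I\times m)=w$, $h\langle r,\mathrm{id}\rangle=x_0$. **Definitions.** An *h-proposition* is a Kan fibration $f:X\to Y$ such that $\mathrm{Path}_Y(X)\to X\times_Y X$ has a section, where $\mathrm{Path}_Y(X)=Y\times_{Y^I}X^I$, i.e. the two projections $X\times_Y X\to X$ are homotopic over $Y$. A *propositional truncation* of $W\to B$ is an h-proposition $\|W\|_B\to B$ with a map $W\to\|W\|_B$ over $B$ such that for each $\sigma : Z\to B$ and each h-proposition $P\to Z$, if there is a map $\sigma^*W\to P$ over $Z$ then there is a map $\sigma^*\|W\|_B\to P$ over $Z$. For $f:X\to Y$, $\neg X\to Y$ is the exponential $0^X$ in the slice over $Y$. An h-proposition $f : X\to Y$ is *weakly $\Pi^0_1$* if there is an h-proposition $R\to Y\times\Delta\mathbb{N}$ such that $R+\neg X$ (with $\neg X$ pulled back to $Y\times\Delta\mathbb{N}$) has a propositional truncation over $Y\times\Delta\mathbb{N}$ with a section, and such that there are maps over $Y$ in both directions between $X$ and the dependent product $\prod_{n:\Delta\mathbb{N}}R_{y,n}$. In $\mathcal{E}$, a monomorphism $A\to B$ is *$\Pi^0_1$*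 if there is $g : B\times\mathbb{N}\to 2$ such that, internally, for all $b:B$, $A_b$ is inhabited iff $g(b,n)=0$ for all $n$. A map $1\to\Omega_{\Pi^0_1}$ *classifies* the $\Pi^0_1$ monomorphisms if each of them is a pullback of it along exactly one map. **Theorem.** Suppose that $1\to\Omega_{\Pi^0_1}$ classifies the $\Pi^0_1$ monomorphisms in $\mathcal{E}$. Then every weakly $\Pi^0_1$ h-proposition $f : X\to Y$ in cubical sets is a homotopy pullback of the Kan fibration $\Delta(1)\to\Delta(\Omega_{\Pi^0_1})$: there is a map $\chi : Y\to\Delta(\Omega_{\Pi^0_1})$ such that $f$ is homotopy equivalent over $Y$ to the pullback of $\Delta(1)\to\Delta(\Omega_{\Pi^0_1})$ along $\chi$. -/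

import Mathlib

/-!
Cubical sets over an arbitrary metatheory.

The metatheory is a category `E` that is regular, locally cartesian closed, has finite disjoint
universal coproducts (`FinitaryExtensive`) and a natural number object; types of the metatheory are
the objects of `E`.  Cubical sets are internal presheaves in `E` on an internal category of cubes.
Internal statements are spelled out through generalised elements: an "element of `A` in context
`J`" is a map `J ⟶ A`.
-/

open CategoryTheory CategoryTheory.Limits

universe v u

noncomputable section

namespace CubicalHProp

/-! ### The metatheory -/

/-- `E` is locally cartesian closed: each pullback functor `E/Y ⥤ E/X` has a right adjoint
(dependent product). -/
class LocallyCartesianClosed (E : Type u) [Category.{v} E] [HasPullbacks E] : Prop where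
  isLeftAdjoint_pullback : ∀ {X Y : E} (f : X ⟶ Y), (Over.pullback f).IsLeftAdjoint

/-- A natural number object. -/
structure NatObj (E : Type u) [Category.{v} E] [HasTerminal E] where
  nat : E
  zero : ⊤_ E ⟶ nat
  succ : nat ⟶ nat
  exists_unique_rec : ∀ {A : E} (a : ⊤_ E ⟶ A) (f : A ⟶ A),
    ∃! h : nat ⟶ A, zero ≫ h = a ∧ succ ≫ h = h ≫ f

/-- The object `2 = 1 + 1` of the metatheory; `0 : 2` is `coprod.inl`, `1 : 2` is `coprod.inr`. -/
abbrev Two (E : Type u) [Category.{v} E] [HasTerminal E] [HasBinaryCoproducts E] : E :=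
  (⊤_ E) ⨿ (⊤_ E)

/-- A monomorphism `m : A ⟶ B` is `Π⁰₁` if there is `g : B × ℕ ⟶ 2` such that, internally, for all
`b : B`, the fibre `A_b` is inhabited iff `g (b, n) = 0` for all `n`. -/
def IsPi01Mono {E : Type u} [Category.{v} E] [HasFiniteLimits E] [HasFiniteCoproducts E]
    (N : NatObj E) {A B : E} (m : A ⟶ B) : Prop :=
  Mono m ∧ ∃ g : B ⨯ N.nat ⟶ Two E, ∀ {J : E} (b : J ⟶ B),
    (∃ a : J ⟶ A, a ≫ m = b) ↔
      prod.map b (𝟙 N.nat) ≫ g = terminal.from (J ⨯ N.nat) ≫ coprod.inl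

/-- `t : 1 ⟶ Ω` classifies the `Π⁰₁` monomorphisms: each of them is a pullback of `t` along exactly
one map.  (It is not demanded that `t` is itself `Π⁰₁`.) -/
def IsPi01Classifier {E : Type u} [Category.{v} E] [HasFiniteLimits E] [HasFiniteCoproducts E]
    (N : NatObj E) {Ω : E} (t : ⊤_ E ⟶ Ω) : Prop :=
  ∀ {A B : E} (m : A ⟶ B), IsPi01Mono N m →
    ∃! χ : B ⟶ Ω, IsPullback (terminal.from A) m t χ

/-! ### Internal categories and internal presheaves -/

/-- An internal category in `E` with object of objects `O`.  The composition is given on generalised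
elements, naturally in the context, in diagrammatic order. -/
structure IntCat {E : Type u} [Category.{v} E] (O : E) where
  hom : E
  dom : hom ⟶ O
  cod : hom ⟶ O
  id : O ⟶ hom
  id_dom : id ≫ dom = 𝟙 O
  id_cod : id ≫ cod = 𝟙 O
  comp : ∀ {J : E} (s t : J ⟶ hom), s ≫ cod = t ≫ dom → (J ⟶ hom)
  comp_natural : ∀ {J K : E} (a : K ⟶ J) (s t : J ⟶ hom) (h : s ≫ cod = t ≫ dom),
    a ≫ comp s t h = comp (a ≫ s) (a ≫ t) (by simp only [Category.assoc, h])
  comp_dom : ∀ {J : E} (s t : J ⟶ hom) (h : s ≫ cod = t ≫ dom), comp s t h ≫ dom = s ≫ dom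
  comp_cod : ∀ {J : E} (s t : J ⟶ hom) (h : s ≫ cod = t ≫ dom), comp s t h ≫ cod = t ≫ cod
  id_comp : ∀ {J : E} (s : J ⟶ hom),
    comp (s ≫ dom ≫ id) s (by simp only [Category.assoc, id_cod, Category.comp_id]) = s
  comp_id : ∀ {J : E} (s : J ⟶ hom),
    comp s (s ≫ cod ≫ id) (by simp only [Category.assoc, id_dom, Category.comp_id]) = s
  assoc : ∀ {J : E} (r s t : J ⟶ hom) (h : r ≫ cod = s ≫ dom) (h' : s ≫ cod = t ≫ dom),
    comp (comp r s h) t ((comp_cod r s h).trans h') =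
      comp r (comp s t h') (h.trans (comp_dom s t h').symm)

/-- The object of arrows from `a` to `b`, for two global objects `a`, `b` of an internal category. -/
abbrev IntCat.homBetween {E : Type u} [Category.{v} E] [HasFiniteLimits E] {O : E} (C : IntCat O)
    (a b : ⊤_ E ⟶ O) : E :=
  pullback (prod.lift C.dom C.cod) (prod.lift a b)

/-- An internal presheaf on `C`: an object `p : X ⟶ O` over the object of objects with a right
action `x, s ↦ x · s` of the arrows.  An element `x` of `X` with `p x = m` is an element of `X_m`,
and `x · s` for `s : n ⟶ m` is its restriction `X_s x`, an element of `X_n`. -/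
structure Psh {E : Type u} [Category.{v} E] {O : E} (C : IntCat O) where
  obj : E
  p : obj ⟶ O
  act : ∀ {J : E} (x : J ⟶ obj) (s : J ⟶ C.hom), s ≫ C.cod = x ≫ p → (J ⟶ obj)
  act_natural : ∀ {J K : E} (a : K ⟶ J) (x : J ⟶ obj) (s : J ⟶ C.hom) (h : s ≫ C.cod = x ≫ p),
    a ≫ act x s h = act (a ≫ x) (a ≫ s) (by simp only [Category.assoc, h])
  act_p : ∀ {J : E} (x : J ⟶ obj) (s : J ⟶ C.hom) (h : s ≫ C.cod = x ≫ p),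
    act x s h ≫ p = s ≫ C.dom
  act_id : ∀ {J : E} (x : J ⟶ obj),
    act x (x ≫ p ≫ C.id) (by simp only [Category.assoc, C.id_cod, Category.comp_id]) = x
  act_comp : ∀ {J : E} (x : J ⟶ obj) (s r : J ⟶ C.hom) (h : s ≫ C.cod = x ≫ p)
    (h' : r ≫ C.cod = s ≫ C.dom),
    act (act x s h) r (h'.trans (act_p x s h).symm) =
      act x (C.comp r s h') ((C.comp_cod r s h').trans h)

namespace Psh

variable {E : Type u} [Category.{v} E] {O : E} {C : IntCat O}

/-- Maps of internal presheaves: maps over the object of objects that commute with the actions. -/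
@[ext]
structure Hom (X Y : Psh C) where
  app : X.obj ⟶ Y.obj
  app_p : app ≫ Y.p = X.p
  app_act : ∀ {J : E} (x : J ⟶ X.obj) (s : J ⟶ C.hom) (h : s ≫ C.cod = x ≫ X.p),
    X.act x s h ≫ app = Y.act (x ≫ app) s (by rw [Category.assoc, app_p, h])

instance : Category (Psh C) where
  Hom X Y := Hom X Y
  id X := { app := 𝟙 _, app_p := by simp, app_act := by intros; simp }
  comp f g :=
    { app := f.app ≫ g.app
      app_p := by rw [Category.assoc, g.app_p, f.app_p]
      app_act := by
        intro J x s h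
        rw [← Category.assoc, f.app_act, g.app_act]
        simp only [Category.assoc] }
  id_comp f := Hom.ext (Category.id_comp _)
  comp_id f := Hom.ext (Category.comp_id _)
  assoc f g h := Hom.ext (Category.assoc _ _ _)

@[ext]
theorem hom_ext {X Y : Psh C} {f g : X ⟶ Y} (h : f.app = g.app) : f = g := Hom.ext h

@[simp]
theorem id_app (X : Psh C) : Hom.app (𝟙 X) = 𝟙 X.obj := rfl

@[simp]
theorem comp_app {X Y Z : Psh C} (f : X ⟶ Y) (g : Y ⟶ Z) : (f ≫ g).app = f.app ≫ g.app := rfl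

theorem act_congr (X : Psh C) {J : E} {x x' : J ⟶ X.obj} {s s' : J ⟶ C.hom} (hx : x = x')
    (hs : s = s') (h : s ≫ C.cod = x ≫ X.p) :
    X.act x s h = X.act x' s' (by rw [← hx, ← hs, h]) := by
  subst hx hs; rfl

theorem comp_congr (C : IntCat O) {J : E} {s s' t t' : J ⟶ C.hom} (hs : s = s') (ht : t = t')
    (h : s ≫ C.cod = t ≫ C.dom) :
    C.comp s t h = C.comp s' t' (by rw [← hs, ← ht, h]) := by
  subst hs ht; rfl

variable [HasFiniteLimits E]

/-- The action on the product. -/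
def prodAct (X Y : Psh C) {J : E} (x : J ⟶ pullback X.p Y.p) (s : J ⟶ C.hom)
    (h : s ≫ C.cod = x ≫ pullback.fst X.p Y.p ≫ X.p) : J ⟶ pullback X.p Y.p :=
  pullback.lift
    (X.act (x ≫ pullback.fst X.p Y.p) s (by rw [h, Category.assoc]))
    (Y.act (x ≫ pullback.snd X.p Y.p) s (by rw [h, Category.assoc, pullback.condition]))
    (by rw [X.act_p, Y.act_p])

theorem prodAct_fst (X Y : Psh C) {J : E} (x : J ⟶ pullback X.p Y.p) (s : J ⟶ C.hom)
    (h : s ≫ C.cod = x ≫ pullback.fst X.p Y.p ≫ X.p) :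
    prodAct X Y x s h ≫ pullback.fst X.p Y.p =
      X.act (x ≫ pullback.fst X.p Y.p) s (by rw [h, Category.assoc]) :=
  pullback.lift_fst _ _ _

theorem prodAct_snd (X Y : Psh C) {J : E} (x : J ⟶ pullback X.p Y.p) (s : J ⟶ C.hom)
    (h : s ≫ C.cod = x ≫ pullback.fst X.p Y.p ≫ X.p) :
    prodAct X Y x s h ≫ pullback.snd X.p Y.p =
      Y.act (x ≫ pullback.snd X.p Y.p) s (by rw [h, Category.assoc, pullback.condition]) :=
  pullback.lift_snd _ _ _

/-- The binary product of internal presheaves, computed over the object of objects. -/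
def prod (X Y : Psh C) : Psh C where
  obj := pullback X.p Y.p
  p := pullback.fst X.p Y.p ≫ X.p
  act x s h := prodAct X Y x s h
  act_natural a x s h := by
    apply pullback.hom_ext
    · rw [Category.assoc, prodAct_fst, prodAct_fst, X.act_natural]
      exact X.act_congr (Category.assoc _ _ _).symm rfl _
    · rw [Category.assoc, prodAct_snd, prodAct_snd, Y.act_natural]
      exact Y.act_congr (Category.assoc _ _ _).symm rfl _
  act_p x s h := by rw [← Category.assoc, prodAct_fst, X.act_p]
  act_id x := by
    apply pullback.hom_ext
    · rw [prodAct_fst]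
      exact (X.act_congr rfl (by simp only [Category.assoc]) _).trans (X.act_id _)
    · rw [prodAct_snd]
      exact (Y.act_congr rfl (by simp only [Category.assoc, pullback.condition_assoc]) _).trans
        (Y.act_id _)
  act_comp x s r h h' := by
    have h'' := (C.comp_cod r s h').trans h
    apply pullback.hom_ext
    · rw [prodAct_fst]
      refine (X.act_congr (prodAct_fst X Y x s h) rfl _).trans ?_
      rw [prodAct_fst X Y x (C.comp r s h') h'']
      exact X.act_comp _ s r _ h'
    · rw [prodAct_snd]
      refine (Y.act_congr (prodAct_snd X Y x s h) rfl _).trans ?_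
      rw [prodAct_snd X Y x (C.comp r s h') h'']
      exact Y.act_comp _ s r _ h'

/-- First projection. -/
def fst (X Y : Psh C) : X.prod Y ⟶ X where
  app := pullback.fst X.p Y.p
  app_p := rfl
  app_act _ _ _ := pullback.lift_fst _ _ _

/-- Second projection. -/
def snd (X Y : Psh C) : X.prod Y ⟶ Y where
  app := pullback.snd X.p Y.p
  app_p := pullback.condition.symm
  app_act _ _ _ := pullback.lift_snd _ _ _

/-- Pairing. -/
def lift {Z X Y : Psh C} (f : Z ⟶ X) (g : Z ⟶ Y) : Z ⟶ X.prod Y where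
  app := pullback.lift f.app g.app (f.app_p.trans g.app_p.symm)
  app_p := (pullback.lift_fst_assoc _ _ _ _).trans f.app_p
  app_act {J} x s h := by
    have w : f.app ≫ X.p = g.app ≫ Y.p := f.app_p.trans g.app_p.symm
    have h' : s ≫ C.cod = (x ≫ pullback.lift f.app g.app w) ≫ pullback.fst X.p Y.p ≫ X.p := by
      rw [Category.assoc, pullback.lift_fst_assoc, f.app_p, h]
    change Z.act x s h ≫ pullback.lift f.app g.app w = prodAct X Y _ s h'
    apply pullback.hom_ext
    · rw [Category.assoc, pullback.lift_fst, prodAct_fst]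
      exact (f.app_act _ _ _).trans
        (X.act_congr (by rw [Category.assoc, pullback.lift_fst]) rfl _)
    · rw [Category.assoc, pullback.lift_snd, prodAct_snd]
      exact (g.app_act _ _ _).trans
        (Y.act_congr (by rw [Category.assoc, pullback.lift_snd]) rfl _)

theorem lift_fst {Z X Y : Psh C} (f : Z ⟶ X) (g : Z ⟶ Y) : lift f g ≫ fst X Y = f :=
  hom_ext (pullback.lift_fst _ _ _)

theorem lift_snd {Z X Y : Psh C} (f : Z ⟶ X) (g : Z ⟶ Y) : lift f g ≫ snd X Y = g :=
  hom_ext (pullback.lift_snd _ _ _)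

theorem prod_hom_ext {Z X Y : Psh C} {f g : Z ⟶ X.prod Y} (h₁ : f ≫ fst X Y = g ≫ fst X Y)
    (h₂ : f ≫ snd X Y = g ≫ snd X Y) : f = g :=
  hom_ext (pullback.hom_ext (congrArg Hom.app h₁) (congrArg Hom.app h₂))

/-- The map `f × g` between products. -/
def map {X X' Y Y' : Psh C} (f : X ⟶ X') (g : Y ⟶ Y') : X.prod Y ⟶ X'.prod Y' :=
  lift (fst X Y ≫ f) (snd X Y ≫ g)

/-- The constant presheaf at `A`: all sets of elements are `A`. -/
def const (C : IntCat O) (A : E) : Psh C where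
  obj := A ⨯ O
  p := Limits.prod.snd
  act := fun x s _ => Limits.prod.lift (x ≫ Limits.prod.fst) (s ≫ C.dom)
  act_natural a x s h := (Limits.prod.comp_lift _ _ _).trans (by simp only [Category.assoc])
  act_p x s h := Limits.prod.lift_snd _ _
  act_id x := by
    apply Limits.prod.hom_ext
    · exact Limits.prod.lift_fst _ _
    · refine (Limits.prod.lift_snd _ _).trans ?_
      rw [Category.assoc, Category.assoc, C.id_dom, Category.comp_id]
  act_comp x s r h h' := by
    apply Limits.prod.hom_ext
    · exact ((Limits.prod.lift_fst _ _).trans (Limits.prod.lift_fst _ _)).trans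
        (Limits.prod.lift_fst _ _).symm
    · exact (Limits.prod.lift_snd _ _).trans
        ((C.comp_dom _ _ _).symm.trans (Limits.prod.lift_snd _ _).symm)

/-- The constant presheaf functor `Δ`. -/
def Δ (C : IntCat O) : E ⥤ Psh C where
  obj A := const C A
  map f :=
    { app := Limits.prod.map f (𝟙 O)
      app_p := (Limits.prod.map_snd _ _).trans (Category.comp_id _)
      app_act := fun x s h => by
        apply Limits.prod.hom_ext
        · refine Eq.trans ?_ (Limits.prod.lift_fst _ _).symm
          refine (Category.assoc _ _ _).trans ?_
          refine (congrArg (_ ≫ ·) (Limits.prod.map_fst _ _)).trans ?_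
          refine (Limits.prod.lift_fst_assoc _ _ _).trans ?_
          refine (Category.assoc _ _ _).trans ?_
          exact ((Category.assoc _ _ _).trans (congrArg (x ≫ ·) (Limits.prod.map_fst _ _))).symm
        · refine Eq.trans ?_ (Limits.prod.lift_snd _ _).symm
          refine (Category.assoc _ _ _).trans ?_
          refine (congrArg (_ ≫ ·) (Limits.prod.map_snd _ _)).trans ?_
          exact (Limits.prod.lift_snd_assoc _ _ _).trans (Category.comp_id _) }
  map_id _ := hom_ext Limits.prod.map_id_id
  map_comp f g := hom_ext (Limits.prod.map_comp_id f g)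

/-- The action on a representable presheaf: precomposition. -/
def yonedaAct (C : IntCat O) (c : ⊤_ E ⟶ O) {J : E} (x : J ⟶ pullback C.cod c) (s : J ⟶ C.hom)
    (h : s ≫ C.cod = x ≫ pullback.fst C.cod c ≫ C.dom) : J ⟶ pullback C.cod c :=
  pullback.lift
    (C.comp s (x ≫ pullback.fst C.cod c) (by rw [h, Category.assoc]))
    (x ≫ pullback.snd C.cod c)
    (by rw [C.comp_cod, Category.assoc, Category.assoc, pullback.condition])

theorem yonedaAct_fst (C : IntCat O) (c : ⊤_ E ⟶ O) {J : E} (x : J ⟶ pullback C.cod c)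
    (s : J ⟶ C.hom) (h : s ≫ C.cod = x ≫ pullback.fst C.cod c ≫ C.dom) :
    yonedaAct C c x s h ≫ pullback.fst C.cod c =
      C.comp s (x ≫ pullback.fst C.cod c) (by rw [h, Category.assoc]) :=
  pullback.lift_fst _ _ _

/-- Maps into the underlying object of a representable are determined by their arrows. -/
theorem yoneda_hom_ext (C : IntCat O) (c : ⊤_ E ⟶ O) {J : E} {x y : J ⟶ pullback C.cod c}
    (h : x ≫ pullback.fst C.cod c = y ≫ pullback.fst C.cod c) : x = y :=
  pullback.hom_ext h (Subsingleton.elim _ _)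

/-- The presheaf represented by the global object `c`: its elements are the arrows with
codomain `c`. -/
def yoneda (C : IntCat O) (c : ⊤_ E ⟶ O) : Psh C where
  obj := pullback C.cod c
  p := pullback.fst C.cod c ≫ C.dom
  act x s h := yonedaAct C c x s h
  act_natural a x s h := by
    apply yoneda_hom_ext
    rw [Category.assoc, yonedaAct_fst, yonedaAct_fst, C.comp_natural]
    exact comp_congr C rfl (Category.assoc _ _ _).symm _
  act_p x s h := by rw [← Category.assoc, yonedaAct_fst, C.comp_dom]
  act_id x := by
    apply yoneda_hom_ext
    rw [yonedaAct_fst]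
    exact (comp_congr C (by simp only [Category.assoc]) rfl _).trans (C.id_comp _)
  act_comp x s r h h' := by
    apply yoneda_hom_ext
    have h'' := (C.comp_cod r s h').trans h
    rw [yonedaAct_fst]
    refine (comp_congr C rfl (yonedaAct_fst C c x s h) _).trans ?_
    rw [yonedaAct_fst C c x (C.comp r s h') h'']
    exact (C.assoc r s _ h' _).symm

end Psh

/-! ### The category of cubes and cubical sets -/

section Cubes

variable {E : Type u} [Category.{v} E] [HasFiniteLimits E] [HasFiniteCoproducts E]

/-- An internal category of cubes: an internal Lawvere theory, i.e. an internal category whose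
objects are the natural numbers `[n]`, such that `[0]` is terminal and `[n+1]` is the product
`[n] × [1]`; the interval is `I = [1]`.  It comes with two endpoints `[0] ⟶ [1]`, which are told
apart by a function from the points of `I` to `2`. -/
structure CubeCat (N : NatObj E) extends IntCat N.nat where
  bang : N.nat ⟶ hom
  bang_dom : bang ≫ dom = 𝟙 N.nat
  bang_cod : bang ≫ cod = terminal.from N.nat ≫ N.zero
  bang_unique : ∀ {J : E} (s : J ⟶ hom), s ≫ cod = terminal.from J ≫ N.zero → s = s ≫ dom ≫ bang
  projL : N.nat ⟶ hom
  projL_dom : projL ≫ dom = N.succ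
  projL_cod : projL ≫ cod = 𝟙 N.nat
  projR : N.nat ⟶ hom
  projR_dom : projR ≫ dom = N.succ
  projR_cod : projR ≫ cod = terminal.from N.nat ≫ N.zero ≫ N.succ
  exists_unique_pair : ∀ {J : E} (n : J ⟶ N.nat) (a b : J ⟶ hom), a ≫ dom = b ≫ dom →
    a ≫ cod = n → b ≫ cod = terminal.from J ≫ N.zero ≫ N.succ →
    ∃! c : J ⟶ hom, ∃ h : c ≫ cod = n ≫ N.succ,
      comp c (n ≫ projL) (by rw [h, Category.assoc, projL_dom]) = a ∧
      comp c (n ≫ projR) (by rw [h, Category.assoc, projR_dom]) = b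
  end₀ : ⊤_ E ⟶ toIntCat.homBetween N.zero (N.zero ≫ N.succ)
  end₁ : ⊤_ E ⟶ toIntCat.homBetween N.zero (N.zero ≫ N.succ)
  endpoints_separated : ∃ d : toIntCat.homBetween N.zero (N.zero ≫ N.succ) ⟶ Two E,
    end₀ ≫ d = coprod.inl ∧ end₁ ≫ d = coprod.inr

variable {N : NatObj E}

/-- Cubical sets: internal presheaves on the category of cubes. -/
abbrev CSet (Q : CubeCat N) := Psh Q.toIntCat

namespace CSet

variable (Q : CubeCat N)

/-- The interval, as a cubical set: the presheaf represented by `[1]`. -/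
abbrev I : CSet Q := Psh.yoneda Q.toIntCat (N.zero ≫ N.succ)

/-- The constant cubical set functor. -/
abbrev Δ : E ⥤ CSet Q := Psh.Δ Q.toIntCat

/-- The global sections functor `Γ`, evaluation at `[0]`. -/
def Γ : CSet Q ⥤ E where
  obj X := pullback X.p N.zero
  map {X Y} f := pullback.lift (pullback.fst X.p N.zero ≫ f.app) (pullback.snd X.p N.zero)
    (by rw [Category.assoc, f.app_p, pullback.condition])
  map_id X := pullback.hom_ext
    ((pullback.lift_fst _ _ _).trans ((Category.comp_id _).trans (Category.id_comp _).symm))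
    (Subsingleton.elim _ _)
  map_comp {X Y Z} f g := pullback.hom_ext
    (by
      refine (pullback.lift_fst _ _ _).trans ?_
      refine Eq.trans ?_ (Category.assoc _ _ _).symm
      refine Eq.trans ?_ (congrArg (_ ≫ ·) (pullback.lift_fst _ _ _).symm)
      refine Eq.trans ?_ (Category.assoc _ _ _)
      exact (Category.assoc _ _ _).symm.trans
        (congrArg (· ≫ g.app) (pullback.lift_fst _ _ _).symm))
    (Subsingleton.elim _ _)

variable {Q}

/-- The arrow `[0] ⟶ [1]` underlying a point of the interval. -/
abbrev ptArrow (e : ⊤_ E ⟶ Q.homBetween N.zero (N.zero ≫ N.succ)) : ⊤_ E ⟶ Q.hom :=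
  e ≫ pullback.fst (Limits.prod.lift Q.dom Q.cod) (Limits.prod.lift N.zero (N.zero ≫ N.succ))

theorem ptArrow_dom (e : ⊤_ E ⟶ Q.homBetween N.zero (N.zero ≫ N.succ)) :
    ptArrow e ≫ Q.dom = N.zero := by
  have h := congrArg (fun k => e ≫ k ≫ Limits.prod.fst)
    (pullback.condition (f := Limits.prod.lift Q.dom Q.cod)
      (g := Limits.prod.lift N.zero (N.zero ≫ N.succ)))
  simp only [Category.assoc, Limits.prod.lift_fst] at h
  rw [Category.assoc, h, ← Category.assoc, Subsingleton.elim (e ≫ _) (𝟙 _), Category.id_comp]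

theorem ptArrow_cod (e : ⊤_ E ⟶ Q.homBetween N.zero (N.zero ≫ N.succ)) :
    ptArrow e ≫ Q.cod = N.zero ≫ N.succ := by
  have h := congrArg (fun k => e ≫ k ≫ Limits.prod.snd)
    (pullback.condition (f := Limits.prod.lift Q.dom Q.cod)
      (g := Limits.prod.lift N.zero (N.zero ≫ N.succ)))
  simp only [Category.assoc, Limits.prod.lift_snd] at h
  rw [Category.assoc, h, ← Category.assoc, Subsingleton.elim (e ≫ _) (𝟙 _), Category.id_comp]

/-- An element `n` of the objects, composed with `[n] ⟶ [0] ⟶ [1]`. -/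
theorem constPt_comp {J : E} (n : J ⟶ N.nat)
    (e : ⊤_ E ⟶ Q.homBetween N.zero (N.zero ≫ N.succ)) :
    (n ≫ Q.bang) ≫ Q.cod = (terminal.from J ≫ ptArrow e) ≫ Q.dom := by
  rw [Category.assoc, Q.bang_cod, Category.assoc, ptArrow_dom, ← Category.assoc,
    Subsingleton.elim (n ≫ terminal.from N.nat) (terminal.from J)]

/-- The composite arrows `[n] ⟶ [0] ⟶ [1]`, for `n : J ⟶ ℕ`, as elements of the interval. -/
def constArrow {J : E} (n : J ⟶ N.nat)
    (e : ⊤_ E ⟶ Q.homBetween N.zero (N.zero ≫ N.succ)) : J ⟶ pullback Q.cod (N.zero ≫ N.succ) :=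
  pullback.lift
    (Q.comp (n ≫ Q.bang) (terminal.from J ≫ ptArrow e) (constPt_comp n e))
    (terminal.from J)
    (by rw [Q.comp_cod, Category.assoc, ptArrow_cod])

theorem constArrow_fst {J : E} (n : J ⟶ N.nat)
    (e : ⊤_ E ⟶ Q.homBetween N.zero (N.zero ≫ N.succ)) :
    constArrow n e ≫ pullback.fst Q.cod (N.zero ≫ N.succ) =
      Q.comp (n ≫ Q.bang) (terminal.from J ≫ ptArrow e) (constPt_comp n e) :=
  pullback.lift_fst _ _ _

theorem constArrow_natural {J K : E} (a : K ⟶ J) (n : J ⟶ N.nat)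
    (e : ⊤_ E ⟶ Q.homBetween N.zero (N.zero ≫ N.succ)) :
    a ≫ constArrow n e = constArrow (a ≫ n) e := by
  apply Psh.yoneda_hom_ext
  rw [Category.assoc, constArrow_fst, constArrow_fst, Q.comp_natural]
  refine Psh.comp_congr Q.toIntCat (Category.assoc _ _ _).symm ?_ _
  rw [← Category.assoc, Subsingleton.elim (a ≫ terminal.from J) (terminal.from K)]

/-- The constant map `B ⟶ I` at a point of the interval: an element of `B_n` goes to the composite
`[n] ⟶ [0] ⟶ [1]`. -/
def constPt (B : CSet Q) (e : ⊤_ E ⟶ Q.homBetween N.zero (N.zero ≫ N.succ)) : B ⟶ I Q where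
  app := constArrow B.p e
  app_p := by
    change constArrow B.p e ≫ pullback.fst Q.cod (N.zero ≫ N.succ) ≫ Q.dom = B.p
    rw [← Category.assoc, constArrow_fst, Q.comp_dom, Category.assoc, Q.bang_dom, Category.comp_id]
  app_act {J} x s h := by
    have h' : s ≫ Q.cod =
        (x ≫ constArrow B.p e) ≫ pullback.fst Q.cod (N.zero ≫ N.succ) ≫ Q.dom := by
      rw [Category.assoc, ← Category.assoc (constArrow B.p e), constArrow_fst, Q.comp_dom,
        Category.assoc, Q.bang_dom, Category.comp_id, h]
    change B.act x s h ≫ constArrow B.p e =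
      Psh.yonedaAct Q.toIntCat (N.zero ≫ N.succ) (x ≫ constArrow B.p e) s h'
    apply Psh.yoneda_hom_ext
    rw [constArrow_natural, constArrow_fst, Psh.yonedaAct_fst]
    have hs : s ≫ Q.cod = ((x ≫ B.p) ≫ Q.bang) ≫ Q.dom := by
      rw [h, Category.assoc (x ≫ B.p), Q.bang_dom, Category.comp_id]
    have key : Q.comp s ((x ≫ B.p) ≫ Q.bang) hs = (B.act x s h ≫ B.p) ≫ Q.bang := by
      rw [Q.bang_unique (Q.comp s ((x ≫ B.p) ≫ Q.bang) hs), B.act_p, ← Category.assoc, Q.comp_dom]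
      rw [Q.comp_cod, Category.assoc, Q.bang_cod, ← Category.assoc]
      exact congrArg (· ≫ N.zero) (Subsingleton.elim _ _)
    have key₂ : (x ≫ constArrow B.p e) ≫ pullback.fst Q.cod (N.zero ≫ N.succ) =
        Q.comp ((x ≫ B.p) ≫ Q.bang) (terminal.from J ≫ ptArrow e) (constPt_comp (x ≫ B.p) e) := by
      rw [constArrow_natural, constArrow_fst]
    refine Eq.trans ?_ (Psh.comp_congr Q.toIntCat rfl key₂ _).symm
    rw [← Q.assoc s ((x ≫ B.p) ≫ Q.bang) (terminal.from J ≫ ptArrow e) hs (constPt_comp _ e)]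
    exact Psh.comp_congr Q.toIntCat key.symm rfl _

/-- The inclusion `⟨r, id⟩ : B ⟶ I × B` of the graph of `r : B ⟶ I`. -/
abbrev graph {B : CSet Q} (r : B ⟶ I Q) : B ⟶ (I Q).prod B := Psh.lift r (𝟙 B)

end CSet

open CSet

/-! ### Kan fibrations -/

/-- The data that a notion of Kan fibration depends on.

* `Cof` is the class of cofibrations: monomorphisms, stable under pullback, containing `0 ⟶ B`,
  and decidable on points: `Γ m` is a complemented subobject.
* `Src r` says that fillers of open boxes based at the graph of `r : B ⟶ I` are demanded.  This is
  required at least for each `r` that factors through a constant cubical set, in particular for each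
  point `1 ⟶ I`.  Demanding it only for these gives fibrations with filling from the points of `I`
  (as for De Morgan cubes); demanding it for all `r` gives filling from a generic point
  (as for cartesian cubes). -/
structure KanData (Q : CubeCat N) where
  Cof : MorphismProperty (CSet Q)
  Src : ∀ {B : CSet Q}, (B ⟶ I Q) → Prop
  cof_mono : ∀ {A B : CSet Q} (m : A ⟶ B), Cof m → Mono m
  cof_pullback : Cof.IsStableUnderBaseChange
  cof_initial : ∀ {A B : CSet Q} (m : A ⟶ B), IsInitial A → Cof m
  cof_decidable : ∀ {A B : CSet Q} (m : A ⟶ B), Cof m →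
    ∃ (D : E) (c : D ⟶ (Γ Q).obj B), Nonempty (IsColimit (BinaryCofan.mk ((Γ Q).map m) c))
  src_precomp : ∀ {A B : CSet Q} (a : A ⟶ B) (r : B ⟶ I Q), Src r → Src (a ≫ r)
  src_const : ∀ {B : CSet Q} {J : E} (b : B ⟶ (Δ Q).obj J) (d : (Δ Q).obj J ⟶ I Q), Src (b ≫ d)

variable {Q : CubeCat N} (K : KanData Q)

/-- Kan fibrations: `f : X ⟶ Y` has fillers for all open boxes.  An open box over
`v : I × B ⟶ Y` consists of a base `x₀ : B ⟶ X` over the graph of `r : B ⟶ I` and of walls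
`w : I × A ⟶ X` over a cofibration `m : A ⟶ B` that agree on `A`.  Since `B` is an arbitrary cubical
set, fillers exist uniformly (take for `B` the object of all open boxes). -/
def IsKanFibration {X Y : CSet Q} (f : X ⟶ Y) : Prop :=
  ∀ {A B : CSet Q} (m : A ⟶ B) (r : B ⟶ I Q), K.Cof m → K.Src r →
    ∀ (w : (I Q).prod A ⟶ X) (x₀ : B ⟶ X) (v : (I Q).prod B ⟶ Y),
      w ≫ f = Psh.map (𝟙 (I Q)) m ≫ v →
      x₀ ≫ f = graph r ≫ v →
      graph (m ≫ r) ≫ w = m ≫ x₀ →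
      ∃ h : (I Q).prod B ⟶ X, h ≫ f = v ∧ Psh.map (𝟙 (I Q)) m ≫ h = w ∧ graph r ≫ h = x₀

/-! ### Homotopies and h-propositions -/

/-- `x` and `y : Z ⟶ X` are homotopic over `Y`: there is a homotopy from `x` to `y`
that `f : X ⟶ Y` sends to a constant one. -/
def FibrewiseHomotopic {X Y Z : CSet Q} (f : X ⟶ Y) (x y : Z ⟶ X) : Prop :=
  ∃ H : (I Q).prod Z ⟶ X,
    graph (constPt Z Q.end₀) ≫ H = x ∧ graph (constPt Z Q.end₁) ≫ H = y ∧
      H ≫ f = Psh.snd (I Q) Z ≫ x ≫ f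

/-- `f : X ⟶ Y` is an h-proposition: a Kan fibration such that `Path_Y(X) ⟶ X ×_Y X` has a section.
Such a section is, by transposition, a homotopy over `Y` between the two projections of `X ×_Y X`. -/
def IsHProp {X Y : CSet Q} (f : X ⟶ Y) : Prop :=
  IsKanFibration K f ∧
    ∀ {P : CSet Q} (p₁ p₂ : P ⟶ X), IsPullback p₁ p₂ f f → FibrewiseHomotopic f p₁ p₂

/-- `f : X ⟶ Y` and `g : Z ⟶ Y` are equivalent: they are homotopy equivalent over `Y`. -/
def FibrewiseEquivalent {X Y Z : CSet Q} (f : X ⟶ Y) (g : Z ⟶ Y) : Prop :=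
  ∃ (a : X ⟶ Z) (b : Z ⟶ X), a ≫ g = f ∧ b ≫ f = g ∧
    FibrewiseHomotopic f (a ≫ b) (𝟙 X) ∧ FibrewiseHomotopic g (b ≫ a) (𝟙 Z)

/-- `f : X ⟶ Y` is a homotopy pullback of the Kan fibration `g : Z ⟶ P`: it is equivalent over `Y` to
the pullback of `g` along some map `Y ⟶ P`. -/
def IsHomotopyPullbackOf {X Y Z P : CSet Q} (f : X ⟶ Y) (g : Z ⟶ P) : Prop :=
  IsKanFibration K f ∧ IsKanFibration K g ∧
    ∃ (χ : Y ⟶ P) (V : CSet Q) (k : V ⟶ Z) (l : V ⟶ Y),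
      IsPullback k l g χ ∧ FibrewiseEquivalent f l

/-! ### The type formers in the definition of weakly `Π⁰₁` -/

/-- `ν : NX ⟶ Y` is the negation of `f : X ⟶ Y`: the exponential `0 ^ X` in the slice over `Y`. -/
def IsNegation {X Y NX : CSet Q} (f : X ⟶ Y) (ν : NX ⟶ Y) : Prop :=
  ∃ (O : CSet Q) (_ : IsInitial O),
    (∀ {V : CSet Q} (a : V ⟶ NX) (b : V ⟶ X), IsPullback a b ν f → Nonempty (V ⟶ O)) ∧
    ∀ {Z V : CSet Q} (z : Z ⟶ Y) (a : V ⟶ Z) (b : V ⟶ X), IsPullback a b z f → (V ⟶ O) →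
      ∃! h : Z ⟶ NX, h ≫ ν = z

/-- `w : W ⟶ B` is the fibrewise coproduct of `r : R ⟶ B` and `s : S ⟶ B`. -/
def IsFibrewiseSum {R S W B : CSet Q} (r : R ⟶ B) (s : S ⟶ B) (w : W ⟶ B) : Prop :=
  ∃ (i : R ⟶ W) (j : S ⟶ W), Nonempty (IsColimit (BinaryCofan.mk i j)) ∧ i ≫ w = r ∧ j ≫ w = s

/-- `t : T ⟶ B` is a propositional truncation of `w : W ⟶ B`: an h-proposition with a map from `W`
over `B` that, stably under reindexing along all `σ : Z ⟶ B`, maps to each h-proposition over `Z` to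
which `W` maps. -/
def IsTruncation {W T B : CSet Q} (w : W ⟶ B) (t : T ⟶ B) : Prop :=
  IsHProp K t ∧ (∃ η : W ⟶ T, η ≫ t = w) ∧
    ∀ {Z W' T' P : CSet Q} (σ : Z ⟶ B) (a : W' ⟶ W) (w' : W' ⟶ Z) (b : T' ⟶ T) (t' : T' ⟶ Z)
      (q : P ⟶ Z), IsPullback a w' w σ → IsPullback b t' t σ → IsHProp K q →
      (∃ u : W' ⟶ P, u ≫ q = w') → ∃ u : T' ⟶ P, u ≫ q = t'

/-- `d : D ⟶ Y` is the dependent product along the projection `Y × M ⟶ Y` of `r : R ⟶ Y × M`: maps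
`Z ⟶ D` over `Y` correspond to maps `Z × M ⟶ R` over `Y × M`. -/
def IsDependentProduct {Y M R D : CSet Q} (r : R ⟶ Y.prod M) (d : D ⟶ Y) : Prop :=
  ∃ ev : D.prod M ⟶ R, ev ≫ r = Psh.map d (𝟙 M) ∧
    ∀ {Z : CSet Q} (z : Z ⟶ Y) (k : Z.prod M ⟶ R), k ≫ r = Psh.map z (𝟙 M) →
      ∃! h : Z ⟶ D, h ≫ d = z ∧ Psh.map h (𝟙 M) ≫ ev = k

/-- An h-proposition `f : X ⟶ Y` is weakly `Π⁰₁` if there is an h-proposition `r : R ⟶ Y × ℕ` with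
terms of `∏ y n, ‖R_{y,n} + ¬ X_y‖` and of `∏ y, (X_y ↔ ∏ n, R_{y,n})`.  The type of natural numbers
is the constant cubical set `Δ ℕ`; terms in context are sections, resp. maps over the context. -/
def IsWeaklyPi01 {X Y : CSet Q} (f : X ⟶ Y) : Prop :=
  IsHProp K f ∧
    ∃ (R : CSet Q) (r : R ⟶ Y.prod ((Δ Q).obj N.nat)), IsHProp K r ∧
      (∃ (NX S W T : CSet Q) (ν : NX ⟶ Y) (k : S ⟶ NX) (s : S ⟶ Y.prod ((Δ Q).obj N.nat))
          (w : W ⟶ Y.prod ((Δ Q).obj N.nat)) (t : T ⟶ Y.prod ((Δ Q).obj N.nat)),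
        IsNegation f ν ∧ IsPullback k s ν (Psh.fst Y ((Δ Q).obj N.nat)) ∧
        IsFibrewiseSum r s w ∧ IsTruncation K w t ∧
        ∃ c : Y.prod ((Δ Q).obj N.nat) ⟶ T, c ≫ t = 𝟙 _) ∧
      (∃ (D : CSet Q) (d : D ⟶ Y), IsDependentProduct r d ∧
        (∃ a : X ⟶ D, a ≫ d = f) ∧ (∃ b : D ⟶ X, b ≫ f = d))

end Cubes

end CubicalHProp

end

/-! The proof rests on the contrast between constant cubical sets, to which a map must take one
value on all vertices of a cube, and cofree ones, to which every function on points extends. For `e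
: G ⟶ J` in `E` the cofree object over `Δ J` is a `PointFamily`: an `n`-cube is an arbitrary
function from the points of `[n]` to a fibre of `e`. A map into it over `Δ J` amounts to a function
on global sections (`PointFamily.hom_ext`, `PointFamily.exists_lift`). Since cofibrations are
complemented on points, open boxes in it are filled by cases; since the endpoints of `I` are told
apart by a function to `2`, any two parallel maps into it over `Δ J` are homotopic. So it is an
h-proposition over `Δ J` (`PointFamily.isHProp_proj`), and a truncation may be eliminated into it.
If a truncation `‖W‖` has a section, `W` therefore has an element over every point of the base, even
over the generic one (`IsTruncation.exists_point`).

Applied to `R + ¬X`, this gives a function from points `y` of `Y` and numbers `n` to `2`, with value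
`0` where the chosen element lies in `R`. It vanishes for all `n` exactly if the fibre of `X` over
`y` has a point (`IsWeaklyPi01.exists_decision`), so inhabitedness of fibres over points has a truth
value in `Ω`. Filling boxes with empty walls transports points of `X` along paths in `Y`; by
uniqueness of classifying maps, the truth value agrees at the vertices of a `1`-cube, hence by
induction at all vertices of any cube (`vertexVal_eq`). It thus extends to `χ : Y ⟶ Δ Ω`
(`IsWeaklyPi01.exists_classifyingMap`).

Let `V` be the pullback of `Δ 1` along `χ`. There is a map `X ⟶ V` because fibres over points in the
image of `X` are inhabited. Conversely, over `V` all fibres of `X` over points are inhabited, so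
`¬X` is empty there and `R + ¬X` reduces to `R`. As `R` is an h-proposition, the section of the
truncation yields a section of `R`, hence of the dependent product, hence a map `V ⟶ X`
(`IsWeaklyPi01.exists_lift`). The two maps are inverse up to homotopy because `X` is an
h-proposition and `V ⟶ Y` is a monomorphism. -/

noncomputable section

namespace CubicalHProp

/-! ### Binary coproducts in an extensive category, through generalised elements -/

section Extensive

variable {E : Type u} [Category.{v} E]

/-- The category has a strict initial object, so an object mapping to it has at most one map to any
object. -/
theorem hom_ext_of_empty [FinitaryExtensive E] {K G : E} (h : Nonempty (K ⟶ ⊥_ E)) (f g : K ⟶ G) :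
    f = g := by
  obtain ⟨e⟩ := h
  exact (initialIsInitial.ofStrict e).hom_ext f g

variable [FinitaryExtensive E] {A B C : E} {i : A ⟶ B} {j : C ⟶ B}

theorem sum_disjoint (hc : IsColimit (BinaryCofan.mk i j)) {L : E} (y : L ⟶ A) (z : L ⟶ C)
    (h : y ≫ i = z ≫ j) : Nonempty (L ⟶ ⊥_ E) :=
  ⟨(FinitaryExtensive.isPullback_initial_to_binaryCofan hc).lift y z h⟩

theorem sum_mono_inl (hc : IsColimit (BinaryCofan.mk i j)) : Mono i :=
  FinitaryExtensive.mono_inl_of_isColimit hc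

variable [HasFiniteLimits E]

/-- The pullback of a binary coproduct cocone is a coproduct cocone. -/
theorem isColimit_pullback_fst (hc : IsColimit (BinaryCofan.mk i j)) {K : E} (x : K ⟶ B) :
    Nonempty (IsColimit (BinaryCofan.mk (pullback.fst x i) (pullback.fst x j))) :=
  ((BinaryCofan.isVanKampen_iff _).1 (FinitaryExtensive.vanKampen _ hc)
    (BinaryCofan.mk (pullback.fst x i) (pullback.fst x j)) (pullback.snd x i) (pullback.snd x j) x
    pullback.condition.symm pullback.condition.symm).2
    ⟨IsPullback.of_hasPullback x i, IsPullback.of_hasPullback x j⟩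

/-- Universality of the coproduct splits the context `K` itself into its parts over `A` and over
`C`. This lemma and `sum_hom_exists` are case distinction in the internal language. -/
theorem sum_hom_ext (hc : IsColimit (BinaryCofan.mk i j)) {K G : E} (x : K ⟶ B) {k k' : K ⟶ G}
    (h₁ : ∀ {L : E} (a : L ⟶ K) (y : L ⟶ A), a ≫ x = y ≫ i → a ≫ k = a ≫ k')
    (h₂ : ∀ {L : E} (a : L ⟶ K) (y : L ⟶ C), a ≫ x = y ≫ j → a ≫ k = a ≫ k') : k = k' := by
  obtain ⟨hx⟩ := isColimit_pullback_fst hc x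
  exact BinaryCofan.IsColimit.hom_ext hx (h₁ _ _ pullback.condition) (h₂ _ _ pullback.condition)

theorem sum_hom_exists (hc : IsColimit (BinaryCofan.mk i j)) {K G : E} (x : K ⟶ B)
    (k₁ : pullback x i ⟶ G) (k₂ : pullback x j ⟶ G) :
    ∃ k : K ⟶ G,
      (∀ {L : E} (a : L ⟶ K) (y : L ⟶ A) (h : a ≫ x = y ≫ i), a ≫ k = pullback.lift a y h ≫ k₁) ∧
      (∀ {L : E} (a : L ⟶ K) (y : L ⟶ C) (h : a ≫ x = y ≫ j),
        a ≫ k = pullback.lift a y h ≫ k₂) := by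
  obtain ⟨hx⟩ := isColimit_pullback_fst hc x
  obtain ⟨k, h₁, h₂⟩ := BinaryCofan.IsColimit.desc' hx k₁ k₂
  refine ⟨k, fun a y h => ?_, fun a y h => ?_⟩
  · rw [← h₁]
    exact (pullback.lift_fst_assoc _ _ h _).symm
  · rw [← h₂]
    exact (pullback.lift_fst_assoc _ _ h _).symm

/-- An element of a coproduct that is nowhere in the right summand is in the left summand. -/
theorem sum_factor_inl (hc : IsColimit (BinaryCofan.mk i j)) {K : E} (x : K ⟶ B)
    (h : ∀ {L : E} (a : L ⟶ K) (z : L ⟶ C), a ≫ x = z ≫ j → Nonempty (L ⟶ ⊥_ E)) :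
    ∃ y : K ⟶ A, y ≫ i = x := by
  obtain ⟨e⟩ := h (pullback.fst x j) (pullback.snd x j) pullback.condition
  -- The part of `K` over the right summand is empty, so any value may be given there.
  obtain ⟨k, h₁, h₂⟩ := sum_hom_exists hc x (pullback.snd x i) (e ≫ initial.to A)
  refine ⟨k, sum_hom_ext hc x (fun a y hy => ?_) fun a y hy => hom_ext_of_empty (h a y hy) _ _⟩
  rw [← Category.assoc, h₁ a y hy, pullback.lift_snd, hy]

end Extensive

/-! ### Dependent products, through generalised elements -/

section Pi

variable {E : Type u} [Category.{v} E] [HasFiniteLimits E] [LocallyCartesianClosed E]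

/-- This is base change along `u` applied to `h`, read off at the generalised element `(a, m)`. -/
theorem pullback_lift_comp_left {C : Type u} [Category.{v} C] [HasPullbacks C] {J K M P Z : C}
    (u : M ⟶ Z) (z : J ⟶ Z) (h : J ⟶ P) (q : P ⟶ Z) (hq : h ≫ q = z) (a : K ⟶ J) (m : K ⟶ M)
    (hm : a ≫ z = m ≫ u) :
    pullback.lift (a ≫ h) m (by rw [Category.assoc, hq, hm]) =
      pullback.lift a m hm ≫ pullback.lift (f := q) (g := u) (pullback.fst z u ≫ h)
        (pullback.snd z u) (by rw [Category.assoc, hq, pullback.condition]) := by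
  apply pullback.hom_ext <;> simp only [Category.assoc, pullback.lift_fst, pullback.lift_snd,
    pullback.lift_fst_assoc]

/-- The dependent product along `u` of `w`: its elements over `z` are the families of elements of
`L` that are indexed by the fibre of `u` over `z`. -/
theorem exists_dependentProduct {L M Z : E} (w : L ⟶ M) (u : M ⟶ Z) :
    ∃ (P : E) (q : P ⟶ Z) (ev : pullback q u ⟶ L), ev ≫ w = pullback.snd q u ∧
      (∀ {J : E} (z : J ⟶ Z) (k : pullback z u ⟶ L), k ≫ w = pullback.snd z u →
        ∃ (h : J ⟶ P) (hq : h ≫ q = z), ∀ {K : E} (a : K ⟶ J) (m : K ⟶ M) (hm : a ≫ z = m ≫ u),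
          pullback.lift (a ≫ h) m (by rw [Category.assoc, hq, hm]) ≫ ev =
            pullback.lift a m hm ≫ k) ∧
      (∀ {J : E} (h h' : J ⟶ P) (hq : h ≫ q = h' ≫ q),
        (∀ {K : E} (a : K ⟶ J) (m : K ⟶ M) (hm : (a ≫ h) ≫ q = m ≫ u),
          pullback.lift (a ≫ h) m hm ≫ ev = pullback.lift (a ≫ h') m
            (by rw [Category.assoc, ← hq, ← Category.assoc, hm]) ≫ ev) → h = h') := by
  have := LocallyCartesianClosed.isLeftAdjoint_pullback u
  let adj := Adjunction.ofIsLeftAdjoint (Over.pullback u)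
  let D := (Over.pullback u).rightAdjoint.obj (Over.mk w)
  -- The inverse transpose is base change followed by the counit, so the counit serves as
  -- evaluation.
  have key : ∀ {J : E} (h : J ⟶ D.left) (z : J ⟶ Z) (hz : h ≫ D.hom = z),
      ((adj.homEquiv (Over.mk z) (Over.mk w)).symm (Over.homMk h hz)).left =
        pullback.lift (pullback.fst z u ≫ h) (pullback.snd z u)
            (by rw [Category.assoc, hz, pullback.condition]) ≫
          (adj.counit.app (Over.mk w)).left := by
    intro J h z hz
    rw [Adjunction.homEquiv_counit]
    rfl
  refine ⟨D.left, D.hom, (adj.counit.app (Over.mk w)).left,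
    Over.w (adj.counit.app (Over.mk w)), ?_, ?_⟩
  · intro J z k hk
    let k' : (Over.pullback u).obj (Over.mk z) ⟶ Over.mk w := Over.homMk k hk
    let h := adj.homEquiv (Over.mk z) (Over.mk w) k'
    refine ⟨h.left, Over.w h, fun a m hm => ?_⟩
    have e := key h.left z (Over.w h)
    have e₂ : ((adj.homEquiv (Over.mk z) (Over.mk w)).symm (Over.homMk h.left (Over.w h))).left =
        k := congrArg CommaMorphism.left (Equiv.symm_apply_apply _ k')
    rw [e₂] at e
    rw [e]
    refine Eq.trans (congrArg (· ≫ _) ?_) (Category.assoc _ _ _)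
    exact pullback_lift_comp_left u z h.left D.hom (Over.w h) a m hm
  · intro J h h' hq e
    -- Maps with equal transposes are equal, and the transposes agree by the hypothesis at the
    -- generic index of the fibre.
    have e' : ((adj.homEquiv (Over.mk (h ≫ D.hom)) (Over.mk w)).symm (Over.homMk h rfl)) =
        ((adj.homEquiv (Over.mk (h ≫ D.hom)) (Over.mk w)).symm (Over.homMk h' hq.symm)) := by
      apply Over.OverMorphism.ext
      rw [key, key]
      exact e _ _ _
    exact congrArg CommaMorphism.left ((Equiv.injective _) e')

/-- Universal quantification: the subobject of `Z` of those `z` whose fibre along `u` is contained in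
the subobject `w` of `M`. -/
theorem exists_forall {L M Z : E} (w : L ⟶ M) [Mono w] (u : M ⟶ Z) :
    ∃ (P : E) (q : P ⟶ Z), Mono q ∧ ∀ {J : E} (z : J ⟶ Z), (∃ h : J ⟶ P, h ≫ q = z) ↔
      ∀ {K : E} (a : K ⟶ J) (m : K ⟶ M), m ≫ u = a ≫ z → ∃ l : K ⟶ L, l ≫ w = m := by
  obtain ⟨P, q, ev, hev, hex, hext⟩ := exists_dependentProduct w u
  refine ⟨P, q, ⟨fun h h' hq => hext h h' hq fun a m hm => ?_⟩,
    fun {J} z => ⟨?_, fun hz => ?_⟩⟩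
  · simp only [← cancel_mono w, Category.assoc, hev, pullback.lift_snd]
  · rintro ⟨h, rfl⟩ K a m hm
    refine ⟨pullback.lift (a ≫ h) m (by rw [hm, Category.assoc]) ≫ ev, ?_⟩
    rw [Category.assoc, hev, pullback.lift_snd]
  -- Containment of the generic element of the fibre gives the whole family at once.
  · obtain ⟨l, hl⟩ := hz (pullback.fst z u) (pullback.snd z u) pullback.condition.symm
    obtain ⟨h, hq, -⟩ := hex z l hl
    exact ⟨h, hq⟩

end Pi

/-! ### The natural number object -/

section Nat

variable {E : Type u} [Category.{v} E]

theorem NatObj.hom_eq_id [HasTerminal E] (N : NatObj E) (h : N.nat ⟶ N.nat)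
    (h₀ : N.zero ≫ h = N.zero) (h₁ : N.succ ≫ h = h ≫ N.succ) : h = 𝟙 _ :=
  (N.exists_unique_rec N.zero N.succ).unique ⟨h₀, h₁⟩ ⟨Category.comp_id _, by simp⟩

/-- Induction: two functions on a family `u : M ⟶ ℕ` are equal if they are equal on the fibre over
`0` and, whenever they are equal on the fibre over `n`, also on the fibre over `n + 1`. -/
theorem NatObj.induction [HasFiniteLimits E] [LocallyCartesianClosed E] (N : NatObj E) {M G : E}
    (u : M ⟶ N.nat) (α β : M ⟶ G)
    (h₀ : ∀ {K : E} (m : K ⟶ M), m ≫ u = terminal.from K ≫ N.zero → m ≫ α = m ≫ β)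
    (h₁ : ∀ {K : E} (n : K ⟶ N.nat),
      (∀ {L : E} (a : L ⟶ K) (m : L ⟶ M), m ≫ u = a ≫ n → m ≫ α = m ≫ β) →
      ∀ m : K ⟶ M, m ≫ u = n ≫ N.succ → m ≫ α = m ≫ β) : α = β := by
  -- `P` is the subobject of those numbers over which `α` and `β` agree on the whole fibre.
  obtain ⟨P, q, hq, hP⟩ := exists_forall (equalizer.ι α β) u
  have hP' : ∀ {J : E} (z : J ⟶ N.nat), (∃ h : J ⟶ P, h ≫ q = z) ↔
      ∀ {K : E} (a : K ⟶ J) (m : K ⟶ M), m ≫ u = a ≫ z → m ≫ α = m ≫ β := by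
    intro J z
    refine (hP z).trans ⟨fun h K a m hm => ?_, fun h K a m hm => ?_⟩
    · obtain ⟨l, rfl⟩ := h a m hm
      rw [Category.assoc, Category.assoc, equalizer.condition]
    · exact ⟨equalizer.lift m (h a m hm), equalizer.lift_ι _ _⟩
  obtain ⟨z, hz⟩ := (hP' N.zero).2 fun {K} a m hm => h₀ m (by
    rw [hm, Subsingleton.elim a (terminal.from K)])
  obtain ⟨s, hs⟩ := (hP' (q ≫ N.succ)).2 fun {K} a m hm => by
    refine h₁ (a ≫ q) (fun {L} b m' hm' => ?_) m (by rw [hm, Category.assoc])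
    exact (hP' q).1 ⟨𝟙 _, Category.id_comp _⟩ (b ≫ a) m' (by rw [hm', Category.assoc])
  -- `P` contains `0` and is closed under successor, so recursion into `P` gives a section of `q`,
  -- and `P` is everything.
  obtain ⟨h, ⟨hz', hs'⟩, -⟩ := N.exists_unique_rec z s
  have hid : h ≫ q = 𝟙 _ := N.hom_eq_id _ (by rw [← Category.assoc, hz', hz])
    (by rw [← Category.assoc, hs', Category.assoc, hs, Category.assoc])
  have := (hP' (𝟙 N.nat)).1 ⟨h, hid⟩ u (𝟙 M) (by simp)
  simpa using this

end Nat

namespace Psh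

variable {E : Type u} [Category.{v} E] {O : E} {C : IntCat O} [HasFiniteLimits E]

/-! ### Elements of products -/

/-- The element of a product with the given components. -/
def pairElt {X Y : Psh C} {J : E} (x : J ⟶ X.obj) (y : J ⟶ Y.obj) (h : x ≫ X.p = y ≫ Y.p) :
    J ⟶ (X.prod Y).obj :=
  pullback.lift x y h

theorem pairElt_fst {X Y : Psh C} {J : E} (x : J ⟶ X.obj) (y : J ⟶ Y.obj)
    (h : x ≫ X.p = y ≫ Y.p) : pairElt x y h ≫ (fst X Y).app = x :=
  pullback.lift_fst _ _ _

theorem pairElt_snd {X Y : Psh C} {J : E} (x : J ⟶ X.obj) (y : J ⟶ Y.obj)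
    (h : x ≫ X.p = y ≫ Y.p) : pairElt x y h ≫ (snd X Y).app = y :=
  pullback.lift_snd _ _ _

theorem prod_elt_ext {X Y : Psh C} {J : E} {z z' : J ⟶ (X.prod Y).obj}
    (h₁ : z ≫ (fst X Y).app = z' ≫ (fst X Y).app) (h₂ : z ≫ (snd X Y).app = z' ≫ (snd X Y).app) :
    z = z' :=
  pullback.hom_ext h₁ h₂

theorem comp_pairElt {X Y : Psh C} {J K : E} (a : K ⟶ J) (x : J ⟶ X.obj) (y : J ⟶ Y.obj)
    (h : x ≫ X.p = y ≫ Y.p) :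
    a ≫ pairElt x y h =
      pairElt (a ≫ x) (a ≫ y) (by rw [Category.assoc, h, Category.assoc]) := by
  apply prod_elt_ext
  · rw [Category.assoc, pairElt_fst, pairElt_fst]
  · rw [Category.assoc, pairElt_snd, pairElt_snd]

theorem elt_lift {Z X Y : Psh C} (f : Z ⟶ X) (g : Z ⟶ Y) {J : E} (z : J ⟶ Z.obj) :
    z ≫ (lift f g).app = pairElt (z ≫ f.app) (z ≫ g.app)
      (by rw [Category.assoc, f.app_p, Category.assoc, g.app_p]) := by
  apply prod_elt_ext
  · rw [pairElt_fst, Category.assoc, ← comp_app, lift_fst]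
  · rw [pairElt_snd, Category.assoc, ← comp_app, lift_snd]

theorem pairElt_map {X X' Y Y' : Psh C} (f : X ⟶ X') (g : Y ⟶ Y') {J : E} (x : J ⟶ X.obj)
    (y : J ⟶ Y.obj) (h : x ≫ X.p = y ≫ Y.p) :
    pairElt x y h ≫ (map f g).app = pairElt (x ≫ f.app) (y ≫ g.app)
      (by rw [Category.assoc, f.app_p, Category.assoc, g.app_p, h]) := by
  apply prod_elt_ext
  · rw [pairElt_fst, Category.assoc, ← comp_app, map, lift_fst, comp_app, ← Category.assoc,
      pairElt_fst]
  · rw [pairElt_snd, Category.assoc, ← comp_app, map, lift_snd, comp_app, ← Category.assoc,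
      pairElt_snd]

theorem eq_pairElt {X Y : Psh C} {J : E} (z : J ⟶ (X.prod Y).obj) :
    z = pairElt (z ≫ (fst X Y).app) (z ≫ (snd X Y).app)
      (by rw [Category.assoc, Category.assoc, (fst X Y).app_p, (snd X Y).app_p]) := by
  apply prod_elt_ext
  · rw [pairElt_fst]
  · rw [pairElt_snd]

theorem pairElt_p {X Y : Psh C} {J : E} (x : J ⟶ X.obj) (y : J ⟶ Y.obj) (h : x ≫ X.p = y ≫ Y.p) :
    pairElt x y h ≫ (X.prod Y).p = y ≫ Y.p := by
  rw [← (snd X Y).app_p, ← Category.assoc, pairElt_snd]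

theorem pairElt_act {X Y : Psh C} {J : E} (x : J ⟶ X.obj) (y : J ⟶ Y.obj)
    (h : x ≫ X.p = y ≫ Y.p) (s : J ⟶ C.hom) (hs : s ≫ C.cod = pairElt x y h ≫ (X.prod Y).p) :
    (X.prod Y).act (pairElt x y h) s hs =
      pairElt (X.act x s (by rw [hs, pairElt_p, h])) (Y.act y s (by rw [hs, pairElt_p]))
        (by rw [X.act_p, Y.act_p]) := by
  apply prod_elt_ext
  · rw [pairElt_fst, (fst X Y).app_act]
    exact act_congr _ (pairElt_fst _ _ _) rfl _
  · rw [pairElt_snd, (snd X Y).app_act]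
    exact act_congr _ (pairElt_snd _ _ _) rfl _

/-! ### Pullbacks -/

section Pullback

variable {X Y Z : Psh C} (f : X ⟶ Z) (g : Y ⟶ Z)

/-- The action on the pullback. -/
def pbAct {J : E} (x : J ⟶ pullback f.app g.app) (s : J ⟶ C.hom)
    (h : s ≫ C.cod = x ≫ pullback.fst f.app g.app ≫ X.p) : J ⟶ pullback f.app g.app :=
  pullback.lift
    (X.act (x ≫ pullback.fst f.app g.app) s (by rw [h, Category.assoc]))
    (Y.act (x ≫ pullback.snd f.app g.app) s
      (by rw [h, ← f.app_p, pullback.condition_assoc, g.app_p, Category.assoc]))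
    (by
      rw [f.app_act, g.app_act]
      exact act_congr _ (by rw [Category.assoc, pullback.condition, Category.assoc]) rfl _)

theorem pbAct_fst {J : E} (x : J ⟶ pullback f.app g.app) (s : J ⟶ C.hom)
    (h : s ≫ C.cod = x ≫ pullback.fst f.app g.app ≫ X.p) :
    pbAct f g x s h ≫ pullback.fst f.app g.app =
      X.act (x ≫ pullback.fst f.app g.app) s (by rw [h, Category.assoc]) :=
  pullback.lift_fst _ _ _

theorem pbAct_snd {J : E} (x : J ⟶ pullback f.app g.app) (s : J ⟶ C.hom)
    (h : s ≫ C.cod = x ≫ pullback.fst f.app g.app ≫ X.p) :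
    pbAct f g x s h ≫ pullback.snd f.app g.app =
      Y.act (x ≫ pullback.snd f.app g.app) s
        (by rw [h, ← f.app_p, pullback.condition_assoc, g.app_p, Category.assoc]) :=
  pullback.lift_snd _ _ _

/-- The pullback of internal presheaves, computed on underlying objects. -/
abbrev pb : Psh C where
  obj := pullback f.app g.app
  p := pullback.fst f.app g.app ≫ X.p
  act x s h := pbAct f g x s h
  act_natural a x s h := by
    apply pullback.hom_ext
    · rw [Category.assoc, pbAct_fst, pbAct_fst, X.act_natural]
      exact X.act_congr (Category.assoc _ _ _).symm rfl _
    · rw [Category.assoc, pbAct_snd, pbAct_snd, Y.act_natural]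
      exact Y.act_congr (Category.assoc _ _ _).symm rfl _
  act_p x s h := by rw [← Category.assoc, pbAct_fst, X.act_p]
  act_id x := by
    have hp : pullback.fst f.app g.app ≫ X.p = pullback.snd f.app g.app ≫ Y.p := by
      rw [← f.app_p, pullback.condition_assoc, g.app_p]
    apply pullback.hom_ext
    · rw [pbAct_fst]
      exact (X.act_congr rfl (by simp only [Category.assoc]) _).trans (X.act_id _)
    · rw [pbAct_snd]
      refine (Y.act_congr rfl ?_ _).trans (Y.act_id _)
      rw [hp, Category.assoc, Category.assoc]
  act_comp x s r h h' := by
    have h'' := (C.comp_cod r s h').trans h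
    apply pullback.hom_ext
    · rw [pbAct_fst]
      refine (X.act_congr (pbAct_fst f g x s h) rfl _).trans ?_
      rw [pbAct_fst f g x (C.comp r s h') h'']
      exact X.act_comp _ s r _ h'
    · rw [pbAct_snd]
      refine (Y.act_congr (pbAct_snd f g x s h) rfl _).trans ?_
      rw [pbAct_snd f g x (C.comp r s h') h'']
      exact Y.act_comp _ s r _ h'

/-- First projection of the pullback. -/
def pbFst : pb f g ⟶ X where
  app := pullback.fst f.app g.app
  app_p := rfl
  app_act _ _ _ := pullback.lift_fst _ _ _

/-- Second projection of the pullback. -/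
def pbSnd : pb f g ⟶ Y where
  app := pullback.snd f.app g.app
  app_p := by
    change _ = pullback.fst f.app g.app ≫ X.p
    rw [← f.app_p, pullback.condition_assoc, ← g.app_p]
  app_act _ _ _ := pullback.lift_snd _ _ _

variable {f g} in
/-- The map to the pullback induced by a commutative square. -/
def pbLift {W : Psh C} (a : W ⟶ X) (b : W ⟶ Y) (w : a ≫ f = b ≫ g) : W ⟶ pb f g where
  app := pullback.lift a.app b.app (congrArg Hom.app w)
  app_p := (pullback.lift_fst_assoc _ _ _ _).trans a.app_p
  app_act {J} x s h := by
    have w' : a.app ≫ f.app = b.app ≫ g.app := congrArg Hom.app w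
    have h' : s ≫ C.cod = (x ≫ pullback.lift a.app b.app w') ≫ pullback.fst f.app g.app ≫ X.p := by
      rw [Category.assoc, pullback.lift_fst_assoc, a.app_p, h]
    change W.act x s h ≫ pullback.lift a.app b.app w' = pbAct f g _ s h'
    apply pullback.hom_ext
    · rw [Category.assoc, pullback.lift_fst, pbAct_fst]
      exact (a.app_act _ _ _).trans
        (X.act_congr (by rw [Category.assoc, pullback.lift_fst]) rfl _)
    · rw [Category.assoc, pullback.lift_snd, pbAct_snd]
      exact (b.app_act _ _ _).trans
        (Y.act_congr (by rw [Category.assoc, pullback.lift_snd]) rfl _)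

theorem pb_condition : pbFst f g ≫ f = pbSnd f g ≫ g :=
  hom_ext pullback.condition

theorem isPullback_pb : IsPullback (pbFst f g) (pbSnd f g) f g :=
  ⟨⟨pb_condition f g⟩, ⟨PullbackCone.IsLimit.mk _
    (fun s => pbLift s.fst s.snd s.condition)
    (fun _ => hom_ext (pullback.lift_fst _ _ _))
    (fun _ => hom_ext (pullback.lift_snd _ _ _))
    (fun _ _ h₁ h₂ => hom_ext (pullback.hom_ext
      ((congrArg Hom.app h₁).trans (pullback.lift_fst _ _ _).symm)
      ((congrArg Hom.app h₂).trans (pullback.lift_snd _ _ _).symm)))⟩⟩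

end Pullback

/-! ### Binary coproducts -/

section Sum

variable [FinitaryExtensive E] (X Y : Psh C)

/-- The context is split along `x`, and on each part the action of the corresponding summand is
used. -/
theorem exists_sumAct {J : E} (x : J ⟶ X.obj ⨿ Y.obj) (s : J ⟶ C.hom)
    (h : s ≫ C.cod = x ≫ coprod.desc X.p Y.p) :
    ∃ k : J ⟶ X.obj ⨿ Y.obj,
      (∀ {L : E} (a : L ⟶ J) (y : L ⟶ X.obj) (hy : a ≫ x = y ≫ coprod.inl),
        a ≫ k = X.act y (a ≫ s) (by
          rw [Category.assoc, h, ← Category.assoc, hy, Category.assoc, coprod.inl_desc]) ≫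
            coprod.inl) ∧
      (∀ {L : E} (a : L ⟶ J) (y : L ⟶ Y.obj) (hy : a ≫ x = y ≫ coprod.inr),
        a ≫ k = Y.act y (a ≫ s) (by
          rw [Category.assoc, h, ← Category.assoc, hy, Category.assoc, coprod.inr_desc]) ≫
            coprod.inr) := by
  obtain ⟨k, h₁, h₂⟩ := sum_hom_exists (coprodIsCoprod X.obj Y.obj) x
    (X.act (pullback.snd x coprod.inl) (pullback.fst x coprod.inl ≫ s) (by
      rw [Category.assoc, h, pullback.condition_assoc, coprod.inl_desc]) ≫ coprod.inl)
    (Y.act (pullback.snd x coprod.inr) (pullback.fst x coprod.inr ≫ s) (by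
      rw [Category.assoc, h, pullback.condition_assoc, coprod.inr_desc]) ≫ coprod.inr)
  refine ⟨k, fun a y hy => ?_, fun a y hy => ?_⟩
  · rw [h₁ a y hy, ← Category.assoc, X.act_natural]
    exact congrArg (· ≫ _) (X.act_congr (pullback.lift_snd _ _ _)
      ((Category.assoc _ _ _).symm.trans (congrArg (· ≫ s) (pullback.lift_fst _ _ _))) _)
  · rw [h₂ a y hy, ← Category.assoc, Y.act_natural]
    exact congrArg (· ≫ _) (Y.act_congr (pullback.lift_snd _ _ _)
      ((Category.assoc _ _ _).symm.trans (congrArg (· ≫ s) (pullback.lift_fst _ _ _))) _)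

/-- The action on the coproduct. -/
def sumAct {J : E} (x : J ⟶ X.obj ⨿ Y.obj) (s : J ⟶ C.hom)
    (h : s ≫ C.cod = x ≫ coprod.desc X.p Y.p) : J ⟶ X.obj ⨿ Y.obj :=
  (exists_sumAct X Y x s h).choose

theorem sumAct_inl {J L : E} (x : J ⟶ X.obj ⨿ Y.obj) (s : J ⟶ C.hom)
    (h : s ≫ C.cod = x ≫ coprod.desc X.p Y.p) (a : L ⟶ J) (y : L ⟶ X.obj)
    (hy : a ≫ x = y ≫ coprod.inl) :
    a ≫ sumAct X Y x s h = X.act y (a ≫ s) (by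
      rw [Category.assoc, h, ← Category.assoc, hy, Category.assoc, coprod.inl_desc]) ≫
        coprod.inl :=
  (exists_sumAct X Y x s h).choose_spec.1 a y hy

theorem sumAct_inr {J L : E} (x : J ⟶ X.obj ⨿ Y.obj) (s : J ⟶ C.hom)
    (h : s ≫ C.cod = x ≫ coprod.desc X.p Y.p) (a : L ⟶ J) (y : L ⟶ Y.obj)
    (hy : a ≫ x = y ≫ coprod.inr) :
    a ≫ sumAct X Y x s h = Y.act y (a ≫ s) (by
      rw [Category.assoc, h, ← Category.assoc, hy, Category.assoc, coprod.inr_desc]) ≫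
        coprod.inr :=
  (exists_sumAct X Y x s h).choose_spec.2 a y hy

/-- The binary coproduct of internal presheaves, computed on underlying objects. -/
abbrev sum : Psh C where
  obj := X.obj ⨿ Y.obj
  p := coprod.desc X.p Y.p
  act x s h := sumAct X Y x s h
  act_natural a x s h := by
    refine sum_hom_ext (coprodIsCoprod X.obj Y.obj) (a ≫ x) (fun b y hy => ?_) fun b y hy => ?_
    · rw [sumAct_inl X Y (a ≫ x) (a ≫ s) _ b y hy, ← Category.assoc,
        sumAct_inl X Y x s h (b ≫ a) y (by rw [Category.assoc, hy])]
      exact congrArg (· ≫ _) (X.act_congr rfl (Category.assoc _ _ _) _)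
    · rw [sumAct_inr X Y (a ≫ x) (a ≫ s) _ b y hy, ← Category.assoc,
        sumAct_inr X Y x s h (b ≫ a) y (by rw [Category.assoc, hy])]
      exact congrArg (· ≫ _) (Y.act_congr rfl (Category.assoc _ _ _) _)
  act_p x s h := by
    refine sum_hom_ext (coprodIsCoprod X.obj Y.obj) x (fun b y hy => ?_) fun b y hy => ?_
    · rw [← Category.assoc, sumAct_inl X Y x s h b y hy]
      refine (Category.assoc _ _ _).trans ((congrArg (_ ≫ ·) (coprod.inl_desc _ _)).trans ?_)
      rw [X.act_p, Category.assoc]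
    · rw [← Category.assoc, sumAct_inr X Y x s h b y hy]
      refine (Category.assoc _ _ _).trans ((congrArg (_ ≫ ·) (coprod.inr_desc _ _)).trans ?_)
      rw [Y.act_p, Category.assoc]
  act_id x := by
    refine sum_hom_ext (coprodIsCoprod X.obj Y.obj) x (fun b y hy => ?_) fun b y hy => ?_
    · rw [sumAct_inl X Y x _ _ b y hy]
      refine (congrArg (· ≫ _) ((X.act_congr rfl ?_ _).trans (X.act_id y))).trans hy.symm
      rw [← Category.assoc, hy, Category.assoc, coprod.inl_desc_assoc]
    · rw [sumAct_inr X Y x _ _ b y hy]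
      refine (congrArg (· ≫ _) ((Y.act_congr rfl ?_ _).trans (Y.act_id y))).trans hy.symm
      rw [← Category.assoc, hy, Category.assoc, coprod.inr_desc_assoc]
  act_comp x s r h h' := by
    refine sum_hom_ext (coprodIsCoprod X.obj Y.obj) x (fun b y hy => ?_) fun b y hy => ?_
    · have hb : (b ≫ r) ≫ C.cod = (b ≫ s) ≫ C.dom := by rw [Category.assoc, h', Category.assoc]
      refine (sumAct_inl X Y _ r _ b _ (sumAct_inl X Y x s h b y hy)).trans
        (Eq.trans (congrArg (· ≫ _) ?_) (sumAct_inl X Y x _ _ b y hy).symm)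
      exact (X.act_comp y (b ≫ s) (b ≫ r) _ hb).trans
        (X.act_congr rfl (C.comp_natural _ _ _ _).symm _)
    · have hb : (b ≫ r) ≫ C.cod = (b ≫ s) ≫ C.dom := by rw [Category.assoc, h', Category.assoc]
      refine (sumAct_inr X Y _ r _ b _ (sumAct_inr X Y x s h b y hy)).trans
        (Eq.trans (congrArg (· ≫ _) ?_) (sumAct_inr X Y x _ _ b y hy).symm)
      exact (Y.act_comp y (b ≫ s) (b ≫ r) _ hb).trans
        (Y.act_congr rfl (C.comp_natural _ _ _ _).symm _)

/-- The left injection. -/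
def sumInl : X ⟶ sum X Y where
  app := coprod.inl
  app_p := coprod.inl_desc _ _
  app_act {J} x s h := by
    have h' : s ≫ C.cod = (x ≫ coprod.inl) ≫ coprod.desc X.p Y.p := by
      rw [Category.assoc, coprod.inl_desc, h]
    have := sumAct_inl X Y (x ≫ coprod.inl) s h' (𝟙 J) x (Category.id_comp _)
    rw [Category.id_comp] at this
    exact (congrArg (· ≫ coprod.inl) (X.act_congr rfl (Category.id_comp s).symm h)).trans this.symm

/-- The right injection. -/
def sumInr : Y ⟶ sum X Y where
  app := coprod.inr
  app_p := coprod.inr_desc _ _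
  app_act {J} x s h := by
    have h' : s ≫ C.cod = (x ≫ coprod.inr) ≫ coprod.desc X.p Y.p := by
      rw [Category.assoc, coprod.inr_desc, h]
    have := sumAct_inr X Y (x ≫ coprod.inr) s h' (𝟙 J) x (Category.id_comp _)
    rw [Category.id_comp] at this
    exact (congrArg (· ≫ coprod.inr) (Y.act_congr rfl (Category.id_comp s).symm h)).trans this.symm

variable {X Y} in
/-- Copairing. -/
def sumDesc {W : Psh C} (f : X ⟶ W) (g : Y ⟶ W) : sum X Y ⟶ W where
  app := coprod.desc f.app g.app
  app_p := by
    apply coprod.hom_ext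
    · rw [coprod.inl_desc_assoc, f.app_p]
      exact (coprod.inl_desc _ _).symm
    · rw [coprod.inr_desc_assoc, g.app_p]
      exact (coprod.inr_desc _ _).symm
  app_act {J} x s h := by
    change sumAct X Y x s h ≫ _ = _
    refine sum_hom_ext (coprodIsCoprod X.obj Y.obj) x (fun b y hy => ?_) fun b y hy => ?_
    · rw [← Category.assoc, sumAct_inl X Y x s h b y hy]
      refine (Category.assoc _ _ _).trans ((congrArg (_ ≫ ·) (coprod.inl_desc _ _)).trans ?_)
      rw [f.app_act, W.act_natural]
      refine W.act_congr ?_ rfl _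
      rw [← Category.assoc, hy, Category.assoc, coprod.inl_desc]
    · rw [← Category.assoc, sumAct_inr X Y x s h b y hy]
      refine (Category.assoc _ _ _).trans ((congrArg (_ ≫ ·) (coprod.inr_desc _ _)).trans ?_)
      rw [g.app_act, W.act_natural]
      refine W.act_congr ?_ rfl _
      rw [← Category.assoc, hy, Category.assoc, coprod.inr_desc]

variable {X Y} in
/-- Binary coproducts of internal presheaves are computed on underlying objects. -/
theorem isColimit_app {W : Psh C} {i : X ⟶ W} {j : Y ⟶ W} (hc : IsColimit (BinaryCofan.mk i j)) :
    Nonempty (IsColimit (BinaryCofan.mk i.app j.app)) := by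
  obtain ⟨a, ha₁, ha₂⟩ : ∃ a : W ⟶ sum X Y, i ≫ a = sumInl X Y ∧ j ≫ a = sumInr X Y :=
    let a := BinaryCofan.IsColimit.desc' hc (sumInl X Y) (sumInr X Y)
    ⟨a.1, a.2.1, a.2.2⟩
  have ha₁' : i.app ≫ a.app = coprod.inl := congrArg Hom.app ha₁
  have ha₂' : j.app ≫ a.app = coprod.inr := congrArg Hom.app ha₂
  -- This half of the isomorphism with the explicit coproduct suffices: `a` provides maps out of
  -- `W.obj`, and this equation makes them unique.
  have hab : a ≫ sumDesc i j = 𝟙 W := by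
    apply BinaryCofan.IsColimit.hom_ext hc
    · apply hom_ext
      refine (Category.assoc _ _ _).symm.trans ((congrArg (· ≫ _) ha₁').trans ?_)
      exact (coprod.inl_desc _ _).trans (Category.comp_id _).symm
    · apply hom_ext
      refine (Category.assoc _ _ _).symm.trans ((congrArg (· ≫ _) ha₂').trans ?_)
      exact (coprod.inr_desc _ _).trans (Category.comp_id _).symm
  have hab' : a.app ≫ coprod.desc i.app j.app = 𝟙 W.obj := congrArg Hom.app hab
  refine ⟨BinaryCofan.isColimitMk (fun s => a.app ≫ coprod.desc s.inl s.inr) (fun s => ?_)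
    (fun s => ?_) fun s m h₁ h₂ => ?_⟩
  · rw [← Category.assoc, ha₁']
    exact coprod.inl_desc _ _
  · rw [← Category.assoc, ha₂']
    exact coprod.inr_desc _ _
  · rw [← Category.id_comp m, ← hab', Category.assoc]
    congr 1
    apply coprod.hom_ext
    · exact (coprod.inl_desc_assoc _ _ _).trans (h₁.trans (coprod.inl_desc _ _).symm)
    · exact (coprod.inr_desc_assoc _ _ _).trans (h₂.trans (coprod.inr_desc _ _).symm)

/-- An initial internal presheaf has empty underlying object. -/
theorem empty_of_isInitial {Z : Psh C} (hZ : IsInitial Z) : Nonempty (Z.obj ⟶ ⊥_ E) :=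
  -- An initial presheaf maps to the constant presheaf at `⊥_ E`.
  ⟨(hZ.to ((Δ C).obj (⊥_ E))).app ≫ Limits.prod.fst⟩

end Sum

end Psh

section Cubes

variable {E : Type u} [Category.{v} E] [HasFiniteLimits E] {N : NatObj E}

/-! ### Arrows of the category of cubes -/

namespace CubeCat

/-- The object `[0]` in an arbitrary context. -/
abbrev zero (J : E) : J ⟶ N.nat := terminal.from J ≫ N.zero

/-- The object `[1]` in an arbitrary context. -/
abbrev one (J : E) : J ⟶ N.nat := terminal.from J ≫ N.zero ≫ N.succ

theorem comp_zeroObj {J K : E} (a : K ⟶ J) : a ≫ zero (N := N) J = zero K := by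
  rw [← Category.assoc, Subsingleton.elim (a ≫ terminal.from J) (terminal.from K)]

theorem comp_oneObj {J K : E} (a : K ⟶ J) : a ≫ one (N := N) J = one K := by
  rw [← Category.assoc, Subsingleton.elim (a ≫ terminal.from J) (terminal.from K)]

variable [HasFiniteCoproducts E] (Q : CubeCat N)

theorem eq_of_cod_zero {J : E} {s t : J ⟶ Q.hom} (hs : s ≫ Q.cod = zero J)
    (ht : t ≫ Q.cod = zero J) (h : s ≫ Q.dom = t ≫ Q.dom) : s = t := by
  rw [Q.bang_unique s hs, Q.bang_unique t ht, ← Category.assoc, h, Category.assoc]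

/-- The pairing of arrows `m ⟶ [n]` and `m ⟶ [1]`. -/
theorem exists_pair {J : E} (n : J ⟶ N.nat) (a b : J ⟶ Q.hom) (h : a ≫ Q.dom = b ≫ Q.dom)
    (ha : a ≫ Q.cod = n) (hb : b ≫ Q.cod = one J) :
    ∃ c : J ⟶ Q.hom, ∃ hc : c ≫ Q.cod = n ≫ N.succ, c ≫ Q.dom = a ≫ Q.dom ∧
      Q.comp c (n ≫ Q.projL) (by rw [hc, Category.assoc, Q.projL_dom]) = a ∧
      Q.comp c (n ≫ Q.projR) (by rw [hc, Category.assoc, Q.projR_dom]) = b := by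
  obtain ⟨c, ⟨hc, h₁, h₂⟩, -⟩ := Q.exists_unique_pair n a b h ha hb
  exact ⟨c, hc, by rw [← h₁, Q.comp_dom], h₁, h₂⟩

theorem pair_ext {J : E} (n : J ⟶ N.nat) {c c' : J ⟶ Q.hom} (hc : c ≫ Q.cod = n ≫ N.succ)
    (hc' : c' ≫ Q.cod = n ≫ N.succ)
    (h₁ : Q.comp c (n ≫ Q.projL) (by rw [hc, Category.assoc, Q.projL_dom]) =
      Q.comp c' (n ≫ Q.projL) (by rw [hc', Category.assoc, Q.projL_dom]))
    (h₂ : Q.comp c (n ≫ Q.projR) (by rw [hc, Category.assoc, Q.projR_dom]) =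
      Q.comp c' (n ≫ Q.projR) (by rw [hc', Category.assoc, Q.projR_dom])) : c = c' := by
  have hL : Q.comp c (n ≫ Q.projL) (by rw [hc, Category.assoc, Q.projL_dom]) ≫ Q.cod = n := by
    rw [Q.comp_cod, Category.assoc, Q.projL_cod, Category.comp_id]
  have hR : Q.comp c (n ≫ Q.projR) (by rw [hc, Category.assoc, Q.projR_dom]) ≫ Q.cod = one J := by
    rw [Q.comp_cod, Category.assoc, Q.projR_cod]
    exact comp_oneObj n
  exact (Q.exists_unique_pair n _ _ (by rw [Q.comp_dom, Q.comp_dom]) hL hR).unique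
    ⟨hc, rfl, rfl⟩ ⟨hc', h₁.symm, h₂.symm⟩

/-- Each cube `[n]` has a point. -/
theorem exists_origin :
    ∃ o : N.nat ⟶ Q.hom, o ≫ Q.dom = zero N.nat ∧ o ≫ Q.cod = 𝟙 N.nat := by
  -- `H` is the object of all points `[0] ⟶ [n]`. The origin is defined by recursion into it: a
  -- point is extended by the last coordinate `end₀`.
  let H := pullback Q.dom N.zero
  let i : H ⟶ Q.hom := pullback.fst Q.dom N.zero
  have hi : i ≫ Q.dom = zero H := pullback.condition.trans (by
    rw [Subsingleton.elim (pullback.snd Q.dom N.zero) (terminal.from H)])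
  obtain ⟨c, hc, hd, -, -⟩ := Q.exists_pair (i ≫ Q.cod) i (terminal.from H ≫ CSet.ptArrow Q.end₀)
    (by rw [hi, Category.assoc, CSet.ptArrow_dom]) rfl
    (by rw [Category.assoc, CSet.ptArrow_cod])
  obtain ⟨h, ⟨h₀, h₁⟩, -⟩ := N.exists_unique_rec
    (pullback.lift (N.zero ≫ Q.id) (𝟙 _) (by
      rw [Category.assoc, Q.id_dom, Category.comp_id, Category.id_comp]) : ⊤_ E ⟶ H)
    (pullback.lift c (terminal.from H) (by rw [hd, hi]) : H ⟶ H)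
  refine ⟨h ≫ i, by rw [Category.assoc, hi, comp_zeroObj], N.hom_eq_id _ ?_ ?_⟩
  · rw [← Category.assoc, ← Category.assoc, h₀, pullback.lift_fst, Category.assoc, Q.id_cod,
      Category.comp_id]
  · rw [← Category.assoc, ← Category.assoc, h₁, Category.assoc h, pullback.lift_fst,
      Category.assoc, hc, ← Category.assoc, ← Category.assoc]

end CubeCat

open CubeCat Psh

variable [HasFiniteCoproducts E] {Q : CubeCat N}

/-! ### Elements of the interval and of constant cubical sets -/

section Elements

variable {J K L : E}

/-- The arrow underlying an element of the interval. -/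
def arr (Q : CubeCat N) : (CSet.I Q).obj ⟶ Q.hom := pullback.fst Q.cod (N.zero ≫ N.succ)

/-- The element of the interval given by an arrow. -/
def ofArr (s : J ⟶ Q.hom) (h : s ≫ Q.cod = one J) : J ⟶ (CSet.I Q).obj :=
  pullback.lift s (terminal.from J) h

theorem ofArr_arr (s : J ⟶ Q.hom) (h : s ≫ Q.cod = one J) : ofArr s h ≫ arr Q = s :=
  pullback.lift_fst _ _ _

theorem arr_dom : arr Q ≫ Q.dom = (CSet.I Q).p := rfl

theorem ofArr_p (s : J ⟶ Q.hom) (h : s ≫ Q.cod = one J) :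
    ofArr s h ≫ (CSet.I Q).p = s ≫ Q.dom := by
  rw [← arr_dom, ← Category.assoc, ofArr_arr]

theorem arr_cod : arr Q ≫ Q.cod = one (CSet.I Q).obj :=
  pullback.condition.trans (congrArg (· ≫ _) (Subsingleton.elim _ _))

theorem interval_ext {s t : J ⟶ (CSet.I Q).obj} (h : s ≫ arr Q = t ≫ arr Q) : s = t :=
  yoneda_hom_ext _ _ h

theorem interval_act (t : J ⟶ (CSet.I Q).obj) (s : J ⟶ Q.hom) (h : s ≫ Q.cod = t ≫ (CSet.I Q).p) :
    (CSet.I Q).act t s h ≫ arr Q =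
      Q.comp s (t ≫ arr Q) (by rw [h, Category.assoc, arr_dom]) :=
  yonedaAct_fst _ _ _ _ h

/-- The value of an element of a constant cubical set. -/
def constVal (Q : CubeCat N) (L : E) : ((CSet.Δ Q).obj L).obj ⟶ L := Limits.prod.fst

/-- The element of a constant cubical set with a given value at a given stage. -/
def constElt (Q : CubeCat N) (l : J ⟶ L) (n : J ⟶ N.nat) : J ⟶ ((CSet.Δ Q).obj L).obj :=
  Limits.prod.lift l n

theorem constElt_val (l : J ⟶ L) (n : J ⟶ N.nat) : constElt Q l n ≫ constVal Q L = l :=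
  Limits.prod.lift_fst _ _

theorem constElt_p (l : J ⟶ L) (n : J ⟶ N.nat) : constElt Q l n ≫ ((CSet.Δ Q).obj L).p = n :=
  Limits.prod.lift_snd _ _

theorem const_elt_ext {x y : J ⟶ ((CSet.Δ Q).obj L).obj} (h : x ≫ constVal Q L = y ≫ constVal Q L)
    (hp : x ≫ ((CSet.Δ Q).obj L).p = y ≫ ((CSet.Δ Q).obj L).p) : x = y :=
  Limits.prod.hom_ext h hp

theorem comp_constElt (a : K ⟶ J) (l : J ⟶ L) (n : J ⟶ N.nat) :
    a ≫ constElt Q l n = constElt Q (a ≫ l) (a ≫ n) :=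
  Limits.prod.comp_lift _ _ _

theorem const_act (x : J ⟶ ((CSet.Δ Q).obj L).obj) (s : J ⟶ Q.hom)
    (h : s ≫ Q.cod = x ≫ ((CSet.Δ Q).obj L).p) :
    ((CSet.Δ Q).obj L).act x s h = constElt Q (x ≫ constVal Q L) (s ≫ Q.dom) := rfl

theorem const_map_val (f : L ⟶ K) :
    ((CSet.Δ Q).map f).app ≫ constVal Q K = constVal Q L ≫ f :=
  Limits.prod.map_fst _ _

/-- A map to a constant cubical set, given by its values. -/
def constLift {X : CSet Q} (f : X.obj ⟶ L)
    (hf : ∀ {J : E} (x : J ⟶ X.obj) (s : J ⟶ Q.hom) (h : s ≫ Q.cod = x ≫ X.p),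
      X.act x s h ≫ f = x ≫ f) : X ⟶ (CSet.Δ Q).obj L where
  app := constElt Q f X.p
  app_p := constElt_p _ _
  app_act x s h := by
    rw [const_act, Category.assoc, constElt_val, comp_constElt, hf, X.act_p]

theorem constLift_val {X : CSet Q} (f : X.obj ⟶ L)
    (hf : ∀ {J : E} (x : J ⟶ X.obj) (s : J ⟶ Q.hom) (h : s ≫ Q.cod = x ≫ X.p),
      X.act x s h ≫ f = x ≫ f) : (constLift f hf).app ≫ constVal Q L = f :=
  constElt_val _ _

/-- Maps to a constant cubical set are determined by their values. -/
theorem to_const_hom_ext {X : CSet Q} {f g : X ⟶ (CSet.Δ Q).obj L}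
    (h : f.app ≫ constVal Q L = g.app ≫ constVal Q L) : f = g :=
  Psh.hom_ext (const_elt_ext h (f.app_p.trans g.app_p.symm))

theorem act_const_val {X : CSet Q} (f : X ⟶ (CSet.Δ Q).obj L) (x : J ⟶ X.obj) (s : J ⟶ Q.hom)
    (h : s ≫ Q.cod = x ≫ X.p) :
    X.act x s h ≫ f.app ≫ constVal Q L = x ≫ f.app ≫ constVal Q L := by
  rw [← Category.assoc, f.app_act, const_act, constElt_val, Category.assoc]

/-- The canonical point of a constant cubical set. -/
abbrev genPt (Q : CubeCat N) (L : E) : L ⟶ ((CSet.Δ Q).obj L).obj := constElt Q (𝟙 L) (zero L)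

end Elements

/-! ### Maps on constant cubical sets and products with the interval -/

/-- A map to a constant cubical set is constant along the interval. -/
theorem comp_app_eq_of_const {B : CSet Q} {A : E} (v : (CSet.I Q).prod B ⟶ (CSet.Δ Q).obj A) {J : E}
    (s t : J ⟶ (CSet.I Q).obj) (b : J ⟶ B.obj) (hs : s ≫ (CSet.I Q).p = b ≫ B.p)
    (ht : t ≫ (CSet.I Q).p = b ≫ B.p) : pairElt s b hs ≫ v.app = pairElt t b ht ≫ v.app := by
  have hL : ((b ≫ B.p) ≫ Q.projL) ≫ Q.cod = b ≫ B.p := by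
    rw [Category.assoc, Q.projL_cod, Category.comp_id]
  have hR : ((b ≫ B.p) ≫ Q.projR) ≫ Q.cod = one J := by
    rw [Category.assoc, Q.projR_cod]
    exact comp_oneObj _
  have hτβ : ofArr ((b ≫ B.p) ≫ Q.projR) hR ≫ (CSet.I Q).p =
      B.act b ((b ≫ B.p) ≫ Q.projL) hL ≫ B.p := by
    simp only [ofArr_p, B.act_p, Category.assoc, Q.projR_dom, Q.projL_dom]
  -- The right side does not mention `s`. For `b` at stage `[n]` it is the value at one element of
  -- stage `[n+1]`: the second projection paired with the restriction of `b` along the first.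
  suffices key : ∀ (s : J ⟶ (CSet.I Q).obj) (hs : s ≫ (CSet.I Q).p = b ≫ B.p),
      pairElt s b hs ≫ v.app =
        constElt Q (pairElt _ _ hτβ ≫ v.app ≫ constVal Q A) (b ≫ B.p) by
    rw [key s hs, key t ht]
  intro s hs
  -- The pair of `s` and `b` is the restriction of that element along `⟨id, s⟩ : [n] ⟶ [n+1]`, and a
  -- map to a constant cubical set has the same value at an element and at its restrictions.
  obtain ⟨e, he, hd, h₁, h₂⟩ := Q.exists_pair (b ≫ B.p) ((b ≫ B.p) ≫ Q.id) (s ≫ arr Q)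
    (by rw [Category.assoc s, arr_dom, hs, Category.assoc, Q.id_dom, Category.comp_id])
    (by rw [Category.assoc, Q.id_cod, Category.comp_id])
    (by rw [Category.assoc, arr_cod, comp_oneObj])
  have hd' : e ≫ Q.dom = b ≫ B.p := by rw [hd, Category.assoc, Q.id_dom, Category.comp_id]
  have hx : e ≫ Q.cod = pairElt _ _ hτβ ≫ ((CSet.I Q).prod B).p := by
    rw [he, pairElt_p, B.act_p, Category.assoc _ Q.projL, Q.projL_dom]
  have hxe : ((CSet.I Q).prod B).act (pairElt _ _ hτβ) e hx = pairElt s b hs := by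
    rw [pairElt_act]
    apply prod_elt_ext
    · rw [pairElt_fst, pairElt_fst]
      apply interval_ext
      rw [interval_act]
      exact (comp_congr _ rfl (ofArr_arr _ _) _).trans h₂
    · rw [pairElt_snd, pairElt_snd]
      refine (B.act_comp b _ e hL (by rw [he, Category.assoc _ Q.projL, Q.projL_dom])).trans ?_
      refine (B.act_congr rfl (h₁.trans ?_) _).trans (B.act_id b)
      rw [Category.assoc]
  rw [← hxe, v.app_act, const_act, hd', Category.assoc]

/-- Both are arrows from `[0]` to the terminal object `[0]`. Hence restricting a point along `[0] ⟶
[0]` does nothing. -/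
theorem zero_bang : N.zero ≫ Q.bang = N.zero ≫ Q.id := by
  have h₀ : (𝟙 (⊤_ E)) = terminal.from _ := Subsingleton.elim _ _
  refine Q.eq_of_cod_zero ?_ ?_ ?_
  · rw [Category.assoc, Q.bang_cod]; exact comp_zeroObj _
  · rw [Category.assoc, Q.id_cod, zero, ← h₀, Category.id_comp, Category.comp_id]
  · rw [Category.assoc, Category.assoc, Q.bang_dom, Q.id_dom]

theorem act_zero_bang (X : CSet Q) {L : E} (x : L ⟶ X.obj) (hx : x ≫ X.p = zero L) (s : L ⟶ Q.hom)
    (hs : s = zero L ≫ Q.bang) (h : s ≫ Q.cod = x ≫ X.p) : X.act x s h = x := by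
  refine (X.act_congr rfl ?_ _).trans (X.act_id x)
  rw [hs, Category.assoc, zero_bang, ← Category.assoc, ← Category.assoc, hx]

theorem bang_cod_eq (X : CSet Q) {J L : E} (n : J ⟶ N.nat) (a : J ⟶ L) (x : L ⟶ X.obj)
    (hx : x ≫ X.p = zero L) : (n ≫ Q.bang) ≫ Q.cod = (a ≫ x) ≫ X.p := by
  simp only [Category.assoc, Q.bang_cod, hx]
  exact (comp_zeroObj _).trans (comp_zeroObj _).symm

/-- The map from a constant cubical set given by a family of points. -/
def ofPt (X : CSet Q) {L : E} (x : L ⟶ X.obj) (hx : x ≫ X.p = zero L) : (CSet.Δ Q).obj L ⟶ X where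
  app := X.act (constVal Q L ≫ x) (((CSet.Δ Q).obj L).p ≫ Q.bang) (bang_cod_eq X _ _ x hx)
  app_p := by rw [X.act_p, Category.assoc, Q.bang_dom, Category.comp_id]
  app_act {J} y s h := by
    have h₂ : s ≫ Q.cod = ((y ≫ ((CSet.Δ Q).obj L).p) ≫ Q.bang) ≫ Q.dom := by
      rw [h, Category.assoc _ Q.bang, Q.bang_dom, Category.comp_id]
    -- Compatibility with restriction holds because `[m] ⟶ [n] ⟶ [0]` is the only arrow `[m] ⟶ [0]`.
    have h₃ : Q.comp s ((y ≫ ((CSet.Δ Q).obj L).p) ≫ Q.bang) h₂ = (s ≫ Q.dom) ≫ Q.bang := by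
      refine Q.eq_of_cod_zero ?_ ?_ ?_
      · rw [Q.comp_cod, Category.assoc, Q.bang_cod]
        exact comp_zeroObj _
      · rw [Category.assoc, Q.bang_cod]
        exact comp_zeroObj _
      · rw [Q.comp_dom, Category.assoc, Q.bang_dom, Category.comp_id]
    have h₄ := bang_cod_eq X (y ≫ ((CSet.Δ Q).obj L).p) (y ≫ constVal Q L) x hx
    rw [const_act, X.act_natural]
    refine Eq.trans ?_ ((X.act_comp _ _ s h₄ h₂).symm.trans (X.act_congr ?_ rfl _))
    · refine X.act_congr ?_ ?_ _
      · rw [← Category.assoc, constElt_val]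
      · rw [h₃, ← Category.assoc, constElt_p]
    · rw [X.act_natural]
      exact X.act_congr (Category.assoc _ _ _) (Category.assoc _ _ _) _

theorem constElt_ofPt (X : CSet Q) {L : E} (x : L ⟶ X.obj) (hx : x ≫ X.p = zero L) {J : E}
    (l : J ⟶ L) (n : J ⟶ N.nat) : constElt Q l n ≫ (ofPt X x hx).app =
      X.act (l ≫ x) (n ≫ Q.bang) (bang_cod_eq X n l x hx) := by
  refine (X.act_natural _ _ _ _).trans (X.act_congr ?_ ?_ _)
  · rw [← Category.assoc, constElt_val]
  · rw [← Category.assoc, constElt_p]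

theorem constElt_zero_ofPt (X : CSet Q) {L : E} (x : L ⟶ X.obj) (hx : x ≫ X.p = zero L) {J : E}
    (l : J ⟶ L) : constElt Q l (zero J) ≫ (ofPt X x hx).app = l ≫ x := by
  rw [constElt_ofPt]
  exact act_zero_bang X _ (by rw [Category.assoc, hx, comp_zeroObj]) _ rfl _

theorem genPt_ofPt (X : CSet Q) {L : E} (x : L ⟶ X.obj) (hx : x ≫ X.p = zero L) :
    genPt Q L ≫ (ofPt X x hx).app = x := by
  rw [constElt_zero_ofPt, Category.id_comp]

/-- A map from a constant cubical set is determined by its value at the canonical point. -/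
theorem const_hom_ext {X : CSet Q} {L : E} {f g : (CSet.Δ Q).obj L ⟶ X}
    (h : genPt Q L ≫ f.app = genPt Q L ≫ g.app) : f = g := by
  apply Psh.hom_ext
  have h₁ := bang_cod_eq ((CSet.Δ Q).obj L) ((CSet.Δ Q).obj L).p (constVal Q L) (genPt Q L)
    (constElt_p _ _)
  -- Every element of `Δ L` is the restriction of the canonical point along some `[n] ⟶ [0]`.
  have key : ((CSet.Δ Q).obj L).act (constVal Q L ≫ genPt Q L) (((CSet.Δ Q).obj L).p ≫ Q.bang) h₁ =
      𝟙 _ := by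
    rw [const_act]
    apply const_elt_ext
    · rw [constElt_val, Category.assoc, constElt_val, Category.comp_id, Category.id_comp]
    · rw [constElt_p, Category.assoc, Q.bang_dom, Category.comp_id, Category.id_comp]
  have hf := f.app_act _ _ h₁
  have hg := g.app_act _ _ h₁
  rw [key] at hf hg
  refine (Category.id_comp _).symm.trans (hf.trans (Eq.trans (X.act_congr ?_ rfl _)
    (hg.symm.trans (Category.id_comp _))))
  rw [Category.assoc, h, Category.assoc]

end Cubes

section Cubes

open CubeCat Psh

variable {E : Type u} [Category.{v} E] [HasFiniteLimits E] [HasFiniteCoproducts E] {N : NatObj E}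
  {Q : CubeCat N}

/-! ### Graphs of maps to the interval -/

theorem elt_graph {B : CSet Q} (r : B ⟶ CSet.I Q) {J : E} (b : J ⟶ B.obj) :
    b ≫ (CSet.graph r).app = pairElt (b ≫ r.app) b (by rw [Category.assoc, r.app_p]) := by
  rw [elt_lift]
  apply prod_elt_ext
  · rw [pairElt_fst, pairElt_fst]
  · rw [pairElt_snd, pairElt_snd, id_app, Category.comp_id]

theorem graph_map {A B : CSet Q} (m : A ⟶ B) (r : B ⟶ CSet.I Q) :
    CSet.graph (m ≫ r) ≫ Psh.map (𝟙 (CSet.I Q)) m = m ≫ CSet.graph r := by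
  apply prod_hom_ext
  · rw [Psh.map, Category.assoc, Category.assoc, lift_fst, lift_fst, ← Category.assoc, lift_fst,
      Category.comp_id]
  · rw [Psh.map, Category.assoc, Category.assoc, lift_snd, lift_snd, ← Category.assoc, lift_snd,
      Category.comp_id, Category.id_comp]

theorem graph_snd {B : CSet Q} (r : B ⟶ CSet.I Q) : CSet.graph r ≫ Psh.snd (CSet.I Q) B = 𝟙 B :=
  lift_snd _ _

theorem graph_fst {B : CSet Q} (r : B ⟶ CSet.I Q) : CSet.graph r ≫ Psh.fst (CSet.I Q) B = r :=
  lift_fst _ _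

theorem map_snd {X X' Y Y' : CSet Q} (f : X ⟶ X') (g : Y ⟶ Y') :
    Psh.map f g ≫ Psh.snd X' Y' = Psh.snd X Y ≫ g :=
  lift_snd _ _

theorem map_fst {X X' Y Y' : CSet Q} (f : X ⟶ X') (g : Y ⟶ Y') :
    Psh.map f g ≫ Psh.fst X' Y' = Psh.fst X Y ≫ f :=
  lift_fst _ _

/-- A map `I × B ⟶ Δ A` is determined by its restriction to any graph. -/
theorem const_eq_snd_graph {B : CSet Q} {A : E} (v : (CSet.I Q).prod B ⟶ (CSet.Δ Q).obj A)
    (r : B ⟶ CSet.I Q) : v = Psh.snd (CSet.I Q) B ≫ CSet.graph r ≫ v := by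
  apply Psh.hom_ext
  rw [comp_app, comp_app, ← Category.assoc, elt_graph]
  have h := eq_pairElt (𝟙 ((CSet.I Q).prod B).obj)
  refine (Category.id_comp _).symm.trans ((congrArg (· ≫ v.app) h).trans ?_)
  refine (comp_app_eq_of_const v _ ((Psh.snd (CSet.I Q) B).app ≫ r.app) _ _ ?_).trans ?_
  · rw [Category.id_comp, Category.assoc, r.app_p]
  · refine congrArg (· ≫ v.app) ?_
    apply prod_elt_ext
    · rw [pairElt_fst, pairElt_fst]
    · rw [pairElt_snd, pairElt_snd, Category.id_comp]

theorem constPt_natural {A B : CSet Q} (m : A ⟶ B)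
    (e : ⊤_ E ⟶ Q.homBetween N.zero (N.zero ≫ N.succ)) :
    m ≫ CSet.constPt B e = CSet.constPt A e := by
  apply Psh.hom_ext
  change m.app ≫ CSet.constArrow B.p e = CSet.constArrow A.p e
  rw [CSet.constArrow_natural, m.app_p]

/-! ### Kan fibrations and h-propositions -/

variable {K : KanData Q}

theorem to_const_terminal_hom_ext {X : CSet Q} (f g : X ⟶ (CSet.Δ Q).obj (⊤_ E)) : f = g :=
  to_const_hom_ext (Subsingleton.elim _ _)

/-- The map to the constant cubical set at `1`. -/
def toConstTerminal (X : CSet Q) : X ⟶ (CSet.Δ Q).obj (⊤_ E) :=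
  constLift (terminal.from _) fun _ _ _ => Subsingleton.elim _ _

/-- The map `v` is constant along the interval, so it is determined on the graph of `r`, where `x₀`
shows that it factors through `t`. All the other equations hold because `Δ 1` is terminal. -/
theorem isKanFibration_const_point {Ω : E} (t : ⊤_ E ⟶ Ω) :
    IsKanFibration K ((CSet.Δ Q).map t) := by
  intro A B m r _ _ w x₀ v _ hx₀ _
  refine ⟨toConstTerminal _, ?_, to_const_terminal_hom_ext _ _, to_const_terminal_hom_ext _ _⟩
  rw [const_eq_snd_graph v r, ← hx₀, ← Category.assoc]
  exact congrArg (· ≫ _) (to_const_terminal_hom_ext _ _)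

/-- The homotopy between the two projections of `X ×_Y X` is universal; it is reindexed along the
pair of `x` and `y`. -/
theorem IsHProp.fibrewiseHomotopic {X Y Z : CSet Q} {f : X ⟶ Y} (hf : IsHProp K f) (x y : Z ⟶ X)
    (h : x ≫ f = y ≫ f) : FibrewiseHomotopic f x y := by
  obtain ⟨H, h₀, h₁, h₂⟩ := hf.2 _ _ (isPullback_pb f f)
  have hx : (isPullback_pb f f).lift x y h ≫ pbFst f f = x := (isPullback_pb f f).lift_fst x y h
  have hy : (isPullback_pb f f).lift x y h ≫ pbSnd f f = y := (isPullback_pb f f).lift_snd x y h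
  refine ⟨Psh.map (𝟙 _) ((isPullback_pb f f).lift x y h) ≫ H, ?_, ?_, ?_⟩
  · rw [← constPt_natural ((isPullback_pb f f).lift x y h), ← Category.assoc, graph_map, Category.assoc, h₀, hx]
  · rw [← constPt_natural ((isPullback_pb f f).lift x y h), ← Category.assoc, graph_map, Category.assoc, h₁, hy]
  · rw [Category.assoc, h₂, ← Category.assoc, map_snd, Category.assoc, ← Category.assoc _ _ f, hx]

theorem FibrewiseHomotopic.refl {X Y Z : CSet Q} (f : X ⟶ Y) (x : Z ⟶ X) :
    FibrewiseHomotopic f x x :=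
  ⟨Psh.snd _ _ ≫ x, by rw [← Category.assoc, graph_snd, Category.id_comp],
    by rw [← Category.assoc, graph_snd, Category.id_comp], Category.assoc _ _ _⟩

theorem IsKanFibration.of_isPullback {X Y V Z : CSet Q} {f : X ⟶ Y} (hf : IsKanFibration K f)
    {k : V ⟶ X} {l : V ⟶ Z} {g : Z ⟶ Y} (hp : IsPullback k l f g) : IsKanFibration K l := by
  intro A B m r hm hr w x₀ v hw hx₀ hwx
  obtain ⟨h, h₁, h₂, h₃⟩ := hf m r hm hr (w ≫ k) (x₀ ≫ k) (v ≫ g)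
    (by rw [Category.assoc, hp.w, ← Category.assoc, hw, Category.assoc])
    (by rw [Category.assoc, hp.w, ← Category.assoc, hx₀, Category.assoc])
    (by rw [← Category.assoc, hwx, Category.assoc])
  refine ⟨hp.lift h v h₁, hp.lift_snd _ _ _, hp.hom_ext ?_ ?_, hp.hom_ext ?_ ?_⟩
  · rw [Category.assoc, hp.lift_fst, h₂]
  · rw [Category.assoc, hp.lift_snd, hw]
  · rw [Category.assoc, hp.lift_fst, h₃]
  · rw [Category.assoc, hp.lift_snd, hx₀]

/-- The homotopy in `X` lifts to `V` when paired with the constant homotopy in `Z`. This allows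
elimination of a truncation into a reindexed h-proposition. -/
theorem IsHProp.of_isPullback {X Y V Z : CSet Q} {f : X ⟶ Y} (hf : IsHProp K f)
    {k : V ⟶ X} {l : V ⟶ Z} {g : Z ⟶ Y} (hp : IsPullback k l f g) : IsHProp K l := by
  refine ⟨IsKanFibration.of_isPullback hf.1 hp, fun {P} p₁ p₂ hP => ?_⟩
  obtain ⟨H, h₀, h₁, h₂⟩ := hf.fibrewiseHomotopic (p₁ ≫ k) (p₂ ≫ k) (by
    rw [Category.assoc, Category.assoc, hp.w, ← Category.assoc, hP.w, Category.assoc])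
  have hw : H ≫ f = (Psh.snd _ P ≫ p₁ ≫ l) ≫ g := by
    rw [h₂]
    simp only [Category.assoc, hp.w]
  refine ⟨hp.lift H _ hw, hp.hom_ext ?_ ?_, hp.hom_ext ?_ ?_, hp.lift_snd _ _ _⟩
  · rw [Category.assoc, hp.lift_fst, h₀]
  · rw [Category.assoc, hp.lift_snd, ← Category.assoc, graph_snd, Category.id_comp]
  · rw [Category.assoc, hp.lift_fst, h₁]
  · rw [Category.assoc, hp.lift_snd, ← Category.assoc, graph_snd, Category.id_comp, hP.w]

/-! ### Transport along a path -/

theorem cubeMap_cod {J : E} {L : E} {Y : CSet Q} {y : L ⟶ Y.obj} (hy : y ≫ Y.p = one L)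
    (a : J ⟶ L) (t : J ⟶ (CSet.I Q).obj) : (t ≫ arr Q) ≫ Q.cod = (a ≫ y) ≫ Y.p := by
  rw [Category.assoc, arr_cod, Category.assoc, hy, comp_oneObj, comp_oneObj]

/-- The map `I × Δ L ⟶ Y` given by a family of `1`-cubes of `Y`. -/
def cubeMap {L : E} {Y : CSet Q} (y : L ⟶ Y.obj) (hy : y ≫ Y.p = one L) :
    (CSet.I Q).prod ((CSet.Δ Q).obj L) ⟶ Y where
  app := Y.act (((Psh.snd (CSet.I Q) ((CSet.Δ Q).obj L)).app ≫ constVal Q L) ≫ y)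
    ((Psh.fst (CSet.I Q) ((CSet.Δ Q).obj L)).app ≫ arr Q) (cubeMap_cod hy _ _)
  app_p := by rw [Y.act_p, Category.assoc, arr_dom, Hom.app_p]
  app_act {J} z s h := by
    have h' : s ≫ Q.cod = (z ≫ (Psh.fst (CSet.I Q) ((CSet.Δ Q).obj L)).app ≫ arr Q) ≫ Q.dom := by
      rw [h, Category.assoc, Category.assoc, arr_dom, (Psh.fst _ _).app_p]
    rw [Y.act_natural]
    refine Eq.trans (Y.act_congr ?_ ?_ _) ((Y.act_comp _ _ s
      (cubeMap_cod hy (z ≫ (Psh.snd (CSet.I Q) ((CSet.Δ Q).obj L)).app ≫ constVal Q L)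
        (z ≫ (Psh.fst (CSet.I Q) ((CSet.Δ Q).obj L)).app)) (by simp only [h', Category.assoc])).symm.trans
      (Y.act_congr ?_ rfl _))
    · rw [← Category.assoc, act_const_val]
    · rw [← Category.assoc, Hom.app_act, interval_act]
    · rw [Y.act_natural]
      exact Y.act_congr (by simp only [Category.assoc]) (by simp only [Category.assoc]) _

theorem pairElt_cubeMap {J L : E} {Y : CSet Q} (y : L ⟶ Y.obj) (hy : y ≫ Y.p = one L)
    (t : J ⟶ (CSet.I Q).obj) (x : J ⟶ ((CSet.Δ Q).obj L).obj)
    (h : t ≫ (CSet.I Q).p = x ≫ ((CSet.Δ Q).obj L).p) :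
    pairElt t x h ≫ (cubeMap y hy).app =
      Y.act ((x ≫ constVal Q L) ≫ y) (t ≫ arr Q) (cubeMap_cod hy _ _) := by
  refine (Y.act_natural _ _ _ _).trans (Y.act_congr ?_ ?_ _)
  · rw [← Category.assoc, ← Category.assoc, pairElt_snd]
  · rw [← Category.assoc, pairElt_fst]

/-- In a Kan fibration, a lift of one end of a path in the base yields a lift of the other end. -/
theorem IsKanFibration.exists_transport [FinitaryExtensive E] {X Y : CSet Q} {f : X ⟶ Y}
    (hf : IsKanFibration K f) {O : CSet Q} (hO : IsInitial O) {L : E} (y : L ⟶ Y.obj)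
    (p q : L ⟶ Q.hom) (hpd : p ≫ Q.dom = zero L) (hqd : q ≫ Q.dom = zero L)
    (hpc : p ≫ Q.cod = one L) (hqc : q ≫ Q.cod = one L) (hp : p ≫ Q.cod = y ≫ Y.p)
    (hq : q ≫ Q.cod = y ≫ Y.p) (x : L ⟶ X.obj) (hx : x ≫ f.app = Y.act y p hp) :
    ∃ x' : L ⟶ X.obj, x' ≫ f.app = Y.act y q hq := by
  have hy : y ≫ Y.p = one L := hp.symm.trans hpc
  have hxp : x ≫ X.p = zero L := by rw [← f.app_p, ← Category.assoc, hx, Y.act_p, hpd]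
  have hpt : ofArr p hpc ≫ (CSet.I Q).p = zero L := by rw [ofArr_p, hpd]
  -- The open box has base `x` at the point `p` and empty walls. The point `p` may vary with `L`;
  -- `r` is still admissible because its source is constant.
  let r : (CSet.Δ Q).obj L ⟶ CSet.I Q := ofPt _ (ofArr p hpc) hpt
  have hempty : ∀ {Z : CSet Q} (a b : (CSet.I Q).prod O ⟶ Z), a = b := by
    intro Z a b
    obtain ⟨e⟩ := empty_of_isInitial hO
    exact Psh.hom_ext (hom_ext_of_empty ⟨(Psh.snd (CSet.I Q) O).app ≫ e⟩ _ _)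
  obtain ⟨h, h₁, -, -⟩ := hf (hO.to ((CSet.Δ Q).obj L)) r (K.cof_initial _ hO)
    (by
      have := K.src_const (𝟙 ((CSet.Δ Q).obj L)) r
      rwa [Category.id_comp] at this)
    (Psh.snd _ O ≫ hO.to X) (ofPt X x hxp) (cubeMap y hy) (hempty _ _)
    (by
      apply const_hom_ext
      rw [comp_app, comp_app, ← Category.assoc, ← Category.assoc, genPt_ofPt, elt_graph,
        pairElt_cubeMap, hx]
      refine Y.act_congr ?_ ?_ _
      · rw [constElt_val, Category.id_comp]
      · rw [genPt_ofPt, ofArr_arr])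
    (hO.hom_ext _ _)
  have hqt : ofArr q hqc ≫ (CSet.I Q).p = genPt Q L ≫ ((CSet.Δ Q).obj L).p := by
    rw [ofArr_p, hqd, constElt_p]
  -- The filler is evaluated at the other point `q` of the path.
  refine ⟨pairElt (ofArr q hqc) (genPt Q L) hqt ≫ h.app, ?_⟩
  rw [Category.assoc, ← comp_app, h₁, pairElt_cubeMap]
  refine Y.act_congr ?_ (ofArr_arr _ _) _
  rw [constElt_val, Category.id_comp]

end Cubes

/-- Functions on an object over a coproduct may be defined by cases on generalised elements. -/
theorem sum_family_exists {E : Type u} [Category.{v} E] [FinitaryExtensive E] [HasFiniteLimits E]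
    {A B C : E} {i : A ⟶ B} {j : C ⟶ B} (hc : IsColimit (BinaryCofan.mk i j)) {K G : E} (x : K ⟶ B)
    (φ₁ : ∀ {L : E} (a : L ⟶ K) (y : L ⟶ A), a ≫ x = y ≫ i → (L ⟶ G))
    (φ₂ : ∀ {L : E} (a : L ⟶ K) (y : L ⟶ C), a ≫ x = y ≫ j → (L ⟶ G))
    (hφ₁ : ∀ {L L' : E} (b : L' ⟶ L) (a : L ⟶ K) (y : L ⟶ A) (h : a ≫ x = y ≫ i),
      b ≫ φ₁ a y h = φ₁ (b ≫ a) (b ≫ y) (by rw [Category.assoc, h, Category.assoc]))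
    (hφ₂ : ∀ {L L' : E} (b : L' ⟶ L) (a : L ⟶ K) (y : L ⟶ C) (h : a ≫ x = y ≫ j),
      b ≫ φ₂ a y h = φ₂ (b ≫ a) (b ≫ y) (by rw [Category.assoc, h, Category.assoc])) :
    ∃ k : K ⟶ G,
      (∀ {L : E} (a : L ⟶ K) (y : L ⟶ A) (h : a ≫ x = y ≫ i), a ≫ k = φ₁ a y h) ∧
      (∀ {L : E} (a : L ⟶ K) (y : L ⟶ C) (h : a ≫ x = y ≫ j), a ≫ k = φ₂ a y h) := by
  obtain ⟨k, h₁, h₂⟩ := sum_hom_exists hc x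
    (φ₁ (pullback.fst x i) (pullback.snd x i) pullback.condition)
    (φ₂ (pullback.fst x j) (pullback.snd x j) pullback.condition)
  refine ⟨k, fun a y h => ?_, fun a y h => ?_⟩
  · rw [h₁ a y h, hφ₁]
    simp only [pullback.lift_fst, pullback.lift_snd]
  · rw [h₂ a y h, hφ₂]
    simp only [pullback.lift_fst, pullback.lift_snd]

section Cubes

open CubeCat Psh

variable {E : Type u} [Category.{v} E] [HasFiniteLimits E] [HasFiniteCoproducts E] {N : NatObj E}
  {Q : CubeCat N}

/-! ### Global sections -/

/-- The underlying element of a global section. -/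
def ptVal (X : CSet Q) : (CSet.Γ Q).obj X ⟶ X.obj := pullback.fst X.p N.zero

theorem ptVal_p (X : CSet Q) : ptVal X ≫ X.p = zero ((CSet.Γ Q).obj X) :=
  pullback.condition.trans (congrArg (· ≫ _) (Subsingleton.elim _ _))

/-- The global section given by an element at stage `[0]`. -/
def mkPt {X : CSet Q} {L : E} (x : L ⟶ X.obj) (hx : x ≫ X.p = zero L) : L ⟶ (CSet.Γ Q).obj X :=
  pullback.lift x (terminal.from L) hx

theorem mkPt_val {X : CSet Q} {L : E} (x : L ⟶ X.obj) (hx : x ≫ X.p = zero L) :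
    mkPt x hx ≫ ptVal X = x :=
  pullback.lift_fst _ _ _

theorem comp_ptVal_p {X : CSet Q} {L : E} (x : L ⟶ (CSet.Γ Q).obj X) :
    (x ≫ ptVal X) ≫ X.p = zero L := by
  rw [Category.assoc, ptVal_p, comp_zeroObj]

theorem pt_ext {X : CSet Q} {L : E} {x y : L ⟶ (CSet.Γ Q).obj X}
    (h : x ≫ ptVal X = y ≫ ptVal X) : x = y :=
  pullback.hom_ext h (Subsingleton.elim _ _)

theorem Γ_map_val {X Y : CSet Q} (f : X ⟶ Y) :
    (CSet.Γ Q).map f ≫ ptVal Y = ptVal X ≫ f.app :=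
  pullback.lift_fst _ _ _

theorem comp_Γ_map_val {X Y : CSet Q} (f : X ⟶ Y) {L : E} (x : L ⟶ (CSet.Γ Q).obj X) :
    (x ≫ (CSet.Γ Q).map f) ≫ ptVal Y = (x ≫ ptVal X) ≫ f.app := by
  rw [Category.assoc, Γ_map_val, Category.assoc]

/-! ### Families of points over a constant cubical set -/

/-- For `e : G ⟶ J`, the object of all `(j, n, φ)` where `φ` assigns to each point `[0] ⟶ [n]` an
element of the fibre `G_j`. -/
structure PointFamily (Q : CubeCat N) {G J : E} (e : G ⟶ J) where
  obj : E
  base : obj ⟶ J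
  p : obj ⟶ N.nat
  ev : ∀ {K : E} (x : K ⟶ obj) (t : K ⟶ Q.hom), t ≫ Q.dom = zero K → t ≫ Q.cod = x ≫ p → (K ⟶ G)
  ev_natural : ∀ {K L : E} (a : L ⟶ K) (x : K ⟶ obj) (t : K ⟶ Q.hom) (hd : t ≫ Q.dom = zero K)
    (hc : t ≫ Q.cod = x ≫ p), a ≫ ev x t hd hc = ev (a ≫ x) (a ≫ t)
      (by rw [Category.assoc, hd, comp_zeroObj]) (by rw [Category.assoc, hc, Category.assoc])
  ev_base : ∀ {K : E} (x : K ⟶ obj) (t : K ⟶ Q.hom) (hd : t ≫ Q.dom = zero K)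
    (hc : t ≫ Q.cod = x ≫ p), ev x t hd hc ≫ e = x ≫ base
  ext : ∀ {K : E} (x x' : K ⟶ obj), x ≫ base = x' ≫ base → ∀ hp : x ≫ p = x' ≫ p,
    (∀ {L : E} (a : L ⟶ K) (t : L ⟶ Q.hom) (hd : t ≫ Q.dom = zero L)
      (hc : t ≫ Q.cod = (a ≫ x) ≫ p), ev (a ≫ x) t hd hc = ev (a ≫ x') t hd
        (by rw [hc, Category.assoc, hp, Category.assoc])) → x = x'
  exists_of : ∀ {K : E} (j : K ⟶ J) (n : K ⟶ N.nat)
    (φ : ∀ {L : E} (a : L ⟶ K) (t : L ⟶ Q.hom), t ≫ Q.dom = zero L → t ≫ Q.cod = a ≫ n → (L ⟶ G)),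
    (∀ {L : E} (a : L ⟶ K) (t : L ⟶ Q.hom) (hd : t ≫ Q.dom = zero L) (hc : t ≫ Q.cod = a ≫ n),
      φ a t hd hc ≫ e = a ≫ j) →
    (∀ {L L' : E} (b : L' ⟶ L) (a : L ⟶ K) (t : L ⟶ Q.hom) (hd : t ≫ Q.dom = zero L)
      (hc : t ≫ Q.cod = a ≫ n), b ≫ φ a t hd hc = φ (b ≫ a) (b ≫ t)
        (by rw [Category.assoc, hd, comp_zeroObj]) (by rw [Category.assoc, hc, Category.assoc])) →
    ∃ (x : K ⟶ obj) (_ : x ≫ base = j) (hp : x ≫ p = n),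
      ∀ {L : E} (a : L ⟶ K) (t : L ⟶ Q.hom) (hd : t ≫ Q.dom = zero L) (hc : t ≫ Q.cod = a ≫ n),
        ev (a ≫ x) t hd (by rw [hc, Category.assoc, hp]) = φ a t hd hc

/-- Let `H` be the object of points of cubes. The fibre of `J × H ⟶ J × ℕ` over `(j, n)` consists of
the points of `[n]`, so the dependent product of `G × H ⟶ J × H` along this map consists of the
required families. -/
theorem nonempty_pointFamily [LocallyCartesianClosed E] {G J : E} (e : G ⟶ J) :
    Nonempty (PointFamily Q e) := by
  let H := pullback Q.dom N.zero
  let i : H ⟶ Q.hom := pullback.fst Q.dom N.zero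
  have hi : i ≫ Q.dom = zero H :=
    pullback.condition.trans (congrArg (· ≫ _) (Subsingleton.elim _ _))
  let pt : ∀ {K : E} (t : K ⟶ Q.hom), t ≫ Q.dom = zero K → (K ⟶ H) :=
    fun t ht => pullback.lift t (terminal.from _) ht
  have pt_i : ∀ {K : E} (t : K ⟶ Q.hom) (ht : t ≫ Q.dom = zero K), pt t ht ≫ i = t :=
    fun t ht => pullback.lift_fst _ _ _
  have H_ext : ∀ {K : E} {s t : K ⟶ H}, s ≫ i = t ≫ i → s = t :=
    fun h => pullback.hom_ext h (Subsingleton.elim _ _)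
  obtain ⟨P, q, ev, hev, hex, hext⟩ := exists_dependentProduct
    (Limits.prod.map e (𝟙 H)) (Limits.prod.map (𝟙 J) (i ≫ Q.cod))
  -- A point of the cube on which `x` lives is an index at which the family `x` can be evaluated.
  have hm : ∀ {K : E} (x : K ⟶ P) (t : K ⟶ Q.hom) (hd : t ≫ Q.dom = zero K),
      t ≫ Q.cod = x ≫ q ≫ Limits.prod.snd → x ≫ q =
        Limits.prod.lift (x ≫ q ≫ Limits.prod.fst) (pt t hd) ≫
          Limits.prod.map (𝟙 J) (i ≫ Q.cod) := by
    intro K x t hd hc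
    rw [Limits.prod.lift_map, ← Category.assoc (pt t hd), pt_i, hc, Category.comp_id]
    apply Limits.prod.hom_ext
    · rw [Limits.prod.lift_fst, Category.assoc]
    · rw [Limits.prod.lift_snd, Category.assoc]
  have hev₁ : (ev ≫ Limits.prod.fst) ≫ e = pullback.snd _ _ ≫ Limits.prod.fst := by
    rw [← hev, Category.assoc, Category.assoc, Limits.prod.map_fst]
  have hev₂ : ev ≫ Limits.prod.snd = pullback.snd _ _ ≫ Limits.prod.snd := by
    rw [← hev, Category.assoc, Limits.prod.map_snd, Category.comp_id]
  -- Conversely, each index arises from a point, so agreement at points is agreement of families.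
  have hM : ∀ {K : E} (x : K ⟶ P) (m : K ⟶ J ⨯ H)
      (h : x ≫ q = m ≫ Limits.prod.map (𝟙 J) (i ≫ Q.cod)),
      Limits.prod.lift (x ≫ q ≫ Limits.prod.fst) (pt ((m ≫ Limits.prod.snd) ≫ i)
        (by rw [Category.assoc, hi, comp_zeroObj])) = m := by
    intro K x m h
    apply Limits.prod.hom_ext
    · rw [Limits.prod.lift_fst, ← Category.assoc, h, Category.assoc, Limits.prod.map_fst,
        Category.comp_id]
    · rw [Limits.prod.lift_snd]
      exact H_ext (pt_i _ _)
  refine ⟨{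
    obj := P
    base := q ≫ Limits.prod.fst
    p := q ≫ Limits.prod.snd
    ev := fun x t hd hc => pullback.lift x _ (hm x t hd hc) ≫ ev ≫ Limits.prod.fst
    ev_natural := fun a x t hd hc => ?_
    ev_base := fun x t hd hc => ?_
    ext := fun x x' hb hp h => ?_
    exists_of := fun {K} j n φ hφ hφ' => ?_ }⟩
  · rw [← Category.assoc]
    refine congrArg (· ≫ _) ?_
    apply pullback.hom_ext
    · simp only [Category.assoc, pullback.lift_fst]
    · simp only [Category.assoc, pullback.lift_snd, Limits.prod.comp_lift]
      congr 1
      apply H_ext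
      rw [Category.assoc, pt_i, pt_i]
  · rw [Category.assoc, hev₁, ← Category.assoc, pullback.lift_snd, Limits.prod.lift_fst]
  · refine hext x x' (Limits.prod.hom_ext (by simpa only [Category.assoc] using hb)
      (by simpa only [Category.assoc] using hp)) fun a m hm' => ?_
    have hd : ((m ≫ Limits.prod.snd) ≫ i) ≫ Q.dom = zero _ := by
      rw [Category.assoc, hi, comp_zeroObj]
    have hc : ((m ≫ Limits.prod.snd) ≫ i) ≫ Q.cod = (a ≫ x) ≫ q ≫ Limits.prod.snd := by
      rw [← Category.assoc (a ≫ x), hm', Category.assoc, Category.assoc, Category.assoc,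
        Limits.prod.map_snd]
    have key := h a ((m ≫ Limits.prod.snd) ≫ i) hd hc
    have e₁ := hM (a ≫ x) m hm'
    have hx' : (a ≫ x') ≫ q = (a ≫ x) ≫ q := by
      rw [Category.assoc, Category.assoc]
      refine congrArg (a ≫ ·) (Limits.prod.hom_ext ?_ ?_)
      · simpa only [Category.assoc] using hb.symm
      · simpa only [Category.assoc] using hp.symm
    have e₂ := hM (a ≫ x') m (hx'.trans hm')
    simp only [e₁, e₂] at key
    apply Limits.prod.hom_ext
    · simpa only [Category.assoc] using key
    · rw [Category.assoc, Category.assoc, hev₂, ← Category.assoc, ← Category.assoc,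
        pullback.lift_snd, pullback.lift_snd]
  · let z := Limits.prod.lift j n
    let u : J ⨯ H ⟶ J ⨯ N.nat := Limits.prod.map (𝟙 J) (i ≫ Q.cod)
    have hzu := pullback.condition (f := z) (g := u)
    have hd : ((pullback.snd z u ≫ Limits.prod.snd) ≫ i) ≫ Q.dom = zero _ := by
      rw [Category.assoc, hi, comp_zeroObj]
    have hc : ((pullback.snd z u ≫ Limits.prod.snd) ≫ i) ≫ Q.cod = pullback.fst z u ≫ n := by
      have := congrArg (· ≫ Limits.prod.snd) hzu
      simp only [z, u, Category.assoc, Limits.prod.lift_snd, Limits.prod.map_snd] at this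
      simpa only [Category.assoc] using this.symm
    have hj : pullback.fst z u ≫ j = pullback.snd z u ≫ Limits.prod.fst := by
      have := congrArg (· ≫ Limits.prod.fst) hzu
      simpa only [z, u, Category.assoc, Limits.prod.lift_fst, Limits.prod.map_fst,
        Category.comp_id] using this
    obtain ⟨x, hx, hk⟩ := hex z (Limits.prod.lift (φ (pullback.fst z u) _ hd hc)
      (pullback.snd z u ≫ Limits.prod.snd)) (by
        rw [Limits.prod.lift_map, hφ, hj, Category.comp_id]
        apply Limits.prod.hom_ext
        · rw [Limits.prod.lift_fst]
        · rw [Limits.prod.lift_snd])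
    refine ⟨x, by rw [← Category.assoc, hx, Limits.prod.lift_fst],
      by rw [← Category.assoc, hx, Limits.prod.lift_snd], fun a t hd' hc' => ?_⟩
    have hm' : a ≫ z = Limits.prod.lift ((a ≫ x) ≫ q ≫ Limits.prod.fst) (pt t hd') ≫ u := by
      rw [← hx, ← Category.assoc]
      refine hm (a ≫ x) t hd' ?_
      rw [hc', Category.assoc, ← Category.assoc x, hx, Limits.prod.lift_snd]
    have := hk a _ hm'
    rw [← Category.assoc, this, Category.assoc, Limits.prod.lift_fst, hφ']
    have e₂ : pullback.lift a _ hm' ≫ (pullback.snd z u ≫ Limits.prod.snd) ≫ i = t := by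
      rw [← Category.assoc, ← Category.assoc, pullback.lift_snd, Limits.prod.lift_snd, pt_i]
    have φ_congr : ∀ {L : E} {a a' : L ⟶ K} {t t' : L ⟶ Q.hom} (ha : a = a') (ht : t = t')
        (hd : t ≫ Q.dom = zero L) (hc : t ≫ Q.cod = a ≫ n),
        φ a t hd hc = φ a' t' (ht ▸ hd) (ht ▸ ha ▸ hc) := by
      rintro L a _ t _ rfl rfl hd hc
      rfl
    exact φ_congr (pullback.lift_fst _ _ _) e₂ _ _

end Cubes

/-! ### Families of points as a cubical set, and maps into it -/

section Cubes

open CubeCat Psh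

variable {E : Type u} [Category.{v} E] [HasFiniteLimits E] [HasFiniteCoproducts E] {N : NatObj E}
  {Q : CubeCat N}

namespace PointFamily

variable {G J : E} {e : G ⟶ J} (D : PointFamily Q e)

theorem ev_congr {K : E} {x x' : K ⟶ D.obj} {t t' : K ⟶ Q.hom} (hx : x = x') (ht : t = t')
    (hd : t ≫ Q.dom = zero K) (hc : t ≫ Q.cod = x ≫ D.p) :
    D.ev x t hd hc = D.ev x' t' (by rw [← ht, hd]) (by rw [← ht, ← hx, hc]) := by
  subst hx ht; rfl

theorem exists_act {K : E} (x : K ⟶ D.obj) (s : K ⟶ Q.hom) (h : s ≫ Q.cod = x ≫ D.p) :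
    ∃ (y : K ⟶ D.obj) (_ : y ≫ D.base = x ≫ D.base) (hp : y ≫ D.p = s ≫ Q.dom),
      ∀ {L : E} (a : L ⟶ K) (t : L ⟶ Q.hom) (hd : t ≫ Q.dom = zero L)
        (hc : t ≫ Q.cod = (a ≫ s) ≫ Q.dom),
        D.ev (a ≫ y) t hd (by rw [hc, Category.assoc, Category.assoc, hp]) =
          D.ev (a ≫ x) (Q.comp t (a ≫ s) hc) (by rw [Q.comp_dom, hd])
            (by rw [Q.comp_cod, Category.assoc, h, Category.assoc]) := by
  obtain ⟨y, hy, hp, h'⟩ := D.exists_of (x ≫ D.base) (s ≫ Q.dom)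
    (fun a t hd hc => D.ev (a ≫ x) (Q.comp t (a ≫ s) (by rw [hc, Category.assoc]))
      (by rw [Q.comp_dom, hd]) (by rw [Q.comp_cod, Category.assoc, h, Category.assoc]))
    (fun a t hd hc => by rw [D.ev_base, Category.assoc])
    (fun b a t hd hc => by
      rw [D.ev_natural]
      refine D.ev_congr (Category.assoc _ _ _).symm ?_ _ _
      rw [Q.comp_natural]
      exact comp_congr _ rfl (Category.assoc _ _ _).symm _)
  exact ⟨y, hy, hp, fun a t hd hc => h' a t hd (by rw [hc, Category.assoc])⟩

/-- The action on families of points: precomposition. -/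
def act {K : E} (x : K ⟶ D.obj) (s : K ⟶ Q.hom) (h : s ≫ Q.cod = x ≫ D.p) : K ⟶ D.obj :=
  (D.exists_act x s h).choose

theorem act_base {K : E} (x : K ⟶ D.obj) (s : K ⟶ Q.hom) (h : s ≫ Q.cod = x ≫ D.p) :
    D.act x s h ≫ D.base = x ≫ D.base :=
  (D.exists_act x s h).choose_spec.choose

theorem act_p {K : E} (x : K ⟶ D.obj) (s : K ⟶ Q.hom) (h : s ≫ Q.cod = x ≫ D.p) :
    D.act x s h ≫ D.p = s ≫ Q.dom :=
  (D.exists_act x s h).choose_spec.choose_spec.choose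

theorem ev_comp_act {K L : E} (x : K ⟶ D.obj) (s : K ⟶ Q.hom) (h : s ≫ Q.cod = x ≫ D.p)
    (a : L ⟶ K) (t : L ⟶ Q.hom) (hd : t ≫ Q.dom = zero L) (hc : t ≫ Q.cod = (a ≫ s) ≫ Q.dom) :
    D.ev (a ≫ D.act x s h) t hd (by rw [hc, Category.assoc, Category.assoc, act_p]) =
      D.ev (a ≫ x) (Q.comp t (a ≫ s) hc) (by rw [Q.comp_dom, hd])
        (by rw [Q.comp_cod, Category.assoc, h, Category.assoc]) :=
  (D.exists_act x s h).choose_spec.choose_spec.choose_spec a t hd hc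

theorem ev_act {K : E} (x : K ⟶ D.obj) (s : K ⟶ Q.hom) (h : s ≫ Q.cod = x ≫ D.p)
    (t : K ⟶ Q.hom) (hd : t ≫ Q.dom = zero K) (hc : t ≫ Q.cod = s ≫ Q.dom) :
    D.ev (D.act x s h) t hd (by rw [hc, act_p]) =
      D.ev x (Q.comp t s hc) (by rw [Q.comp_dom, hd]) (by rw [Q.comp_cod, h]) := by
  refine (D.ev_congr (Category.id_comp _).symm rfl _ _).trans
    ((D.ev_comp_act x s h (𝟙 K) t hd (by rw [hc, Category.id_comp])).trans
      (D.ev_congr (Category.id_comp _) ?_ _ _))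
  exact comp_congr _ rfl (Category.id_comp _) _

/-- The cubical set of families of points. -/
def psh : CSet Q where
  obj := D.obj
  p := D.p
  act x s h := D.act x s h
  act_natural b x s h := by
    have hb : (b ≫ s) ≫ Q.cod = (b ≫ x) ≫ D.p := by rw [Category.assoc, h, Category.assoc]
    refine D.ext _ _ ?_ ?_ fun a t hd hc => ?_
    · rw [act_base, Category.assoc, act_base, Category.assoc]
    · rw [act_p, Category.assoc, act_p, Category.assoc]
    · have hc' : t ≫ Q.cod = (a ≫ b ≫ s) ≫ Q.dom := by
        simpa only [Category.assoc, act_p] using hc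
      refine (D.ev_congr (Category.assoc _ _ _).symm rfl _ _).trans
        ((D.ev_comp_act x s h (a ≫ b) t hd (by simp only [hc', Category.assoc])).trans
        (Eq.trans (D.ev_congr (Category.assoc _ _ _) ?_ _ _)
          (D.ev_comp_act (b ≫ x) (b ≫ s) hb a t hd hc').symm))
      exact comp_congr _ rfl (Category.assoc _ _ _) _
  act_p x s h := D.act_p x s h
  act_id x := by
    refine D.ext _ _ (D.act_base _ _ _) ?_ fun a t hd hc => ?_
    · rw [act_p, Category.assoc, Category.assoc, Q.id_dom, Category.comp_id]
    · have hc' : t ≫ Q.cod = (a ≫ x ≫ D.p ≫ Q.id) ≫ Q.dom := by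
        simpa only [Category.assoc, act_p] using hc
      refine (D.ev_comp_act x _ _ a t hd hc').trans (D.ev_congr rfl ?_ _ _)
      refine (comp_congr _ rfl ?_ _).trans (Q.comp_id t)
      simp only [Category.assoc, Q.id_dom, Category.comp_id] at hc'
      rw [← Category.assoc t, hc']
      simp only [Category.assoc]
  act_comp x s r h h' := by
    refine D.ext _ _ ?_ ?_ fun a t hd hc => ?_
    · rw [act_base, act_base, act_base]
    · rw [act_p, act_p, Q.comp_dom]
    · have hc' : t ≫ Q.cod = (a ≫ r) ≫ Q.dom := by
        simpa only [Category.assoc, act_p] using hc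
      have hrs : (a ≫ r) ≫ Q.cod = (a ≫ s) ≫ Q.dom := by
        rw [Category.assoc, h', Category.assoc]
      have hc'' : t ≫ Q.cod = (a ≫ Q.comp r s h') ≫ Q.dom := by
        rw [hc', Category.assoc, Category.assoc, Q.comp_dom]
      rw [D.ev_comp_act _ r _ a t hd hc', D.ev_comp_act x s h a _ _
        (by rw [Q.comp_cod, hrs]), D.ev_comp_act x _ _ a t hd hc'']
      refine D.ev_congr rfl ?_ _ _
      rw [Q.assoc _ _ _ hc' hrs]
      exact comp_congr _ rfl (Q.comp_natural _ _ _ _).symm _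

/-- The projection to the constant cubical set. -/
def proj : D.psh ⟶ (CSet.Δ Q).obj J :=
  constLift D.base fun x s h => D.act_base x s h

theorem proj_val : D.proj.app ≫ constVal Q J = D.base := constLift_val _ _

/-- The value of a family of points at stage `[0]` at the only point. -/
def evPt {K : E} (x : K ⟶ D.psh.obj) (hx : x ≫ D.psh.p = zero K) : K ⟶ G :=
  D.ev x (zero K ≫ Q.id) (by rw [Category.assoc, Q.id_dom, Category.comp_id])
    (by rw [Category.assoc, Q.id_cod, Category.comp_id]; exact hx.symm)

theorem evPt_congr {K : E} {x x' : K ⟶ D.psh.obj} (h : x = x') (hx : x ≫ D.psh.p = zero K) :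
    D.evPt x hx = D.evPt x' (by rw [← h, hx]) := by
  subst h; rfl

theorem evPt_natural {K L : E} (a : L ⟶ K) (x : K ⟶ D.psh.obj) (hx : x ≫ D.psh.p = zero K) :
    a ≫ D.evPt x hx = D.evPt (a ≫ x) (by rw [Category.assoc, hx, comp_zeroObj]) := by
  refine (D.ev_natural _ _ _ _ _).trans (D.ev_congr rfl ?_ _ _)
  rw [← Category.assoc, comp_zeroObj]

theorem evPt_base {K : E} (x : K ⟶ D.psh.obj) (hx : x ≫ D.psh.p = zero K) :
    D.evPt x hx ≫ e = x ≫ D.proj.app ≫ constVal Q J := by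
  rw [proj_val]
  exact D.ev_base _ _ _ _

/-- Restricting along a vertex brings a family down to stage `[0]`, so families are controlled by
their values there. This is what makes `D.psh` cofree on points. -/
theorem ev_eq_evPt {K : E} (x : K ⟶ D.psh.obj) (t : K ⟶ Q.hom) (hd : t ≫ Q.dom = zero K)
    (hc : t ≫ Q.cod = x ≫ D.psh.p) :
    D.ev x t hd hc = D.evPt (D.psh.act x t hc) ((D.psh.act_p _ _ _).trans hd) := by
  have h₀ : (zero K ≫ Q.id) ≫ Q.cod = t ≫ Q.dom := by
    rw [Category.assoc, Q.id_cod, Category.comp_id, hd]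
  refine Eq.trans (D.ev_congr rfl ?_ _ _) (D.ev_act x t hc _ _ h₀).symm
  refine (Q.id_comp t).symm.trans (comp_congr _ ?_ rfl _)
  rw [← Category.assoc, hd]

/-- Maps to families of points are determined by their projection and their values at points. -/
theorem hom_ext {B : CSet Q} {f g : B ⟶ D.psh} (h : f ≫ D.proj = g ≫ D.proj)
    (hp : ∀ {K : E} (b : K ⟶ (CSet.Γ Q).obj B),
      D.evPt ((b ≫ ptVal B) ≫ f.app) (by rw [Category.assoc, f.app_p, comp_ptVal_p]) =
        D.evPt ((b ≫ ptVal B) ≫ g.app) (by rw [Category.assoc, g.app_p, comp_ptVal_p])) :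
    f = g := by
  have hb : f.app ≫ D.base = g.app ≫ D.base := by
    have := congrArg (fun k => Hom.app k ≫ constVal Q J) h
    simpa only [comp_app, Category.assoc, proj_val] using this
  apply Psh.hom_ext
  refine D.ext _ _ hb (f.app_p.trans g.app_p.symm) fun {L} a t hd hc => ?_
  have hc' : t ≫ Q.cod = a ≫ B.p :=
    hc.trans ((Category.assoc _ _ _).trans (congrArg (a ≫ ·) f.app_p))
  have hpt : B.act a t hc' ≫ B.p = zero L := by rw [B.act_p, hd]
  have hg : t ≫ Q.cod = (a ≫ g.app) ≫ D.psh.p := by rw [hc', Category.assoc, g.app_p]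
  refine (D.ev_eq_evPt (a ≫ f.app) t hd hc).trans (Eq.trans ?_
    (D.ev_eq_evPt (a ≫ g.app) t hd hg).symm)
  have key := hp (mkPt (B.act a t hc') hpt)
  refine (D.evPt_congr ?_ _).trans (key.trans (D.evPt_congr ?_ _))
  · rw [mkPt_val, f.app_act]
  · rw [mkPt_val, g.app_act]

/-- A map to the constant cubical set lifts to families of points if it lifts on global
sections. -/
theorem exists_lift {B : CSet Q} (z : B ⟶ (CSet.Δ Q).obj J) (k : (CSet.Γ Q).obj B ⟶ G)
    (hk : k ≫ e = ptVal B ≫ z.app ≫ constVal Q J) :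
    ∃ h : B ⟶ D.psh, h ≫ D.proj = z ∧ ∀ {K : E} (b : K ⟶ (CSet.Γ Q).obj B),
      D.evPt ((b ≫ ptVal B) ≫ h.app) (by rw [Category.assoc, h.app_p, comp_ptVal_p]) = b ≫ k := by
  have hpt : ∀ {L : E} (a : L ⟶ B.obj) (t : L ⟶ Q.hom) (_ : t ≫ Q.dom = zero L)
      (hc : t ≫ Q.cod = a ≫ B.p), B.act a t hc ≫ B.p = zero L := by
    intro L a t hd hc
    rw [B.act_p, hd]
  have mk_congr : ∀ {L : E} {x y : L ⟶ B.obj} (h : x = y) (hx : x ≫ B.p = zero L),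
      mkPt x hx = mkPt y (h ▸ hx) := by
    rintro L x _ rfl hx
    rfl
  -- An element of `B` goes to the family whose value at a vertex `t` is `k` at the restriction of
  -- the element along `t`.
  obtain ⟨h, hb, hp, hev⟩ := D.exists_of (z.app ≫ constVal Q J) B.p
    (fun a t hd hc => mkPt (B.act a t hc) (hpt a t hd hc) ≫ k)
    (fun a t hd hc => by
      rw [Category.assoc, hk, ← Category.assoc, mkPt_val, act_const_val])
    (fun b a t hd hc => by
      rw [← Category.assoc]
      refine congrArg (· ≫ k) (pt_ext ?_)
      rw [Category.assoc, mkPt_val, mkPt_val, B.act_natural])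
  have hev' : ∀ {L : E} (a : L ⟶ B.obj) (t : L ⟶ Q.hom) (hd : t ≫ Q.dom = zero L)
      (hc : t ≫ Q.cod = a ≫ B.p),
      D.ev (a ≫ h) t hd (by rw [hc, Category.assoc, hp]) =
        mkPt (B.act a t hc) (hpt a t hd hc) ≫ k := fun a t hd hc => hev a t hd hc
  -- At a vertex `t`, both sides are `k` applied to the restriction of `x` along the composite of
  -- `t` and `s`.
  have hact : ∀ {M : E} (x : M ⟶ B.obj) (s : M ⟶ Q.hom) (hs : s ≫ Q.cod = x ≫ B.p)
      (hs' : s ≫ Q.cod = (x ≫ h) ≫ D.p), B.act x s hs ≫ h = D.act (x ≫ h) s hs' := by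
    intro M x s hs hs'
    refine D.ext _ _ ?_ ?_ fun a t hd hc => ?_
    · rw [act_base, Category.assoc, hb, act_const_val, Category.assoc, hb]
    · rw [act_p, Category.assoc, hp, B.act_p]
    · have hc' : t ≫ Q.cod = (a ≫ s) ≫ Q.dom := by
        simpa only [Category.assoc, hp, B.act_p] using hc
      have hsa : (a ≫ s) ≫ Q.cod = (a ≫ x) ≫ B.p := by
        rw [Category.assoc, hs, Category.assoc]
      have e₁ := hev' (a ≫ B.act x s hs) t hd
        (by rw [hc', Category.assoc, Category.assoc, B.act_p])
      have e₂ := hev' (a ≫ x) (Q.comp t (a ≫ s) hc') (by rw [Q.comp_dom, hd])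
        (by rw [Q.comp_cod, hsa])
      refine (D.ev_congr (Category.assoc _ _ _).symm rfl _ _).trans (e₁.trans (Eq.trans ?_
        (D.ev_comp_act (x ≫ h) s hs' a t hd hc').symm))
      refine Eq.trans ?_ (e₂.symm.trans (D.ev_congr (Category.assoc _ _ _) rfl _ _))
      refine congrArg (· ≫ k) (mk_congr ?_ _)
      refine (B.act_congr (B.act_natural _ _ _ _) rfl _).trans ?_
      exact B.act_comp (a ≫ x) (a ≫ s) t hsa hc'
  let H : B ⟶ D.psh :=
    { app := h
      app_p := hp
      app_act := fun {M} x s hs => hact x s hs (by rw [hs, Category.assoc, hp]) }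
  refine ⟨H, ?_, fun {K} b => ?_⟩
  · apply to_const_hom_ext
    rw [comp_app, Category.assoc, proj_val]
    exact hb
  · have hc : (zero K ≫ Q.id) ≫ Q.cod = (b ≫ ptVal B) ≫ B.p := by
      rw [Category.assoc, Q.id_cod, Category.comp_id, comp_ptVal_p]
    refine (hev' (b ≫ ptVal B) (zero K ≫ Q.id)
      (by rw [Category.assoc, Q.id_dom, Category.comp_id]) hc).trans ?_
    refine congrArg (· ≫ k) (pt_ext ?_)
    rw [mkPt_val]
    refine (B.act_congr rfl ?_ _).trans (B.act_id _)
    rw [← Category.assoc (b ≫ ptVal B), comp_ptVal_p]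

end PointFamily

end Cubes

/-! ### Families of points form an h-proposition -/

section Cubes

open CubeCat Psh

variable {E : Type u} [Category.{v} E] [HasFiniteLimits E] [FinitaryExtensive E] {N : NatObj E}
  {Q : CubeCat N} {K : KanData Q}

namespace PointFamily

variable {G J : E} {e : G ⟶ J} (D : PointFamily Q e)

/-- A filler need only be given on points, in any way that respects the base. Over each point of `B`
it is decidable whether one is in `A`: there the wall `w` is used, and elsewhere `x₀`. -/
theorem isKanFibration_proj : IsKanFibration K D.proj := by
  intro A B m r hm _ w x₀ v hw hx₀ hwx
  obtain ⟨C, c, ⟨hc⟩⟩ := K.cof_decidable m hm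
  let IB := (CSet.I Q).prod B
  have wall_p : ∀ {L : E} (a : L ⟶ (CSet.Γ Q).obj IB) (y : L ⟶ (CSet.Γ Q).obj A),
      ((a ≫ ptVal IB) ≫ (Psh.fst (CSet.I Q) B).app) ≫ (CSet.I Q).p = (y ≫ ptVal A) ≫ A.p := by
    intro L a y
    rw [Category.assoc, (Psh.fst _ _).app_p, comp_ptVal_p, comp_ptVal_p]
  have wall_pt : ∀ {L : E} (a : L ⟶ (CSet.Γ Q).obj IB) (y : L ⟶ (CSet.Γ Q).obj A),
      (pairElt _ _ (wall_p a y) ≫ w.app) ≫ D.psh.p = zero L := by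
    intro L a y
    rw [Category.assoc, w.app_p, pairElt_p, comp_ptVal_p]
  have base_pt : ∀ {L : E} (y : L ⟶ C), (((y ≫ c) ≫ ptVal B) ≫ x₀.app) ≫ D.psh.p = zero L := by
    intro L y
    rw [Category.assoc, x₀.app_p, comp_ptVal_p]
  -- The cases are on the projection to `B`. Outside `A` the value is that of `x₀`, whatever the
  -- interval coordinate is.
  obtain ⟨k, hk₁, hk₂⟩ := sum_family_exists hc ((CSet.Γ Q).map (Psh.snd (CSet.I Q) B))
    (fun a y _ => D.evPt _ (wall_pt a y)) (fun _ y _ => D.evPt _ (base_pt y))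
    (fun b a y h => by
      rw [D.evPt_natural]
      refine D.evPt_congr ?_ _
      rw [← Category.assoc, comp_pairElt]
      simp only [Category.assoc])
    (fun b a y h => by
      rw [D.evPt_natural]
      refine D.evPt_congr ?_ _
      simp only [Category.assoc])
  have hk : k ≫ e = ptVal IB ≫ v.app ≫ constVal Q J := by
    refine sum_hom_ext hc ((CSet.Γ Q).map (Psh.snd (CSet.I Q) B)) (fun a y h => ?_)
      fun a y h => ?_
    · have e₁ : pairElt _ _ (wall_p a y) ≫ (Psh.map (𝟙 (CSet.I Q)) m).app = a ≫ ptVal IB := by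
        rw [pairElt_map]
        apply prod_elt_ext
        · rw [pairElt_fst, id_app, Category.comp_id]
        · rw [pairElt_snd, ← comp_Γ_map_val, ← h, comp_Γ_map_val]
      rw [← Category.assoc, hk₁ a y h, D.evPt_base, Category.assoc, ← Category.assoc w.app,
        ← comp_app, hw, comp_app, ← Category.assoc, ← Category.assoc, e₁]
      simp only [Category.assoc]
    · have e₁ : (y ≫ c) ≫ ptVal B = (a ≫ ptVal IB) ≫ (Psh.snd (CSet.I Q) B).app := by
        rw [← h, comp_Γ_map_val]
      -- Using `x₀` away from the graph of `r` is legitimate because `v`, having constant target,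
      -- does not depend on the interval coordinate.
      have e₂ : v.app = (Psh.snd (CSet.I Q) B).app ≫ (CSet.graph r ≫ v).app :=
        congrArg Hom.app (const_eq_snd_graph v r)
      rw [← Category.assoc, hk₂ a y h, D.evPt_base, Category.assoc, ← Category.assoc x₀.app,
        ← comp_app, hx₀, e₁, e₂]
      simp only [Category.assoc]
  obtain ⟨h, hv, hpt⟩ := D.exists_lift v k hk
  refine ⟨h, hv, D.hom_ext ?_ fun {L} b => ?_, D.hom_ext ?_ fun {L} b => ?_⟩
  · rw [Category.assoc, hv, hw]
  · have e₁ := hpt (b ≫ (CSet.Γ Q).map (Psh.map (𝟙 (CSet.I Q)) m))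
    have e₂ : (b ≫ (CSet.Γ Q).map (Psh.map (𝟙 (CSet.I Q)) m)) ≫
        (CSet.Γ Q).map (Psh.snd (CSet.I Q) B) =
        (b ≫ (CSet.Γ Q).map (Psh.snd (CSet.I Q) A)) ≫ (CSet.Γ Q).map m := by
      rw [Category.assoc, Category.assoc, ← Functor.map_comp, ← Functor.map_comp, map_snd]
    refine (D.evPt_congr ?_ _).trans ((e₁.trans (hk₁ _ _ e₂)).trans (D.evPt_congr ?_ _))
    · rw [comp_Γ_map_val, comp_app]
      simp only [Category.assoc]
    · refine congrArg (· ≫ w.app) ?_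
      apply prod_elt_ext
      · rw [pairElt_fst, comp_Γ_map_val, Category.assoc, ← comp_app, map_fst, Category.comp_id]
      · rw [pairElt_snd, comp_Γ_map_val]
  · rw [Category.assoc, hv, hx₀]
  · have e₁ := hpt (b ≫ (CSet.Γ Q).map (CSet.graph r))
    have e₂ : (CSet.Γ Q).map (CSet.graph r) ≫ (CSet.Γ Q).map (Psh.snd (CSet.I Q) B) = 𝟙 _ := by
      rw [← Functor.map_comp, graph_snd, CategoryTheory.Functor.map_id]
    refine (D.evPt_congr ?_ _).trans (e₁.trans ?_)
    · rw [comp_Γ_map_val, comp_app]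
      simp only [Category.assoc]
    -- On the graph of `r`, the wall and the base agree over `A` by `hwx`; outside `A` the filler is
    -- `x₀` by construction.
    · refine sum_hom_ext hc b (fun a y h => ?_) fun a y h => ?_
      · have e₃ : (a ≫ b ≫ (CSet.Γ Q).map (CSet.graph r)) ≫
            (CSet.Γ Q).map (Psh.snd (CSet.I Q) B) = y ≫ (CSet.Γ Q).map m := by
          rw [Category.assoc, Category.assoc, e₂, Category.comp_id, h]
        rw [← Category.assoc, hk₁ _ _ e₃, D.evPt_natural]
        refine D.evPt_congr ?_ _
        have e₅ : (a ≫ b) ≫ ptVal B = (y ≫ ptVal A) ≫ m.app := by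
          rw [h, comp_Γ_map_val]
        have e₆ : (y ≫ ptVal A) ≫ (CSet.graph (m ≫ r)).app ≫ w.app = (a ≫ b) ≫ ptVal B ≫ x₀.app := by
          rw [← comp_app, hwx, comp_app, ← Category.assoc, ← e₅]
          simp only [Category.assoc]
        refine Eq.trans ?_ (e₆.trans (by simp only [Category.assoc]))
        rw [← Category.assoc (y ≫ ptVal A), elt_graph]
        refine congrArg (· ≫ w.app) ?_
        apply prod_elt_ext
        · rw [pairElt_fst, pairElt_fst, ← Category.assoc a, comp_Γ_map_val, e₅, Category.assoc _ _
            (Hom.app (Psh.fst _ _)), ← comp_app (CSet.graph r), graph_fst, comp_app, Category.assoc]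
        · rw [pairElt_snd, pairElt_snd]
      · have e₃ : (a ≫ b ≫ (CSet.Γ Q).map (CSet.graph r)) ≫
            (CSet.Γ Q).map (Psh.snd (CSet.I Q) B) = y ≫ c := by
          rw [Category.assoc, Category.assoc, e₂, Category.comp_id, h]
        rw [← Category.assoc, hk₂ _ _ e₃, D.evPt_natural]
        refine D.evPt_congr ?_ _
        rw [← h]
        simp only [Category.assoc]

/-- The element of the object of points of the interval underlying a global section. -/
def intervalPt (Q : CubeCat N) :
    (CSet.Γ Q).obj (CSet.I Q) ⟶ Q.homBetween N.zero (N.zero ≫ N.succ) :=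
  pullback.lift (ptVal (CSet.I Q) ≫ arr Q) (terminal.from _) (by
    apply Limits.prod.hom_ext
    · rw [Category.assoc, Category.assoc, Limits.prod.lift_fst, Category.assoc, Limits.prod.lift_fst,
        arr_dom, ptVal_p]
    · rw [Category.assoc, Category.assoc, Limits.prod.lift_snd, Category.assoc, Limits.prod.lift_snd,
        arr_cod, comp_oneObj])

/-- At stage `[0]` the composite `[n] ⟶ [0] ⟶ [1]` is just the point. This lets the separating
function be evaluated at the ends of a homotopy. -/
theorem Γ_constPt_intervalPt (B : CSet Q)
    (i : ⊤_ E ⟶ Q.homBetween N.zero (N.zero ≫ N.succ)) :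
    (CSet.Γ Q).map (CSet.constPt B i) ≫ intervalPt Q = terminal.from _ ≫ i := by
  refine pullback.hom_ext ?_ (Subsingleton.elim _ _)
  rw [Category.assoc, Category.assoc, intervalPt, pullback.lift_fst, ← Category.assoc, Γ_map_val]
  have h₁ : (CSet.constPt B i).app ≫ arr Q = _ := CSet.constArrow_fst B.p i
  rw [Category.assoc, h₁, Q.comp_natural]
  have h₂ : ptVal B ≫ terminal.from B.obj ≫ CSet.ptArrow i = terminal.from _ ≫ CSet.ptArrow i := by
    rw [← Category.assoc, Subsingleton.elim (ptVal B ≫ terminal.from B.obj) (terminal.from _)]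
  refine (comp_congr _ ?_ h₂ _).trans (Q.id_comp _)
  rw [← Category.assoc, ptVal_p, Category.assoc, zero_bang, Category.assoc,
    ← Category.assoc (CSet.ptArrow i), CSet.ptArrow_dom]

/-- A homotopy may be any function on points over the base. The function `d` that separates the
endpoints divides the points of `I × P` in two; the homotopy is `p₁` where `d` is `0` and `p₂` where
`d` is `1`. -/
theorem isHProp_proj : IsHProp K D.proj := by
  refine ⟨D.isKanFibration_proj, fun {P} p₁ p₂ hP => ?_⟩
  obtain ⟨d, hd₀, hd₁⟩ := Q.endpoints_separated
  let IP := (CSet.I Q).prod P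
  let x : (CSet.Γ Q).obj IP ⟶ Two E :=
    (CSet.Γ Q).map (Psh.fst (CSet.I Q) P) ≫ intervalPt Q ≫ d
  let z := (CSet.Γ Q).map (Psh.snd (CSet.I Q) P)
  have hpt : ∀ (p : P ⟶ D.psh) {L : E} (a : L ⟶ (CSet.Γ Q).obj IP),
      (((a ≫ z) ≫ ptVal P) ≫ p.app) ≫ D.psh.p = zero L := by
    intro p L a
    rw [Category.assoc, p.app_p, comp_ptVal_p]
  obtain ⟨k, hk₁, hk₂⟩ := sum_family_exists (coprodIsCoprod (⊤_ E) (⊤_ E)) x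
    (fun a _ _ => D.evPt _ (hpt p₁ a)) (fun a _ _ => D.evPt _ (hpt p₂ a))
    (fun b a y h => by
      rw [D.evPt_natural]
      refine D.evPt_congr ?_ _
      simp only [Category.assoc])
    (fun b a y h => by
      rw [D.evPt_natural]
      refine D.evPt_congr ?_ _
      simp only [Category.assoc])
  have hw : p₁.app ≫ D.proj.app = p₂.app ≫ D.proj.app := congrArg Hom.app hP.w
  have hk : k ≫ e = ptVal IP ≫ (Psh.snd (CSet.I Q) P ≫ p₁ ≫ D.proj).app ≫ constVal Q J := by
    have hz : ∀ {L : E} (a : L ⟶ (CSet.Γ Q).obj IP), (a ≫ z) ≫ ptVal P =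
        a ≫ ptVal IP ≫ (Psh.snd (CSet.I Q) P).app := by
      intro L a
      rw [Category.assoc, Γ_map_val]
    refine sum_hom_ext (coprodIsCoprod (⊤_ E) (⊤_ E)) x (fun a y h => ?_) fun a y h => ?_
    · rw [← Category.assoc, hk₁ a y h, D.evPt_base, hz]
      simp only [comp_app, Category.assoc]
    · rw [← Category.assoc, hk₂ a y h, D.evPt_base, hz, comp_app, comp_app, hw]
      simp only [Category.assoc]
  obtain ⟨H, hH, hHpt⟩ := D.exists_lift _ k hk
  have hend : ∀ (i : ⊤_ E ⟶ Q.homBetween N.zero (N.zero ≫ N.succ)) {L : E}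
      (b : L ⟶ (CSet.Γ Q).obj P),
      (b ≫ (CSet.Γ Q).map (CSet.graph (CSet.constPt P i))) ≫ x = terminal.from L ≫ i ≫ d := by
    intro i L b
    have e₁ : (CSet.Γ Q).map (CSet.graph (CSet.constPt P i)) ≫ x =
        (terminal.from _ ≫ i) ≫ d := by
      rw [← Γ_constPt_intervalPt, ← Category.assoc, ← Functor.map_comp, graph_fst, Category.assoc]
    rw [Category.assoc, e₁, ← Category.assoc, ← Category.assoc,
      Subsingleton.elim (b ≫ terminal.from _) (terminal.from L), Category.assoc]
  have hz : ∀ (i : ⊤_ E ⟶ Q.homBetween N.zero (N.zero ≫ N.succ)) {L : E}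
      (b : L ⟶ (CSet.Γ Q).obj P),
      (b ≫ (CSet.Γ Q).map (CSet.graph (CSet.constPt P i))) ≫ z = b := by
    intro i L b
    rw [Category.assoc, ← Functor.map_comp, graph_snd, CategoryTheory.Functor.map_id, Category.comp_id]
  refine ⟨H, D.hom_ext ?_ fun b => ?_, D.hom_ext ?_ fun b => ?_, hH⟩
  · rw [Category.assoc, hH, ← Category.assoc, graph_snd, Category.id_comp]
  · refine (D.evPt_congr ?_ _).trans ((hHpt _).trans
      ((hk₁ _ (terminal.from _) ((hend Q.end₀ b).trans (by rw [hd₀]))).trans (D.evPt_congr ?_ _)))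
    · rw [comp_Γ_map_val, comp_app]
      simp only [Category.assoc]
    · rw [hz]
  · rw [Category.assoc, hH, ← Category.assoc, graph_snd, Category.id_comp, hP.w]
  · refine (D.evPt_congr ?_ _).trans ((hHpt _).trans
      ((hk₂ _ (terminal.from _) ((hend Q.end₁ b).trans (by rw [hd₁]))).trans (D.evPt_congr ?_ _)))
    · rw [comp_Γ_map_val, comp_app]
      simp only [Category.assoc]
    · rw [hz]

end PointFamily

end Cubes

/-! ### Classifiers of `Π⁰₁` monomorphisms -/

section Classifier

variable {E : Type u} [Category.{v} E] [HasFiniteLimits E]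

/-- It suffices to test generalised elements: the condition provides the lifts, and `m` being monic
makes them unique. -/
theorem isPullback_of_classifies {A B Ω : E} (m : A ⟶ B) [Mono m] (t : ⊤_ E ⟶ Ω) (χ : B ⟶ Ω)
    (h : ∀ {J : E} (b : J ⟶ B), b ≫ χ = terminal.from J ≫ t ↔ ∃ a : J ⟶ A, a ≫ m = b) :
    IsPullback (terminal.from A) m t χ := by
  have hex : ∀ s : PullbackCone t χ, ∃ a : s.pt ⟶ A, a ≫ m = s.snd := fun s =>
    (h s.snd).1 (by rw [← s.condition, Subsingleton.elim s.fst (terminal.from _)])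
  choose l hl using hex
  exact ⟨⟨((h m).2 ⟨𝟙 A, Category.id_comp m⟩).symm⟩, ⟨PullbackCone.IsLimit.mk _ l
    (fun _ => Subsingleton.elim _ _) hl
    (fun s k _ hk => by rw [← cancel_mono m, hk, hl])⟩⟩

variable [HasFiniteCoproducts E] [LocallyCartesianClosed E] (N : NatObj E)

/-- The subobject of `B` on which a binary sequence `g` is constantly `0`. -/
theorem exists_isPi01Mono {B : E} (g : B ⨯ N.nat ⟶ Two E) :
    ∃ (A : E) (m : A ⟶ B), Mono m ∧ ∀ {J : E} (b : J ⟶ B), (∃ a : J ⟶ A, a ≫ m = b) ↔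
      prod.map b (𝟙 N.nat) ≫ g = terminal.from (J ⨯ N.nat) ≫ coprod.inl := by
  obtain ⟨A, m, hm, hA⟩ := exists_forall (equalizer.ι g (terminal.from _ ≫ coprod.inl))
    (Limits.prod.fst : B ⨯ N.nat ⟶ B)
  refine ⟨A, m, hm, fun {J} b => (hA b).trans ⟨fun h => ?_, fun h K a k hk => ?_⟩⟩
  · obtain ⟨l, hl⟩ := h Limits.prod.fst (prod.map b (𝟙 N.nat)) (Limits.prod.map_fst _ _)
    rw [← hl, Category.assoc, equalizer.condition, ← Category.assoc, ← Category.assoc,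
      Subsingleton.elim ((l ≫ _) ≫ terminal.from _) (terminal.from _)]
  · refine ⟨equalizer.lift k ?_, equalizer.lift_ι _ _⟩
    have e : k = Limits.prod.lift a (k ≫ Limits.prod.snd) ≫ prod.map b (𝟙 N.nat) := by
      rw [Limits.prod.lift_map]
      apply Limits.prod.hom_ext
      · rw [Limits.prod.lift_fst, hk]
      · rw [Limits.prod.lift_snd, Category.comp_id]
    rw [e, Category.assoc, h, ← Category.assoc, ← Category.assoc]
    exact congrArg (· ≫ _) (Subsingleton.elim _ _)

/-- A predicate that is given by the vanishing of binary sequences has a truth value in a classifier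
of `Π⁰₁` monomorphisms, and equivalent instances of it have equal truth values. -/
theorem IsPi01Classifier.exists_truthValue {Ω : E} {t : ⊤_ E ⟶ Ω} (hΩ : IsPi01Classifier N t)
    {B : E} (P : ∀ {J : E}, (J ⟶ B) → Prop) (g : B ⨯ N.nat ⟶ Two E)
    (hg : ∀ {J : E} (b : J ⟶ B),
      prod.map b (𝟙 N.nat) ≫ g = terminal.from (J ⨯ N.nat) ≫ coprod.inl ↔ P b) :
    ∃ χ : B ⟶ Ω, (∀ {J : E} (b : J ⟶ B), b ≫ χ = terminal.from J ≫ t ↔ P b) ∧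
      ∀ {J : E} (b c : J ⟶ B), (∀ {L : E} (a : L ⟶ J), P (a ≫ b) ↔ P (a ≫ c)) →
        b ≫ χ = c ≫ χ := by
  obtain ⟨A, m, hm, hA⟩ := exists_isPi01Mono N g
  obtain ⟨χ, hχ, -⟩ := hΩ m ⟨hm, g, hA⟩
  have hP : ∀ {J : E} (b : J ⟶ B), b ≫ χ = terminal.from J ≫ t ↔ P b := by
    intro J b
    rw [← hg, ← hA]
    constructor
    · intro h
      exact ⟨hχ.lift (terminal.from J) b h.symm, hχ.lift_snd _ _ _⟩
    · rintro ⟨a, rfl⟩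
      rw [Category.assoc, ← hχ.w, ← Category.assoc, Subsingleton.elim (a ≫ _) (terminal.from J)]
  refine ⟨χ, hP, fun {J} b c hbc => ?_⟩
  -- Both `b ≫ χ` and `c ≫ χ` classify the subobject of `J` on which `P` holds of `b`. It is again
  -- `Π⁰₁`, so uniqueness of the classifying map identifies the two.
  obtain ⟨A', m', hm', hA'⟩ := exists_isPi01Mono N (prod.map b (𝟙 N.nat) ≫ g)
  have hA'' : ∀ {L : E} (a : L ⟶ J), (∃ k : L ⟶ A', k ≫ m' = a) ↔ P (a ≫ b) := by
    intro L a
    rw [hA', ← Category.assoc, Limits.prod.map_map, Category.comp_id, hg]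
  refine (hΩ m' ⟨hm', _, hA'⟩).unique (isPullback_of_classifies m' t _ fun a => ?_)
    (isPullback_of_classifies m' t _ fun a => ?_)
  · rw [hA'', ← Category.assoc, hP]
  · rw [hA'', ← Category.assoc, hP, hbc]

end Classifier

section Cubes

open CubeCat Psh

variable {E : Type u} [Category.{v} E] [HasFiniteLimits E] [HasFiniteCoproducts E] {N : NatObj E}
  {Q : CubeCat N}

/-! ### Functions on points that are constant on cubes -/

section Invariance

variable {Y : CSet Q} {A : E} (c : (CSet.Γ Q).obj Y ⟶ A)

/-- The value of a function on points at a vertex `p` of a cube `y`. -/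
def vertexVal {L : E} (y : L ⟶ Y.obj) (p : L ⟶ Q.hom) (hd : p ≫ Q.dom = zero L)
    (hc : p ≫ Q.cod = y ≫ Y.p) : L ⟶ A :=
  mkPt (Y.act y p hc) (by rw [Y.act_p, hd]) ≫ c

theorem vertexVal_congr {L : E} {y y' : L ⟶ Y.obj} {p p' : L ⟶ Q.hom} (hd : p ≫ Q.dom = zero L)
    (hc : p ≫ Q.cod = y ≫ Y.p) (hd' : p' ≫ Q.dom = zero L) (hc' : p' ≫ Q.cod = y' ≫ Y.p)
    (h : Y.act y p hc = Y.act y' p' hc') : vertexVal c y p hd hc = vertexVal c y' p' hd' hc' := by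
  refine congrArg (· ≫ c) (pt_ext ?_)
  rw [mkPt_val, mkPt_val, h]

theorem vertexVal_natural {K L : E} (a : K ⟶ L) (y : L ⟶ Y.obj) (p : L ⟶ Q.hom)
    (hd : p ≫ Q.dom = zero L) (hc : p ≫ Q.cod = y ≫ Y.p) :
    a ≫ vertexVal c y p hd hc = vertexVal c (a ≫ y) (a ≫ p)
      (by rw [Category.assoc, hd, comp_zeroObj]) (by rw [Category.assoc, hc, Category.assoc]) := by
  refine (Category.assoc _ _ _).symm.trans (congrArg (· ≫ c) (pt_ext ?_))
  rw [Category.assoc, mkPt_val, mkPt_val, Y.act_natural]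

/-- The vertices of a restricted cube are vertices of the original cube. -/
theorem vertexVal_act {L : E} (y : L ⟶ Y.obj) (s : L ⟶ Q.hom) (hs : s ≫ Q.cod = y ≫ Y.p)
    (p q : L ⟶ Q.hom) (hd : p ≫ Q.dom = zero L) (hc : p ≫ Q.cod = s ≫ Q.dom)
    (hq : Q.comp p s hc = q) :
    vertexVal c (Y.act y s hs) p hd (by rw [Y.act_p, hc]) =
      vertexVal c y q (by rw [← hq, Q.comp_dom, hd]) (by rw [← hq, Q.comp_cod, hs]) := by
  apply vertexVal_congr
  exact (Y.act_comp y s p hs hc).trans (Y.act_congr rfl hq _)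

/-- A function on points that takes the same value at any two vertices of a `1`-cube takes the same
value at any two vertices of an `n`-cube. -/
theorem vertexVal_eq [LocallyCartesianClosed E]
    (h₁ : ∀ {L : E} (y : L ⟶ Y.obj) (p q : L ⟶ Q.hom) (hpd : p ≫ Q.dom = zero L)
      (hqd : q ≫ Q.dom = zero L) (hpc : p ≫ Q.cod = y ≫ Y.p) (hqc : q ≫ Q.cod = y ≫ Y.p),
      y ≫ Y.p = one L → vertexVal c y p hpd hpc = vertexVal c y q hqd hqc)
    {L : E} (y : L ⟶ Y.obj) (p q : L ⟶ Q.hom) (hpd : p ≫ Q.dom = zero L)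
    (hqd : q ≫ Q.dom = zero L) (hpc : p ≫ Q.cod = y ≫ Y.p) (hqc : q ≫ Q.cod = y ≫ Y.p) :
    vertexVal c y p hpd hpc = vertexVal c y q hqd hqc := by
  -- Induction needs a single family over `ℕ`. `M₁` is the object of cubes of `Y` with a vertex, `M`
  -- that of cubes with two vertices, and the dimension is the map to `ℕ`.
  let H := pullback Q.dom N.zero
  let i : H ⟶ Q.hom := pullback.fst Q.dom N.zero
  have hi : i ≫ Q.dom = zero H :=
    pullback.condition.trans (congrArg (· ≫ _) (Subsingleton.elim _ _))
  let M₁ := pullback Y.p (i ≫ Q.cod)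
  let y₁ : M₁ ⟶ Y.obj := pullback.fst Y.p (i ≫ Q.cod)
  let p₁ : M₁ ⟶ Q.hom := pullback.snd Y.p (i ≫ Q.cod) ≫ i
  have hp₁ : p₁ ≫ Q.cod = y₁ ≫ Y.p := (Category.assoc _ _ _).trans pullback.condition.symm
  have hp₁' : p₁ ≫ Q.dom = zero M₁ := by rw [Category.assoc, hi, comp_zeroObj]
  let M := pullback y₁ y₁
  let m₁ : M ⟶ M₁ := pullback.fst y₁ y₁
  let m₂ : M ⟶ M₁ := pullback.snd y₁ y₁
  have hm : m₁ ≫ y₁ = m₂ ≫ y₁ := pullback.condition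
  have hex₁ : ∀ {K : E} (y : K ⟶ Y.obj) (p : K ⟶ Q.hom), p ≫ Q.dom = zero K →
      p ≫ Q.cod = y ≫ Y.p → ∃ m : K ⟶ M₁, m ≫ y₁ = y ∧ m ≫ p₁ = p := by
    intro K y p hd hc
    have e₁ : pullback.lift p (terminal.from K) hd ≫ i = p := pullback.lift_fst _ _ _
    refine ⟨pullback.lift y (pullback.lift p (terminal.from K) hd)
      (by rw [← Category.assoc, e₁, hc]), pullback.lift_fst _ _ _, ?_⟩
    refine (Category.assoc _ _ _).symm.trans ((congrArg (· ≫ i) (pullback.lift_snd _ _ _)).trans e₁)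
  have hex : ∀ {K : E} (y : K ⟶ Y.obj) (p q : K ⟶ Q.hom), p ≫ Q.dom = zero K →
      q ≫ Q.dom = zero K → p ≫ Q.cod = y ≫ Y.p → q ≫ Q.cod = y ≫ Y.p →
      ∃ m : K ⟶ M, (m ≫ m₁) ≫ y₁ = y ∧ (m ≫ m₁) ≫ p₁ = p ∧ (m ≫ m₂) ≫ p₁ = q := by
    intro K y p q hpd hqd hpc hqc
    obtain ⟨a, ha, ha'⟩ := hex₁ y p hpd hpc
    obtain ⟨b, hb, hb'⟩ := hex₁ y q hqd hqc
    have e₁ : pullback.lift a b (ha.trans hb.symm) ≫ m₁ = a := pullback.lift_fst _ _ _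
    have e₂ : pullback.lift a b (ha.trans hb.symm) ≫ m₂ = b := pullback.lift_snd _ _ _
    exact ⟨_, by rw [e₁, ha], by rw [e₁, ha'], by rw [e₂, hb']⟩
  let α : M ⟶ A := m₁ ≫ vertexVal c y₁ p₁ hp₁' hp₁
  let β : M ⟶ A := m₂ ≫ vertexVal c y₁ p₁ hp₁' hp₁
  have key : α = β := by
    -- In dimension `0` the two vertices are equal, since `[0]` has only one point.
    refine N.induction (m₁ ≫ y₁ ≫ Y.p) α β (fun {K} m h => ?_) fun {K} n ih m h => ?_
    · have ha : ((m ≫ m₁) ≫ p₁) ≫ Q.cod = zero K := by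
        simp only [Category.assoc, hp₁]
        exact h
      have hb : ((m ≫ m₂) ≫ p₁) ≫ Q.cod = zero K := by
        rw [← Category.assoc m₁, hm, Category.assoc] at h
        simp only [Category.assoc, hp₁]
        exact h
      rw [← Category.assoc, ← Category.assoc, vertexVal_natural, vertexVal_natural]
      apply vertexVal_congr
      refine Y.act_congr ?_ (Q.eq_of_cod_zero ha hb ?_) _
      · rw [Category.assoc, hm, Category.assoc]
      · rw [Category.assoc, Category.assoc _ p₁, hp₁', comp_zeroObj, comp_zeroObj]
    · let y := m ≫ m₁ ≫ y₁
      let p := (m ≫ m₁) ≫ p₁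
      let q := (m ≫ m₂) ≫ p₁
      have hy : y ≫ Y.p = n ≫ N.succ := by
        rw [← h]
        simp only [y, Category.assoc]
      have hpc : p ≫ Q.cod = y ≫ Y.p := by
        simp only [p, y, Category.assoc, hp₁]
      have hqc : q ≫ Q.cod = y ≫ Y.p := by
        simp only [q, y, Category.assoc, hp₁]
        rw [← Category.assoc m₁, hm, Category.assoc]
      have hpd : p ≫ Q.dom = zero K := by
        simp only [p, Category.assoc, hp₁', comp_zeroObj]
      have hqd : q ≫ Q.dom = zero K := by
        simp only [q, Category.assoc, hp₁', comp_zeroObj]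
      have hpn := hpc.trans hy
      have hqn := hqc.trans hy
      suffices vertexVal c y p hpd hpc = vertexVal c y q hqd hqc by
        rw [← Category.assoc, ← Category.assoc, vertexVal_natural, vertexVal_natural]
        refine Eq.trans (vertexVal_congr _ _ _ _ _ ?_) (this.trans (vertexVal_congr _ _ _ _ _ ?_))
        · exact Y.act_congr (Category.assoc _ _ _) rfl _
        · refine Y.act_congr ?_ rfl _
          rw [Category.assoc, ← hm]
      -- The induction hypothesis, unpacked from `M` to cubes and vertices.
      have ih' : ∀ (y : K ⟶ Y.obj) (p q : K ⟶ Q.hom) (hpd : p ≫ Q.dom = zero K)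
          (hqd : q ≫ Q.dom = zero K) (hpc : p ≫ Q.cod = y ≫ Y.p) (hqc : q ≫ Q.cod = y ≫ Y.p),
          y ≫ Y.p = n → vertexVal c y p hpd hpc = vertexVal c y q hqd hqc := by
        intro y p q hpd hqd hpc hqc hn
        obtain ⟨m, e₁, e₂, e₃⟩ := hex y p q hpd hqd hpc hqc
        have := ih (𝟙 K) m (by rw [← Category.assoc, ← Category.assoc, e₁, hn, Category.id_comp])
        rw [← Category.assoc, ← Category.assoc, vertexVal_natural, vertexVal_natural] at this
        refine Eq.trans (vertexVal_congr _ _ _ _ _ ?_) (this.trans (vertexVal_congr _ _ _ _ _ ?_))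
        · exact Y.act_congr e₁.symm e₂.symm _
        · exact Y.act_congr (by rw [← e₁, Category.assoc, Category.assoc, hm]) e₃ _
      have hL : ∀ (s : K ⟶ Q.hom), s ≫ Q.cod = n ≫ N.succ → s ≫ Q.cod = (n ≫ Q.projL) ≫ Q.dom := by
        intro s hs
        rw [hs, Category.assoc, Q.projL_dom]
      have hR : ∀ (s : K ⟶ Q.hom), s ≫ Q.cod = n ≫ N.succ → s ≫ Q.cod = (n ≫ Q.projR) ≫ Q.dom := by
        intro s hs
        rw [hs, Category.assoc, Q.projR_dom]
      have hLc : (n ≫ Q.projL) ≫ Q.cod = n := by rw [Category.assoc, Q.projL_cod, Category.comp_id]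
      have hRc : (n ≫ Q.projR) ≫ Q.cod = one K := by
        rw [Category.assoc, Q.projR_cod]
        exact comp_oneObj n
      let pL := Q.comp p (n ≫ Q.projL) (hL p hpn)
      let pR := Q.comp p (n ≫ Q.projR) (hR p hpn)
      let qL := Q.comp q (n ≫ Q.projL) (hL q hqn)
      let qR := Q.comp q (n ≫ Q.projR) (hR q hqn)
      have hpL : pL ≫ Q.dom = zero K := by rw [Q.comp_dom, hpd]
      have hpR : pR ≫ Q.dom = zero K := by rw [Q.comp_dom, hpd]
      have hqL : qL ≫ Q.dom = zero K := by rw [Q.comp_dom, hqd]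
      have hqR : qR ≫ Q.dom = zero K := by rw [Q.comp_dom, hqd]
      have hpLc : pL ≫ Q.cod = n := by rw [Q.comp_cod, hLc]
      have hqLc : qL ≫ Q.cod = n := by rw [Q.comp_cod, hLc]
      have hpRc : pR ≫ Q.cod = one K := by rw [Q.comp_cod, hRc]
      have hqRc : qR ≫ Q.cod = one K := by rw [Q.comp_cod, hRc]
      -- the vertex that agrees with `p` in the first coordinates and with `q` in the last one
      obtain ⟨s, hs, hsd, hsL, hsR⟩ := Q.exists_pair n pL qR (by rw [hpL, hqR]) hpLc hqRc
      have hbang : ∀ (k : K ⟶ N.nat) (a : K ⟶ Q.hom), a ≫ Q.dom = zero K →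
          (k ≫ Q.bang) ≫ Q.cod = a ≫ Q.dom := by
        intro k a ha
        rw [Category.assoc, Q.bang_cod, comp_zeroObj, ha]
      -- constant arrows do not change points
      have hconst : ∀ (a b : K ⟶ Q.hom) (k : K ⟶ N.nat) (ha : a ≫ Q.dom = zero K)
          (hb : b ≫ Q.dom = zero K) (hbk : b ≫ Q.cod = k),
          Q.comp b (Q.comp (k ≫ Q.bang) a (hbang k a ha)) (by
            rw [Q.comp_dom, Category.assoc, Q.bang_dom, Category.comp_id, hbk]) = a := by
        intro a b k ha hb hbk
        have e₁ : b ≫ Q.cod = (k ≫ Q.bang) ≫ Q.dom := by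
          rw [hbk, Category.assoc, Q.bang_dom, Category.comp_id]
        rw [← Q.assoc b (k ≫ Q.bang) a e₁ (hbang k a ha)]
        refine (comp_congr _ ?_ rfl _).trans (Q.id_comp a)
        refine Q.eq_of_cod_zero ?_ ?_ ?_
        · rw [Q.comp_cod, hbang k a ha, ha]
        · rw [Category.assoc, Category.assoc, Q.id_cod, Category.comp_id, ha]
        · rw [Q.comp_dom, hb, Category.assoc, Category.assoc, Q.id_dom, Category.comp_id, ha]
      have hid : ∀ (b : K ⟶ Q.hom) (k : K ⟶ N.nat) (hb : b ≫ Q.cod = k),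
          Q.comp b (k ≫ Q.id) (by rw [hb, Category.assoc, Q.id_dom, Category.comp_id]) = b := by
        rintro b _ rfl
        refine (comp_congr _ rfl (Category.assoc _ _ _) _).trans (Q.comp_id b)
      have hidd : ∀ k : K ⟶ N.nat, (k ≫ Q.id) ≫ Q.dom = k := fun k => by
        rw [Category.assoc, Q.id_dom, Category.comp_id]
      have hidc : ∀ k : K ⟶ N.nat, (k ≫ Q.id) ≫ Q.cod = k := fun k => by
        rw [Category.assoc, Q.id_cod, Category.comp_id]
      have hbd : ∀ (k : K ⟶ N.nat) (a : K ⟶ Q.hom) (ha : a ≫ Q.dom = zero K),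
          Q.comp (k ≫ Q.bang) a (hbang k a ha) ≫ Q.dom = k := by
        intro k a ha
        rw [Q.comp_dom, Category.assoc, Q.bang_dom, Category.comp_id]
      -- moving the last coordinate
      obtain ⟨e, he, hed, heL, heR⟩ := Q.exists_pair n
        (Q.comp (one K ≫ Q.bang) pL (hbang _ pL hpL)) (one K ≫ Q.id)
        (by rw [hbd _ pL hpL, hidd]) (by rw [Q.comp_cod, hpLc]) (hidc _)
      have hed' : e ≫ Q.dom = one K := by rw [hed, hbd _ pL hpL]
      -- The edge `e` of the cube keeps the first coordinates at `pL`; its vertex `a` is the vertex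
      -- of `[n+1]` with coordinates `pL` and `a`.
      have move₁ : ∀ (a b : K ⟶ Q.hom) (ha : a ≫ Q.cod = one K) (_ : a ≫ Q.dom = zero K)
          (hb : b ≫ Q.cod = n ≫ N.succ), Q.comp b (n ≫ Q.projL) (hL b hb) = pL →
          Q.comp b (n ≫ Q.projR) (hR b hb) = a → Q.comp a e (by rw [ha, hed']) = b := by
        intro a b ha ha' hb hbL hbR
        refine Q.pair_ext n (by rw [Q.comp_cod, he]) hb ?_ ?_
        · rw [Q.assoc _ _ _ _ (hL e he), hbL]
          exact (comp_congr _ rfl heL _).trans (hconst pL a _ hpL ha' ha)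
        · rw [Q.assoc _ _ _ _ (hR e he), hbR]
          exact (comp_congr _ rfl heR _).trans (hid a _ ha)
      -- moving the first coordinates
      obtain ⟨e', he', hed'', heL', heR'⟩ := Q.exists_pair n (n ≫ Q.id)
        (Q.comp (n ≫ Q.bang) qR (hbang _ qR hqR))
        (by rw [hbd _ qR hqR, hidd]) (hidc _) (by rw [Q.comp_cod, hqRc])
      have hed₂ : e' ≫ Q.dom = n := by rw [hed'', hidd]
      have move₂ : ∀ (a b : K ⟶ Q.hom) (ha : a ≫ Q.cod = n) (_ : a ≫ Q.dom = zero K)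
          (hb : b ≫ Q.cod = n ≫ N.succ), Q.comp b (n ≫ Q.projL) (hL b hb) = a →
          Q.comp b (n ≫ Q.projR) (hR b hb) = qR → Q.comp a e' (by rw [ha, hed₂]) = b := by
        intro a b ha ha' hb hbL hbR
        refine Q.pair_ext n (by rw [Q.comp_cod, he']) hb ?_ ?_
        · rw [Q.assoc _ _ _ _ (hL e' he'), hbL]
          exact (comp_congr _ rfl heL' _).trans (hid a _ ha)
        · rw [Q.assoc _ _ _ _ (hR e' he'), hbR]
          exact (comp_congr _ rfl heR' _).trans (hconst qR a _ hqR ha' ha)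
      have hey : e ≫ Q.cod = y ≫ Y.p := he.trans hy.symm
      have hey' : e' ≫ Q.cod = y ≫ Y.p := he'.trans hy.symm
      have hpR' : pR ≫ Q.cod = e ≫ Q.dom := by rw [hpRc, hed']
      have hqR' : qR ≫ Q.cod = e ≫ Q.dom := by rw [hqRc, hed']
      have hpL' : pL ≫ Q.cod = e' ≫ Q.dom := by rw [hpLc, hed₂]
      have hqL' : qL ≫ Q.cod = e' ≫ Q.dom := by rw [hqLc, hed₂]
      -- From `p` to `s` along the `1`-cube given by `e`, where `h₁` applies, and from `s` to `q` in
      -- the `n`-cube given by `e'`, where the induction hypothesis applies.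
      rw [← vertexVal_act c y e hey pR p hpR hpR' (move₁ pR p hpRc hpR hpn rfl rfl),
        h₁ _ pR qR hpR hqR _ (by rw [Y.act_p, hqR']) (by rw [Y.act_p, hed']),
        vertexVal_act c y e hey qR s hqR hqR' (move₁ qR s hqRc hqR hs hsL hsR),
        ← vertexVal_act c y e' hey' pL s hpL hpL' (move₂ pL s hpLc hpL hs hsL hsR),
        ih' _ pL qL hpL hqL _ (by rw [Y.act_p, hqL']) (by rw [Y.act_p, hed₂]),
        vertexVal_act c y e' hey' qL q hqL hqL' (move₂ qL q hqLc hqL hqn rfl rfl)]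
  obtain ⟨m, e₁, e₂, e₃⟩ := hex y p q hpd hqd hpc hqc
  have := congrArg (m ≫ ·) key
  simp only [α, β] at this
  rw [← Category.assoc, ← Category.assoc, vertexVal_natural, vertexVal_natural] at this
  refine Eq.trans (vertexVal_congr _ _ _ _ _ ?_) (this.trans (vertexVal_congr _ _ _ _ _ ?_))
  · exact Y.act_congr e₁.symm e₂.symm _
  · exact Y.act_congr (by rw [← e₁, Category.assoc, Category.assoc, hm]) e₃ _

end Invariance

end Cubes

section Cubes

open CubeCat Psh

variable {E : Type u} [Category.{v} E] [HasFiniteLimits E] [FinitaryExtensive E] {N : NatObj E}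
  {Q : CubeCat N} {K : KanData Q}

/-! ### Maps into coproducts -/

/-- A map into a coproduct that does not meet the second summand at any point factors through the
first summand. -/
theorem exists_factor_inl {R S W Z : CSet Q} {i : R ⟶ W} {j : S ⟶ W}
    (hc : IsColimit (BinaryCofan.mk i j)) (x : Z ⟶ W)
    (h : ∀ {L : E} (z : L ⟶ Z.obj) (s : L ⟶ S.obj), z ≫ Z.p = zero L →
      z ≫ x.app = s ≫ j.app → Nonempty (L ⟶ ⊥_ E)) :
    ∃ y : Z ⟶ R, y ≫ i = x := by
  obtain ⟨hc'⟩ := isColimit_app hc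
  obtain ⟨o, ho, ho'⟩ := Q.exists_origin
  have := sum_mono_inl hc'
  -- An element of any stage that lies in `S` would have its origin in `S`, so the hypothesis on
  -- points excludes it.
  obtain ⟨y, hy⟩ := sum_factor_inl hc' x.app (fun {L} a s e => by
    have hp : a ≫ Z.p = s ≫ S.p := by
      rw [← x.app_p, ← Category.assoc, e, Category.assoc, j.app_p]
    have hz : (a ≫ Z.p ≫ o) ≫ Q.cod = a ≫ Z.p := by
      rw [Category.assoc, Category.assoc, ho', Category.comp_id]
    refine h (Z.act a (a ≫ Z.p ≫ o) hz) (S.act s (a ≫ Z.p ≫ o) (hz.trans hp)) ?_ ?_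
    · rw [Z.act_p, Category.assoc, Category.assoc, ho, comp_zeroObj, comp_zeroObj]
    · rw [x.app_act, j.app_act]
      exact W.act_congr e rfl _)
  have hyp : y ≫ R.p = Z.p := by rw [← i.app_p, ← Category.assoc, hy, x.app_p]
  refine ⟨⟨y, hyp, fun {J} z s hs => ?_⟩, Psh.hom_ext hy⟩
  rw [← cancel_mono i.app, Category.assoc, hy, x.app_act, i.app_act]
  exact W.act_congr (by rw [Category.assoc, hy]) rfl _

/-! ### Points of constant cubical sets -/

theorem comp_ofPt (X : CSet Q) {J L : E} (x : L ⟶ X.obj) (hx : x ≫ X.p = zero L)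
    (l : J ⟶ ((CSet.Δ Q).obj L).obj) (hl : l ≫ ((CSet.Δ Q).obj L).p = zero J) :
    l ≫ (ofPt X x hx).app = (l ≫ constVal Q L) ≫ x := by
  rw [← constElt_zero_ofPt X x hx]
  refine congrArg (· ≫ _) (const_elt_ext ?_ ?_)
  · rw [constElt_val]
  · rw [constElt_p, hl]

theorem constElt_map {J L M : E} (l : J ⟶ L) (n : J ⟶ N.nat) (f : L ⟶ M) :
    constElt Q l n ≫ ((CSet.Δ Q).map f).app = constElt Q (l ≫ f) n := by
  apply const_elt_ext
  · rw [Category.assoc, const_map_val, ← Category.assoc, constElt_val, constElt_val]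
  · rw [Category.assoc, ((CSet.Δ Q).map f).app_p, constElt_p, constElt_p]

/-! ### Points of truncations, negations and dependent products -/

/-- If a truncation has a section, the truncated family is inhabited at each point. -/
theorem IsTruncation.exists_point [LocallyCartesianClosed E] {W T Z : CSet Q} {w : W ⟶ Z}
    {t : T ⟶ Z} (h : IsTruncation K w t) (c : Z ⟶ T) (hc : c ≫ t = 𝟙 Z) {L : E} (z : L ⟶ Z.obj)
    (hz : z ≫ Z.p = zero L) : ∃ s : L ⟶ W.obj, s ≫ w.app = z := by
  -- `D` is cofree on the fibre of `W` over `z`. It is an h-proposition over `Δ L`, so the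
  -- truncation reindexed along `σ` can be eliminated into it.
  obtain ⟨D⟩ := nonempty_pointFamily (Q := Q) (pullback.snd w.app z)
  let σ := ofPt Z z hz
  have hk : (ptVal (pb w σ) ≫ (pbFst w σ).app) ≫ w.app =
      (ptVal (pb w σ) ≫ (pbSnd w σ).app ≫ constVal Q L) ≫ z := by
    have e := congrArg Psh.Hom.app (pb_condition w σ)
    rw [comp_app, comp_app] at e
    rw [Category.assoc, e, ← Category.assoc, ← Category.assoc (ptVal _)]
    refine comp_ofPt Z z hz _ ?_
    rw [Category.assoc, (pbSnd w σ).app_p, ptVal_p]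
  -- The reindexed `W` maps to `D`, because each of its points lies in the fibre in question.
  obtain ⟨u, hu, -⟩ := D.exists_lift (pbSnd w σ) (pullback.lift _ _ hk) (pullback.lift_snd _ _ _)
  obtain ⟨v, hv⟩ := h.2.2 σ (pbFst w σ) (pbSnd w σ) (pbFst t σ) (pbSnd t σ) D.proj
    (isPullback_pb _ _) (isPullback_pb _ _) D.isHProp_proj ⟨u, hu⟩
  have hs : (σ ≫ c) ≫ t = 𝟙 _ ≫ σ := by
    rw [Category.assoc, hc, Category.comp_id, Category.id_comp]
  let k := (isPullback_pb t σ).lift _ _ hs ≫ v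
  have hkp : k ≫ D.proj = 𝟙 _ := by
    rw [Category.assoc, hv, IsPullback.lift_snd]
  have hkp' := congrArg Psh.Hom.app hkp
  rw [comp_app, id_app] at hkp'
  have hgen : (genPt Q L ≫ k.app) ≫ D.proj.app ≫ constVal Q L = 𝟙 L := by
    rw [Category.assoc, ← Category.assoc k.app, hkp', Category.id_comp, constElt_val]
  -- At stage `[0]`, the section `k` of `D` is an actual element of the fibre.
  refine ⟨D.evPt (genPt Q L ≫ k.app) ?_ ≫ pullback.fst w.app z, ?_⟩
  · rw [Category.assoc, k.app_p, constElt_p]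
  · rw [Category.assoc, pullback.condition, ← Category.assoc, D.evPt_base, hgen,
      Category.id_comp]

/-- Elements of `X` and `¬X` over the same element of `Y` form an element of the pullback, which
maps to the initial cubical set, whose underlying object is empty. -/
theorem IsNegation.empty {X Y NX : CSet Q} {f : X ⟶ Y} {ν : NX ⟶ Y} (h : IsNegation f ν) {L : E}
    (x : L ⟶ X.obj) (n : L ⟶ NX.obj) (e : x ≫ f.app = n ≫ ν.app) : Nonempty (L ⟶ ⊥_ E) := by
  obtain ⟨O, hO, h, -⟩ := h
  obtain ⟨k⟩ := h (pbFst ν f) (pbSnd ν f) (isPullback_pb ν f)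
  obtain ⟨z⟩ := empty_of_isInitial hO
  exact ⟨pullback.lift n x e.symm ≫ k.app ≫ z⟩

/-- The universal property speaks of maps on `Δ L × Δ A`, whereas `ρ` gives a map on `Δ (L × A)`;
the comparison map `θ` bridges the two. The transpose is then evaluated at the canonical point. -/
theorem IsDependentProduct.exists_point {Y R D : CSet Q} {A : E}
    {r : R ⟶ Y.prod ((CSet.Δ Q).obj A)} {d : D ⟶ Y} (h : IsDependentProduct r d) {L : E}
    (y : L ⟶ Y.obj) (hy : y ≫ Y.p = zero L) (ρ : L ⨯ A ⟶ R.obj)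
    (hρ : ρ ≫ r.app ≫ (Psh.fst _ _).app = Limits.prod.fst ≫ y)
    (hρ' : ρ ≫ r.app ≫ (Psh.snd _ _).app = constElt Q Limits.prod.snd (zero _)) :
    ∃ x : L ⟶ D.obj, x ≫ d.app = y := by
  obtain ⟨ev, -, h⟩ := h
  have hp : ρ ≫ R.p = zero _ := by
    rw [← r.app_p, ← (Psh.fst _ _).app_p, ← Category.assoc r.app, ← Category.assoc, hρ,
      Category.assoc, hy, comp_zeroObj]
  let P := ((CSet.Δ Q).obj L).prod ((CSet.Δ Q).obj A)
  let φ : P ⟶ (CSet.Δ Q).obj L := Psh.fst _ _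
  let ψ : P ⟶ (CSet.Δ Q).obj A := Psh.snd _ _
  let θ : P ⟶ (CSet.Δ Q).obj (L ⨯ A) :=
    constLift (Limits.prod.lift (φ.app ≫ constVal Q L) (ψ.app ≫ constVal Q A)) (fun x s hs => by
      rw [Limits.prod.comp_lift, Limits.prod.comp_lift, act_const_val φ, act_const_val ψ])
  have hθ₁ : θ ≫ (CSet.Δ Q).map Limits.prod.fst = φ := by
    apply to_const_hom_ext
    rw [comp_app, Category.assoc, const_map_val, ← Category.assoc, constLift_val,
      Limits.prod.lift_fst]
  have hθ₂ : θ ≫ (CSet.Δ Q).map Limits.prod.snd = ψ := by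
    apply to_const_hom_ext
    rw [comp_app, Category.assoc, const_map_val, ← Category.assoc, constLift_val,
      Limits.prod.lift_snd]
  have e₁ : ofPt R ρ hp ≫ r ≫ Psh.fst _ _ = (CSet.Δ Q).map Limits.prod.fst ≫ ofPt Y y hy := by
    apply const_hom_ext
    rw [comp_app, comp_app, comp_app, ← Category.assoc, genPt_ofPt, hρ, ← Category.assoc,
      constElt_map, Category.id_comp, constElt_zero_ofPt]
  have e₂ : ofPt R ρ hp ≫ r ≫ Psh.snd _ _ = (CSet.Δ Q).map Limits.prod.snd := by
    apply const_hom_ext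
    rw [comp_app, comp_app, ← Category.assoc, genPt_ofPt, hρ', constElt_map, Category.id_comp]
  obtain ⟨k, ⟨hk, -⟩, -⟩ := h (ofPt Y y hy) (θ ≫ ofPt R ρ hp) (by
    apply Psh.prod_hom_ext
    · rw [map_fst, Category.assoc, Category.assoc, e₁, ← Category.assoc, hθ₁]
    · rw [map_snd, Category.assoc, Category.assoc, e₂, hθ₂, Category.comp_id])
  refine ⟨genPt Q L ≫ k.app, ?_⟩
  rw [Category.assoc, ← comp_app, hk, genPt_ofPt]

/-! ### Weakly `Π⁰₁` h-propositions -/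

section WeaklyPi01

variable {X Y : CSet Q} {f : X ⟶ Y}

/-- There is a function on the points of the base that decides the stages of a weakly `Π⁰₁`
h-proposition. -/
theorem IsWeaklyPi01.exists_decision [LocallyCartesianClosed E] (hf : IsWeaklyPi01 K f) :
    ∃ g : (CSet.Γ Q).obj Y ⨯ N.nat ⟶ Two E, ∀ {J : E} (y : J ⟶ (CSet.Γ Q).obj Y),
      prod.map y (𝟙 N.nat) ≫ g = terminal.from (J ⨯ N.nat) ≫ coprod.inl ↔
        ∃ x : J ⟶ X.obj, x ≫ f.app = y ≫ ptVal Y := by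
  obtain ⟨-, R, r, -, ⟨NX, S, W, T, ν, k, s, w, t, hν, hk, ⟨i, j, ⟨hc⟩, hi, hj⟩, ht, c, hct⟩,
    D, d, hd, -, b, hb⟩ := hf
  obtain ⟨hc'⟩ := isColimit_app hc
  have hz : ((Limits.prod.fst : (CSet.Γ Q).obj Y ⨯ N.nat ⟶ _) ≫ ptVal Y) ≫ Y.p =
      constElt Q (Limits.prod.snd : (CSet.Γ Q).obj Y ⨯ N.nat ⟶ _) (zero _) ≫
        ((CSet.Δ Q).obj N.nat).p := by
    rw [comp_ptVal_p, constElt_p]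
  -- The choice of an element of `R + ¬X` over the generic point. The map `δ` then records its
  -- summand: `0` for `R`, `1` for `¬X`.
  obtain ⟨s₀, hs₀⟩ := ht.exists_point c hct (pairElt _ _ hz) (by rw [pairElt_p, constElt_p])
  obtain ⟨δ, hδ₁, hδ₂⟩ : ∃ δ : W.obj ⟶ Two E, i.app ≫ δ = terminal.from R.obj ≫ coprod.inl ∧
      j.app ≫ δ = terminal.from S.obj ≫ coprod.inr :=
    let δ := BinaryCofan.IsColimit.desc' hc' (terminal.from R.obj ≫ coprod.inl)
      (terminal.from S.obj ≫ (coprod.inr : ⊤_ E ⟶ Two E))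
    ⟨δ.1, δ.2.1, δ.2.2⟩
  have hi' : i.app ≫ w.app = r.app := congrArg Psh.Hom.app hi
  have hj' : j.app ≫ w.app = s.app := congrArg Psh.Hom.app hj
  have hk' : k.app ≫ ν.app = s.app ≫ (Psh.fst _ _).app := congrArg Psh.Hom.app hk.w
  refine ⟨s₀ ≫ δ, fun {J} y => ⟨fun h => ?_, ?_⟩⟩
  -- If the sequence vanishes, the chosen elements all lie in `R`; together they form a point of the
  -- dependent product, hence of `X`.
  · obtain ⟨ρ, hρ⟩ := sum_factor_inl hc' (prod.map y (𝟙 N.nat) ≫ s₀) (fun {L} a z e => by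
      refine sum_disjoint (coprodIsCoprod (⊤_ E) (⊤_ E)) (terminal.from L) (terminal.from L) ?_
      have e' := congrArg (· ≫ δ) e
      simp only [Category.assoc, hδ₂, h] at e'
      rw [← Category.assoc, ← Category.assoc, Subsingleton.elim (a ≫ _) (terminal.from L),
        Subsingleton.elim (z ≫ _) (terminal.from L)] at e'
      exact e')
    have hρ' : ρ ≫ r.app = prod.map y (𝟙 N.nat) ≫ pairElt _ _ hz := by
      rw [← hi', ← Category.assoc, hρ, Category.assoc, hs₀]
    obtain ⟨x, hx⟩ := hd.exists_point (y ≫ ptVal Y) (comp_ptVal_p y) ρ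
      (by rw [← Category.assoc, hρ', Category.assoc, pairElt_fst, ← Category.assoc,
        Limits.prod.map_fst, Category.assoc])
      (by rw [← Category.assoc, hρ', Category.assoc, pairElt_snd, comp_constElt,
        Limits.prod.map_snd, Category.comp_id, comp_zeroObj])
    refine ⟨x ≫ b.app, ?_⟩
    rw [Category.assoc, ← comp_app, hb, hx]
  -- A point of `X` over `y` excludes `¬X`, so the chosen elements lie in `R`.
  · rintro ⟨x, hx⟩
    obtain ⟨ρ, hρ⟩ := sum_factor_inl hc' (prod.map y (𝟙 N.nat) ≫ s₀) (fun {L} a z e => by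
      refine hν.empty ((a ≫ Limits.prod.fst) ≫ x) (z ≫ k.app) ?_
      rw [Category.assoc z, hk', ← hj', Category.assoc j.app, ← Category.assoc z, ← e,
        Category.assoc _ x, hx]
      simp only [Category.assoc]
      rw [← Category.assoc s₀, hs₀, pairElt_fst, prod.map_fst_assoc])
    rw [← Category.assoc, ← hρ, Category.assoc, hδ₁, ← Category.assoc]
    exact congrArg (· ≫ coprod.inl) (Subsingleton.elim _ _)

/-- A weakly `Π⁰₁` h-proposition has a section along each map at whose points it is inhabited. -/
theorem IsWeaklyPi01.exists_lift (hf : IsWeaklyPi01 K f) {V : CSet Q} (l : V ⟶ Y)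
    (hl : ∀ {L : E} (v : L ⟶ V.obj), v ≫ V.p = zero L →
      ∃ x : L ⟶ X.obj, x ≫ f.app = v ≫ l.app) : ∃ b : V ⟶ X, b ≫ f = l := by
  obtain ⟨-, R, r, hr, ⟨NX, S, W, T, ν, k, s, w, t, hν, hk, ⟨i, j, ⟨hc⟩, hi, hj⟩, ht, c, hct⟩,
    D, d, ⟨ev, -, hd⟩, -, b, hb⟩ := hf
  let σ : V.prod ((CSet.Δ Q).obj N.nat) ⟶ Y.prod ((CSet.Δ Q).obj N.nat) := Psh.map l (𝟙 _)
  have hj' : j.app ≫ w.app = s.app := congrArg Psh.Hom.app hj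
  have hk' : k.app ≫ ν.app = s.app ≫ (Psh.fst _ _).app := congrArg Psh.Hom.app hk.w
  have hσ : σ.app ≫ (Psh.fst _ _).app = (Psh.fst _ _).app ≫ l.app :=
    congrArg Psh.Hom.app (map_fst l (𝟙 _))
  have hw : (pbFst w σ).app ≫ w.app = (pbSnd w σ).app ≫ σ.app :=
    congrArg Psh.Hom.app (pb_condition w σ)
  -- Over `V`, no point of the sum comes from `¬X`, so the whole reindexed sum factors through `R`.
  obtain ⟨y, hy⟩ := exists_factor_inl hc (pbFst w σ) (fun {L} z s' hz e => by
    obtain ⟨x, hx⟩ := hl (z ≫ (pbSnd w σ).app ≫ (Psh.fst _ _).app) (by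
      rw [Category.assoc, Category.assoc, (Psh.fst _ _).app_p, (pbSnd w σ).app_p, hz])
    refine hν.empty x (s' ≫ k.app) ?_
    rw [Category.assoc, hk', ← hj', Category.assoc, ← Category.assoc s', ← e, hx, Category.assoc,
      Category.assoc, Category.assoc, ← hσ, ← Category.assoc (pbFst w σ).app, hw, Category.assoc])
  have hyr : y ≫ r = pbSnd w σ ≫ σ := by
    rw [← hi, ← Category.assoc, hy, pb_condition]
  -- The reindexed `R` is an h-proposition, so the truncation maps to it, and the section `c`
  -- becomes a section of `R` over `V × Δ ℕ`. Its transpose is a map to the dependent product.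
  obtain ⟨u, hu⟩ := ht.2.2 σ (pbFst w σ) (pbSnd w σ) (pbFst t σ) (pbSnd t σ) (pbSnd r σ)
    (isPullback_pb _ _) (isPullback_pb _ _) (hr.of_isPullback (isPullback_pb r σ))
    ⟨(isPullback_pb r σ).lift y (pbSnd w σ) hyr, IsPullback.lift_snd _ _ _ _⟩
  have hs : (σ ≫ c) ≫ t = 𝟙 _ ≫ σ := by
    rw [Category.assoc, hct, Category.comp_id, Category.id_comp]
  obtain ⟨h, ⟨hh, -⟩, -⟩ := hd l ((isPullback_pb t σ).lift _ _ hs ≫ u ≫ pbFst r σ) (by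
    rw [Category.assoc, Category.assoc, pb_condition, ← Category.assoc u, hu, ← Category.assoc,
      IsPullback.lift_snd, Category.id_comp])
  exact ⟨h ≫ b, by rw [Category.assoc, hb, hh]⟩

/-- A truth value on points that classifies a weakly `Π⁰₁` h-proposition extends to a map of
cubical sets. -/
theorem IsWeaklyPi01.exists_classifyingMap [LocallyCartesianClosed E] (hf : IsWeaklyPi01 K f)
    {Ω : E} {t : ⊤_ E ⟶ Ω} (hΩ : IsPi01Classifier N t) :
    ∃ χ : Y ⟶ (CSet.Δ Q).obj Ω, toConstTerminal X ≫ (CSet.Δ Q).map t = f ≫ χ ∧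
      ∀ {L : E} (y : L ⟶ Y.obj), y ≫ Y.p = zero L →
        y ≫ χ.app ≫ constVal Q Ω = terminal.from L ≫ t → ∃ x : L ⟶ X.obj, x ≫ f.app = y := by
  obtain ⟨g, hg⟩ := hf.exists_decision
  obtain ⟨χ, hχ, hinv⟩ := hΩ.exists_truthValue N
    (fun {J} (y : J ⟶ (CSet.Γ Q).obj Y) => ∃ x : J ⟶ X.obj, x ≫ f.app = y ≫ ptVal Y) g hg
  obtain ⟨o, ho, ho'⟩ := Q.exists_origin
  obtain ⟨⟨hK, -⟩, R, r, -, ⟨NX, S, W, T, ν, k, s, w, t', ⟨O, hO, -⟩, -⟩, -⟩ := hf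
  -- Transport carries inhabitedness of the fibre from one vertex of a `1`-cube to another. It is
  -- stated after every reindexing `a`, as equality of truth values requires.
  have htr : ∀ {L : E} (y : L ⟶ Y.obj) (p q : L ⟶ Q.hom) (hpd : p ≫ Q.dom = zero L)
      (hqd : q ≫ Q.dom = zero L) (hpc : p ≫ Q.cod = y ≫ Y.p) (hqc : q ≫ Q.cod = y ≫ Y.p),
      y ≫ Y.p = one L → ∀ {M : E} (a : M ⟶ L),
        (∃ x : M ⟶ X.obj, x ≫ f.app = (a ≫ mkPt (Y.act y p hpc) (by rw [Y.act_p, hpd])) ≫ ptVal Y) →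
        ∃ x : M ⟶ X.obj, x ≫ f.app = (a ≫ mkPt (Y.act y q hqc) (by rw [Y.act_p, hqd])) ≫ ptVal Y := by
    rintro L y p q hpd hqd hpc hqc hy M a ⟨x, hx⟩
    rw [Category.assoc, mkPt_val, Y.act_natural] at hx
    obtain ⟨x', hx'⟩ := IsKanFibration.exists_transport hK hO (a ≫ y) (a ≫ p) (a ≫ q)
      (by rw [Category.assoc, hpd, comp_zeroObj]) (by rw [Category.assoc, hqd, comp_zeroObj])
      (by rw [Category.assoc, hpc, hy, comp_oneObj]) (by rw [Category.assoc, hqc, hy, comp_oneObj])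
      (by rw [Category.assoc, hpc, Category.assoc]) (by rw [Category.assoc, hqc, Category.assoc])
      x hx
    exact ⟨x', by rw [Category.assoc, mkPt_val, Y.act_natural, hx']⟩
  have hvert : ∀ {L : E} (y : L ⟶ Y.obj) (p q : L ⟶ Q.hom) (hpd : p ≫ Q.dom = zero L)
      (hqd : q ≫ Q.dom = zero L) (hpc : p ≫ Q.cod = y ≫ Y.p) (hqc : q ≫ Q.cod = y ≫ Y.p),
      vertexVal χ y p hpd hpc = vertexVal χ y q hqd hqc := vertexVal_eq χ
    (fun y p q hpd hqd hpc hqc hy =>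
    hinv _ _ fun a => ⟨htr y p q hpd hqd hpc hqc hy a, htr y q p hqd hpd hqc hpc hy a⟩)
  have hod : ∀ {L : E} (y : L ⟶ Y.obj), (y ≫ Y.p ≫ o) ≫ Q.dom = zero L := fun y => by
    rw [Category.assoc, Category.assoc, ho, comp_zeroObj, comp_zeroObj]
  have hoc : ∀ {L : E} (y : L ⟶ Y.obj), (y ≫ Y.p ≫ o) ≫ Q.cod = y ≫ Y.p := fun y => by
    rw [Category.assoc, Category.assoc, ho', Category.comp_id]
  -- The truth value of a cube is read off at its origin. By `hvert` any other vertex would do, so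
  -- it is invariant under restriction.
  let χ' : Y.obj ⟶ Ω := vertexVal χ (𝟙 _) (𝟙 _ ≫ Y.p ≫ o) (hod _) (hoc _)
  have hχ' : ∀ {L : E} (y : L ⟶ Y.obj), y ≫ χ' = vertexVal χ y (y ≫ Y.p ≫ o) (hod y) (hoc y) := by
    intro L y
    refine (vertexVal_natural χ y _ _ _ _).trans (vertexVal_congr _ _ _ _ _ ?_)
    exact Y.act_congr (Category.comp_id y) (by rw [Category.id_comp]) _
  have hact : ∀ {J : E} (x : J ⟶ Y.obj) (s : J ⟶ Q.hom) (h : s ≫ Q.cod = x ≫ Y.p),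
      Y.act x s h ≫ χ' = x ≫ χ' := by
    intro J x s h
    rw [hχ', hχ', vertexVal_act χ x s h _ _ (hod _) ((hoc _).trans (Y.act_p _ _ _)) rfl]
    exact hvert _ _ _ _ _ _ _
  refine ⟨constLift χ' hact, to_const_hom_ext ?_, fun {L} y hy h => ?_⟩
  · rw [comp_app, comp_app, Category.assoc, Category.assoc, const_map_val, constLift_val, hχ']
    have hX : (X.p ≫ o) ≫ Q.cod = 𝟙 _ ≫ X.p := by
      rw [Category.assoc, ho', Category.comp_id, Category.id_comp]
    have e := (hχ (mkPt (Y.act f.app (f.app ≫ Y.p ≫ o) (hoc _))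
      ((Y.act_p _ _ _).trans (hod _)))).2 ⟨X.act (𝟙 _) (X.p ≫ o) hX, by
        rw [f.app_act, mkPt_val]
        exact Y.act_congr (Category.id_comp _) (by rw [← Category.assoc, f.app_p]) _⟩
    refine ((Category.assoc _ _ _).symm.trans (congrArg (· ≫ t) ?_)).trans e.symm
    exact Subsingleton.elim _ _
  · rw [constLift_val, hχ'] at h
    obtain ⟨x, hx⟩ := (hχ _).1 h
    rw [mkPt_val] at hx
    refine ⟨x, hx.trans ?_⟩
    refine act_zero_bang Y y hy _ ?_ _
    refine Q.eq_of_cod_zero ((hoc y).trans hy) ?_ ?_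
    · rw [Category.assoc, Q.bang_cod, comp_zeroObj]
    · rw [hod, Category.assoc, Q.bang_dom, Category.comp_id]

end WeaklyPi01

end Cubes

end CubicalHProp

end

/-! ### The equivalence with the pullback along the classifying map -/

theorem mainTheorem4 {E : Type u} [Category.{v} E] [Regular E]
    [CubicalHProp.LocallyCartesianClosed E] [FinitaryExtensive E] (N : CubicalHProp.NatObj E)
    (Q : CubicalHProp.CubeCat N) (K : CubicalHProp.KanData Q)
    {Ω : E} (t : ⊤_ E ⟶ Ω) (hΩ : CubicalHProp.IsPi01Classifier N t)
    {X Y : CubicalHProp.CSet Q} (f : X ⟶ Y) (hf : CubicalHProp.IsWeaklyPi01 K f) :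
    CubicalHProp.IsHomotopyPullbackOf K f ((CubicalHProp.CSet.Δ Q).map t) := by
  open CubicalHProp CubicalHProp.Psh in
  obtain ⟨χ, hX, hχ⟩ := hf.exists_classifyingMap hΩ
  have hV := isPullback_pb ((CSet.Δ Q).map t) χ
  -- Points of the pullback have truth value `t`, so the fibres of `X` over them are inhabited.
  obtain ⟨b, hb⟩ := hf.exists_lift (pbSnd ((CSet.Δ Q).map t) χ) fun {L} v hv => by
    refine hχ _ (by rw [Category.assoc, (pbSnd _ χ).app_p, hv]) ?_
    have e : (pbFst ((CSet.Δ Q).map t) χ).app ≫ ((CSet.Δ Q).map t).app =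
        (pbSnd ((CSet.Δ Q).map t) χ).app ≫ χ.app := congrArg Psh.Hom.app hV.w
    rw [Category.assoc, ← Category.assoc (pbSnd _ χ).app, ← e, Category.assoc, const_map_val,
      ← Category.assoc, ← Category.assoc]
    exact congrArg (· ≫ t) (Subsingleton.elim _ _)
  have ha : hV.lift _ f hX ≫ pbSnd _ χ = f := hV.lift_snd _ _ _
  refine ⟨hf.1.1, isKanFibration_const_point t, χ, _, _, _, hV, hV.lift _ f hX, b, ha, hb,
    hf.1.fibrewiseHomotopic _ _ ?_, ?_⟩
  · rw [Category.assoc, hb, ha, Category.id_comp]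
  -- This composite is equal to the identity, not merely homotopic: maps into the pullback are
  -- determined by their projection to `Y`, as `Δ 1` is terminal.
  · have e : b ≫ hV.lift _ f hX = 𝟙 _ := by
      apply hV.hom_ext
      · exact to_const_terminal_hom_ext _ _
      · rw [Category.assoc, ha, hb, Category.id_comp]
    rw [e]
    exact FibrewiseHomotopic.refl _ _
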